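/- **Conventions.** For a Euclidean space $V$ of dimension $n$ with orthonormal coordinates $x_1,\dots,x_n$, let $\xi_1,\dots,\xi_n$ be coordinates on a second copy of $V$. A super form of bidegree $(a,b)$ is $\alpha=\sum_{|I|=a,|J|=b}\alpha_{IJ}(x)\,dx_I\wedge d\xi_J$, an element of the exterior algebra on $dx_i,d\xi_i$ with coefficients that are functions on $V$. $J$ denotes the algebra homomorphism exchanging $dx_i$ and $d\xi_i$, $d\alpha=\sum_i dx_i\wedge\partial_{x_i}\alpha$, $d^{\#}=J\circ d\circ J$, and $\int g\,\omega_n:=\int_V g\,dx$ for $\omega_n=dx_1\wedge d\xi_1\wedge\dots\wedge dx_n\wedge d\xi_n$. A $(p,p)$-current $T$ on $V$ is a continuous linear functional on the space of smooth compactly supported $(m,m)$-forms, $m=n-p$. It is closed if $\langle T,d\alpha\rangle=0$ for all smooth compactly supported $(m-1,m)$-forms $\alpha$ (no condition if $m=0$); it is positive if it is symmetric (that is, $\langle T,J\alpha\rangle=(-1)^m\langle T,\alpha\rangle$ for all $\alpha$) and $\langle T,(-1)^{m(m-1)/2}\beta\wedge J\beta\rangle\ge 0$ for all smooth compactly supported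 $(m,0)$-forms $\beta$. A linear map $\pi:V\to V'$ pulls super forms back by $\pi^*$, acting in the same way on the $dx_i$ and the $d\xi_i$. The Lelong class $\mathcal L$ consists of the convex functions $f:\mathbb R^n\to\mathbb R$ with $f(x)\le C|x|+D$ for some $C\ge0$, $D\in\mathbb R$. For convex $f_1,\dots,f_p$ on $\mathbb R^n$, the intersection product $dd^{\#}f_1\wedge\dots\wedge dd^{\#}f_p$ is the $(p,p)$-current $S$ with measure coefficients (a linear functional on the compactly supported $(n-p,n-p)$-forms with continuous coefficients, bounded in supremum norm on forms supported in a fixed compact set) such that $\langle S,\alpha\rangle=\lim_j\int dd^{\#}g_1^j\wedge\dots\wedge dd^{\#}g_p^j\wedge\alpha$ for every such form $\alpha$ and all sequences $(g_i^j)_j$ of smooth convex functions with $g_i^j\to f_i$ uniformly on compact sets. **Proposition.** Let $0\le p\le n$, let $L\subset\mathbb R^n$ be a linear subspace of dimension $n-k$, let $\pi:\mathbb R^n\to L$ be a linear projection onto $L$ (a linear map with $\pi|_L=\mathrm{id}_L$), and let $f_1,\dots,f_p\in\mathcal L$. Then the intersection product $S=dd^{\#}f_1\wedge\dots\wedge dd^{\#}f_p$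 exists and is unique, and the push-forward $\pi_*S$ is a well-defined $(p-k,p-k)$-current on $L$: there is exactly one continuous linear functional $T=\pi_*S$ on the smooth compactly supported $(n-p,n-p)$-forms on $L$ such that $$\langle T,\alpha\rangle=\lim_{R\to\infty}\langle S,\chi_R\,\pi^*\alpha\rangle$$ for every such form $\alpha$ and every family $(\chi_R)_{R\in\mathbb R}$ of continuous functions $\chi_R:\mathbb R^n\to[0,1]$ such that $\pi$ is proper on $\operatorname{supp}\chi_R$ for each $R$ (for example, $\chi_R$ has compact support) and $\chi_R\to1$ pointwise as $R\to\infty$. Moreover $\pi_*S$ is positive and closed, and if $p<k$ then $\pi_*S=0$. -/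

import Mathlib

open MeasureTheory Set Filter Topology TopologicalSpace Module
open scoped ContDiff Distributions CompactlySupported

namespace Super

section Algebra

variable (V : Type*) [NormedAddCommGroup V] [InnerProductSpace ℝ V]

/-- The algebra of constant super forms, i.e. the exterior algebra of the dual of `E = V × W` where
`W` is a second copy of `V`. The covector `(a, b)` stands for `∑ aᵢ dxᵢ + ∑ bᵢ dξᵢ`, and the product
of the algebra is the wedge product. -/
abbrev Covector : Type _ := ExteriorAlgebra ℝ (Dual ℝ V × Dual ℝ V)

/-- The differential in the `x` directions attached to a linear functional on `V`. -/
noncomputable def dx : Dual ℝ V →ₗ[ℝ] Covector V :=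
  ExteriorAlgebra.ι ℝ ∘ₗ LinearMap.inl ℝ (Dual ℝ V) (Dual ℝ V)

/-- The differential in the `ξ` directions attached to a linear functional on `V`. -/
noncomputable def dxi : Dual ℝ V →ₗ[ℝ] Covector V :=
  ExteriorAlgebra.ι ℝ ∘ₗ LinearMap.inr ℝ (Dual ℝ V) (Dual ℝ V)

/-- The constant forms of bidegree `(a, b)`: the span of the products of `a` differentials `dx` and
`b` differentials `dξ`. -/
noncomputable def bidegree (a b : ℕ) : Submodule ℝ (Covector V) :=
  LinearMap.range (dx V) ^ a * LinearMap.range (dxi V) ^ b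

/-- The algebra homomorphism `J` that exchanges `dxᵢ` and `dξᵢ`. -/
noncomputable def J : Covector V →ₐ[ℝ] Covector V :=
  ExteriorAlgebra.map (LinearEquiv.prodComm ℝ (Dual ℝ V) (Dual ℝ V)).toLinearMap

/-- The pull-back of constant forms under the extension of a linear map `V → V'` to `E → E'`. -/
noncomputable def pullback {V' : Type*} [NormedAddCommGroup V'] [InnerProductSpace ℝ V']
    (φ : V →ₗ[ℝ] V') : Covector V' →ₐ[ℝ] Covector V :=
  ExteriorAlgebra.map (φ.dualMap.prodMap φ.dualMap)

/-- The sign `(-1)^(k(k-1)/2)`. -/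
def sgn (k : ℕ) : ℝ := (-1) ^ (k * (k - 1) / 2)

theorem J_dx (a : Dual ℝ V) : J V (dx V a) = dxi V a := by
  simp [J, dx, dxi]

theorem J_dxi (a : Dual ℝ V) : J V (dxi V a) = dx V a := by
  simp [J, dx, dxi]

theorem pullback_dx {V' : Type*} [NormedAddCommGroup V'] [InnerProductSpace ℝ V']
    (φ : V →ₗ[ℝ] V') (a : Dual ℝ V') : pullback V φ (dx V' a) = dx V (a ∘ₗ φ) := by
  simp [pullback, dx, LinearMap.dualMap_apply']

theorem pullback_dxi {V' : Type*} [NormedAddCommGroup V'] [InnerProductSpace ℝ V']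
    (φ : V →ₗ[ℝ] V') (a : Dual ℝ V') : pullback V φ (dxi V' a) = dxi V (a ∘ₗ φ) := by
  simp [pullback, dxi, LinearMap.dualMap_apply']

theorem dxi_mul_dx (a b : Dual ℝ V) : dxi V a * dx V b = -(dx V b * dxi V a) :=
  eq_neg_of_add_eq_zero_left (ExteriorAlgebra.ι_add_mul_swap _ _)

theorem range_dxi_mul_range_dx :
    LinearMap.range (dxi V) * LinearMap.range (dx V) =
      LinearMap.range (dx V) * LinearMap.range (dxi V) := by
  apply le_antisymm
  · rw [Submodule.mul_le]
    rintro _ ⟨a, rfl⟩ _ ⟨b, rfl⟩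
    rw [dxi_mul_dx]
    exact Submodule.neg_mem _ (Submodule.mul_mem_mul ⟨b, rfl⟩ ⟨a, rfl⟩)
  · rw [Submodule.mul_le]
    rintro _ ⟨a, rfl⟩ _ ⟨b, rfl⟩
    rw [show dx V a * dxi V b = -(dxi V b * dx V a) by rw [dxi_mul_dx, neg_neg]]
    exact Submodule.neg_mem _ (Submodule.mul_mem_mul ⟨b, rfl⟩ ⟨a, rfl⟩)

theorem bidegree_swap (a b : ℕ) :
    LinearMap.range (dxi V) ^ b * LinearMap.range (dx V) ^ a = bidegree V a b :=
  ((show Commute (LinearMap.range (dxi V)) (LinearMap.range (dx V)) from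
    range_dxi_mul_range_dx V).pow_pow b a)

variable {V}

theorem mul_mem_bidegree {a b c d : ℕ} {u v : Covector V} (hu : u ∈ bidegree V a b)
    (hv : v ∈ bidegree V c d) : u * v ∈ bidegree V (a + c) (b + d) := by
  have h : bidegree V (a + c) (b + d) = bidegree V a b * bidegree V c d := by
    unfold bidegree
    rw [pow_add, pow_add, mul_assoc, mul_assoc, ← mul_assoc (_ ^ b) (_ ^ c),
      bidegree_swap V c b, bidegree, mul_assoc]
  rw [h]
  exact Submodule.mul_mem_mul hu hv

theorem dx_mem_bidegree (a : Dual ℝ V) : dx V a ∈ bidegree V 1 0 := by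
  simp [bidegree]

theorem J_mem_bidegree {a b : ℕ} {u : Covector V} (hu : u ∈ bidegree V a b) :
    J V u ∈ bidegree V b a := by
  have h1 : (LinearMap.range (dx V)).map (J V).toLinearMap = LinearMap.range (dxi V) := by
    rw [← LinearMap.range_comp]; congr 1; ext1 x; exact J_dx V x
  have h2 : (LinearMap.range (dxi V)).map (J V).toLinearMap = LinearMap.range (dx V) := by
    rw [← LinearMap.range_comp]; congr 1; ext1 x; exact J_dxi V x
  have h : (bidegree V a b).map (J V).toLinearMap = bidegree V b a := by
    rw [← bidegree_swap V b a, bidegree, Submodule.map_mul, Submodule.map_pow, Submodule.map_pow,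
      h1, h2]
  rw [← h]
  exact Submodule.mem_map_of_mem hu

theorem pullback_mem_bidegree {V' : Type*} [NormedAddCommGroup V'] [InnerProductSpace ℝ V']
    (φ : V →ₗ[ℝ] V') {a b : ℕ} {u : Covector V'} (hu : u ∈ bidegree V' a b) :
    pullback V φ u ∈ bidegree V a b := by
  have h1 : (LinearMap.range (dx V')).map (pullback V φ).toLinearMap ≤ LinearMap.range (dx V) := by
    rintro _ ⟨_, ⟨x, rfl⟩, rfl⟩
    exact ⟨x ∘ₗ φ, (pullback_dx V φ x).symm⟩
  have h2 : (LinearMap.range (dxi V')).map (pullback V φ).toLinearMap ≤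
      LinearMap.range (dxi V) := by
    rintro _ ⟨_, ⟨x, rfl⟩, rfl⟩
    exact ⟨x ∘ₗ φ, (pullback_dxi V φ x).symm⟩
  have h : (bidegree V' a b).map (pullback V φ).toLinearMap ≤ bidegree V a b := by
    rw [bidegree, Submodule.map_mul, Submodule.map_pow, Submodule.map_pow]
    exact mul_le_mul' (pow_le_pow_left' h1 a) (pow_le_pow_left' h2 b)
  exact h (Submodule.mem_map_of_mem hu)

end Algebra

section Analysis

variable (V : Type*) [NormedAddCommGroup V] [InnerProductSpace ℝ V] [FiniteDimensional ℝ V]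

/-- The basis `dx₁, dξ₁, dx₂, dξ₂, …, dxₙ, dξₙ` (in this order; `false` marks `dx`, `true` marks
`dξ`) for an orthonormal system of coordinates on `V`. -/
noncomputable def covectorBasis :
    Basis (Fin (finrank ℝ V) ×ₗ Bool) ℝ (Dual ℝ V × Dual ℝ V) :=
  ((stdOrthonormalBasis ℝ V).toBasis.dualBasis.prod
    (stdOrthonormalBasis ℝ V).toBasis.dualBasis).reindex
    ((Equiv.boolProdEquivSum _).symm.trans ((Equiv.prodComm _ _).trans toLex))

/-- The constant forms are a finite-dimensional space; it is normed by the largest coefficient. -/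
noncomputable instance : NormedAddCommGroup (Covector V) :=
  NormedAddCommGroup.induced (Covector V) (Finset (Fin (finrank ℝ V) ×ₗ Bool) → ℝ)
    (covectorBasis V).ExteriorAlgebra.equivFun (LinearEquiv.injective _)

noncomputable instance : NormedSpace ℝ (Covector V) :=
  NormedSpace.induced ℝ (Covector V) (Finset (Fin (finrank ℝ V) ×ₗ Bool) → ℝ)
    (covectorBasis V).ExteriorAlgebra.equivFun.toLinearMap

instance : FiniteDimensional ℝ (Covector V) :=
  (covectorBasis V).ExteriorAlgebra.finiteDimensional_of_finite

/-- The coefficient `c` of `c • ωₙ`, where `ωₙ = dx₁ ∧ dξ₁ ∧ … ∧ dxₙ ∧ dξₙ`. -/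
noncomputable def topCoeff : Covector V →ₗ[ℝ] ℝ :=
  (covectorBasis V).ExteriorAlgebra.coord Finset.univ

variable {V}

/-- The integral over `E` of an `(n, n)`-form `g • ωₙ`, which is the integral of `g` over `V`. -/
noncomputable def superIntegral [MeasurableSpace V] [BorelSpace V] (α : V → Covector V) : ℝ :=
  ∫ x, topCoeff V (α x)

/-- The operator `d`, that is `α ↦ ∑ᵢ dxᵢ ∧ ∂α/∂xᵢ`. -/
noncomputable def d (α : V → Covector V) (x : V) : Covector V :=
  ∑ i, dx V ((stdOrthonormalBasis ℝ V).toBasis.coord i) *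
    fderiv ℝ α x (stdOrthonormalBasis ℝ V i)

/-- The operator `d^# = J ∘ d ∘ J`. -/
noncomputable def dSharp (α : V → Covector V) (x : V) : Covector V :=
  J V (d (fun y => J V (α y)) x)

/-- The `(1, 1)`-form `d d^# g` of a smooth function `g`. -/
noncomputable def ddSharp (g : V → ℝ) : V → Covector V :=
  d (dSharp fun x => algebraMap ℝ (Covector V) (g x))

/-- The form `d d^# g₁ ∧ … ∧ d d^# gₚ` of smooth functions. -/
noncomputable def wedgeDDSharp {p : ℕ} (g : Fin p → V → ℝ) (x : V) : Covector V :=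
  (List.ofFn fun i => ddSharp (g i) x).prod

variable (V) in
/-- Smooth compactly supported `(a, b)`-forms, with the usual inductive limit topology. -/
abbrev TestForm (a b : ℕ) : Type _ := 𝓓((⊤ : Opens V), bidegree V a b)

variable (V) in
/-- Currents of bidimension `(a, b)`, i.e. of bidegree `(dim V - a, dim V - b)`. -/
abbrev Current (a b : ℕ) : Type _ := TestForm V a b →L[ℝ] ℝ

variable (V) in
/-- Compactly supported `(a, b)`-forms with continuous coefficients. -/
abbrev ContForm (a b : ℕ) : Type _ := C_c(V, bidegree V a b)

theorem contDiff_codRestrict {S : Submodule ℝ (Covector V)} {α : V → Covector V}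
    (h : ContDiff ℝ ∞ α) (hm : ∀ x, α x ∈ S) : ContDiff ℝ ∞ fun x => (⟨α x, hm x⟩ : S) := by
  obtain ⟨P, hP⟩ := S.subtype.exists_leftInverse_of_injective (Submodule.ker_subtype S)
  have : (fun x => (⟨α x, hm x⟩ : S)) = fun x => LinearMap.toContinuousLinearMap P (α x) := by
    funext x
    exact (LinearMap.congr_fun hP (⟨α x, hm x⟩ : S)).symm
  rw [this]
  exact (LinearMap.toContinuousLinearMap P).contDiff.comp h

theorem hasCompactSupport_codRestrict {S : Submodule ℝ (Covector V)} {α : V → Covector V}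
    (h : HasCompactSupport α) (hm : ∀ x, α x ∈ S) :
    HasCompactSupport fun x => (⟨α x, hm x⟩ : S) := by
  refine h.mono ?_
  intro x hx hx'
  exact hx (Subtype.ext hx')

/-- A smooth compactly supported function with values in the `(a, b)`-forms is a test form. -/
def TestForm.mk {a b : ℕ} (α : V → Covector V) (h : ContDiff ℝ ∞ α) (hc : HasCompactSupport α)
    (hm : ∀ x, α x ∈ bidegree V a b) : TestForm V a b :=
  ⟨fun x => ⟨α x, hm x⟩, contDiff_codRestrict h hm, hasCompactSupport_codRestrict hc hm,
    subset_univ _⟩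

theorem TestForm.contDiff_coe {a b : ℕ} (α : TestForm V a b) :
    ContDiff ℝ ∞ fun x => (α x : Covector V) :=
  (LinearMap.toContinuousLinearMap (bidegree V a b).subtype).contDiff.comp
    (TestFunction.contDiff α)

theorem TestForm.hasCompactSupport_coe {a b : ℕ} (α : TestForm V a b) :
    HasCompactSupport fun x => (α x : Covector V) :=
  (TestFunction.hasCompactSupport α).comp_left (g := ((↑) : bidegree V a b → Covector V)) rfl

theorem contDiff_mul {α β : V → Covector V} (hα : ContDiff ℝ ∞ α) (hβ : ContDiff ℝ ∞ β) :
    ContDiff ℝ ∞ fun x => α x * β x := by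
  let B : Covector V →L[ℝ] Covector V →L[ℝ] Covector V :=
    LinearMap.toContinuousLinearMap
      (LinearMap.toContinuousLinearMap.toLinearMap ∘ₗ LinearMap.mul ℝ (Covector V))
  exact (B.contDiff.comp hα).clm_apply hβ

/-- The test form `J(α)`. -/
noncomputable def TestForm.J {a b : ℕ} (α : TestForm V a b) : TestForm V b a :=
  TestForm.mk (fun x => Super.J V (α x))
    ((LinearMap.toContinuousLinearMap (Super.J V).toLinearMap).contDiff.comp α.contDiff_coe)
    (α.hasCompactSupport_coe.comp_left (map_zero (Super.J V)))
    (fun x => J_mem_bidegree (α x).2)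

/-- The test form `σₘ β ∧ J(β)` of an `(m, 0)`-form `β`. -/
noncomputable def TestForm.square {m : ℕ} (β : TestForm V m 0) : TestForm V m m :=
  TestForm.mk (fun x => sgn m • ((β x : Covector V) * Super.J V (β x)))
    (ContDiff.const_smul (sgn m) (contDiff_mul β.contDiff_coe
      ((LinearMap.toContinuousLinearMap (Super.J V).toLinearMap).contDiff.comp β.contDiff_coe)))
    (β.hasCompactSupport_coe.comp_left (g := fun u : Covector V => sgn m • (u * Super.J V u))
      (by simp))
    (fun x => Submodule.smul_mem _ _ (by
      simpa using mul_mem_bidegree (β x).2 (J_mem_bidegree (β x).2)))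

/-- The test form `dα`. -/
noncomputable def TestForm.d {a b c : ℕ} (h : c + 1 = a) (α : TestForm V c b) : TestForm V a b :=
  TestForm.mk (Super.d fun x => (α x : Covector V))
    (by
      unfold Super.d
      refine ContDiff.sum fun i _ => contDiff_mul contDiff_const ?_
      exact (α.contDiff_coe.fderiv_right (m := ∞) (by simp)).clm_apply contDiff_const)
    (by
      refine (α.hasCompactSupport_coe.fderiv ℝ).mono ?_
      intro x hx hx'
      exact hx (by simp [Super.d, hx']))
    (fun x => Submodule.sum_mem _ fun i _ => by
      have hd : fderiv ℝ (fun x => (α x : Covector V)) x (stdOrthonormalBasis ℝ V i) ∈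
          bidegree V c b := by
        have h1 : HasFDerivAt (fun x => (α x : Covector V))
            ((LinearMap.toContinuousLinearMap (bidegree V c b).subtype).comp (fderiv ℝ α x)) x :=
          (LinearMap.toContinuousLinearMap (bidegree V c b).subtype).hasFDerivAt.comp x
            ((TestFunction.contDiff α).differentiable (by simp) x).hasFDerivAt
        rw [h1.fderiv]
        exact (fderiv ℝ α x (stdOrthonormalBasis ℝ V i)).2
      have := mul_mem_bidegree (dx_mem_bidegree ((stdOrthonormalBasis ℝ V).toBasis.coord i)) hd
      rwa [zero_add, add_comm 1 c, h] at this)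

/-- `T` is closed: `⟨dT, α⟩ = ± ⟨T, dα⟩` vanishes for all test forms `α`. -/
def Current.IsClosed {a b : ℕ} (T : Current V a b) : Prop :=
  ∀ (c : ℕ) (h : c + 1 = a) (α : TestForm V c b), T (α.d h) = 0

/-- `T` is symmetric, i.e. `T_{IJ} = T_{JI}` for its coefficients. As `J(α) = (-1)^m α` for symmetric
`(m, m)`-forms and `J(α) = -(-1)^m α` for antisymmetric ones, this says that `T` vanishes on the
antisymmetric test forms. -/
def Current.IsSymmetric {m : ℕ} (T : Current V m m) : Prop :=
  ∀ α : TestForm V m m, T α.J = (-1) ^ m * T α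

/-- `T` is positive: it is symmetric and nonnegative on the forms `σₘ β ∧ J(β)`. -/
def Current.IsPositive {m : ℕ} (T : Current V m m) : Prop :=
  T.IsSymmetric ∧ ∀ β : TestForm V m 0, 0 ≤ T β.square

variable (V) in
/-- Currents of bidimension `(a, b)` whose coefficients are (locally finite signed Radon) measures:
linear functionals on the forms with continuous coefficients that are bounded, with respect to the
supremum norm, on the forms supported in a given compact set. -/
@[ext]
structure MeasureCurrent (a b : ℕ) where
  toLinearMap : ContForm V a b →ₗ[ℝ] ℝ
  bounded : ∀ K : Set V, IsCompact K → ∃ C : ℝ, ∀ α : ContForm V a b, tsupport α ⊆ K →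
    ∀ M : ℝ, (∀ x, ‖α x‖ ≤ M) → |toLinearMap α| ≤ C * M

variable (V) in
/-- The Lelong class: convex functions of at most linear growth. -/
def LelongClass : Set (V → ℝ) :=
  {f | ConvexOn ℝ univ f ∧ ∃ C D : ℝ, 0 ≤ C ∧ ∀ x, f x ≤ C * ‖x‖ + D}

/-- `g` is a sequence of smooth convex functions converging to `f` uniformly on compact sets. -/
def IsSmoothConvexApprox (f : V → ℝ) (g : ℕ → V → ℝ) : Prop :=
  (∀ j, ConvexOn ℝ univ (g j) ∧ ContDiff ℝ ∞ (g j)) ∧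
    ∀ K : Set V, IsCompact K → TendstoUniformlyOn g f atTop K

/-- `S` is the intersection product `d d^# f₁ ∧ … ∧ d d^# fₚ` of the convex functions `fᵢ`, i.e. the
limit of `d d^# g₁ʲ ∧ … ∧ d d^# gₚʲ`, in the space of currents with measure coefficients, for all
approximations of the `fᵢ` by smooth convex functions `gᵢʲ`. Here `m = dim V - p`. -/
def HasIntersectionProduct [MeasurableSpace V] [BorelSpace V] {p m : ℕ} (f : Fin p → V → ℝ)
    (S : MeasureCurrent V m m) : Prop :=
  ∀ g : Fin p → ℕ → V → ℝ, (∀ i, IsSmoothConvexApprox (f i) (g i)) → ∀ α : ContForm V m m,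
    Tendsto (fun j => superIntegral fun x => wedgeDDSharp (fun i => g i j) x * (α x : Covector V))
      atTop (𝓝 (S.toLinearMap α))

variable {V' : Type*} [NormedAddCommGroup V'] [InnerProductSpace ℝ V'] [FiniteDimensional ℝ V']

/-- A cutoff function for the map `π`: a continuous function with values in `[0, 1]` such that `π` is
proper on its support (for instance, a function with compact support). -/
structure IsCutoff (π : V →L[ℝ] V') (χ : V → ℝ) : Prop where
  continuous : Continuous χ
  mem_Icc : ∀ x, χ x ∈ Icc (0 : ℝ) 1
  proper : ∀ K : Set V', IsCompact K → IsCompact (tsupport χ ∩ π ⁻¹' K)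

/-- The continuous compactly supported form `χ π^* α`. -/
noncomputable def cutoffPullback {a b : ℕ} (π : V →L[ℝ] V') (χ : V → ℝ) (hχ : IsCutoff π χ)
    (α : TestForm V' a b) : ContForm V a b where
  toFun x := χ x • ⟨pullback V π.toLinearMap (α (π x)), pullback_mem_bidegree _ (α (π x)).2⟩
  continuous_toFun := by
    refine hχ.continuous.smul (Continuous.subtype_mk ?_ _)
    exact (LinearMap.toContinuousLinearMap (pullback V π.toLinearMap).toLinearMap).continuous.comp
      (α.contDiff_coe.continuous.comp π.continuous)
  hasCompactSupport' := by
    refine HasCompactSupport.intro (hχ.proper _ (TestFunction.hasCompactSupport α)) ?_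
    intro x hx
    by_cases h : x ∈ tsupport χ
    · have h0 : α (π x) = 0 := image_eq_zero_of_notMem_tsupport fun h' => hx ⟨h, h'⟩
      refine Subtype.ext ?_
      simp [h0]
    · rw [image_eq_zero_of_notMem_tsupport h, zero_smul]

/-- `T` is the push-forward `π_* S` defined by cutoff exhaustion: the weak limit as `R → ∞` of
`π_*(χ_R S)`, where `⟨π_*(χ S), α⟩ = ⟨S, χ π^* α⟩`, for all families of cutoff functions `χ_R` that
tend to `1` at every point. -/
def HasPushforward {a b : ℕ} (π : V →L[ℝ] V') (S : MeasureCurrent V a b) (T : Current V' a b) :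
    Prop :=
  ∀ (χ : ℝ → V → ℝ) (hχ : ∀ R, IsCutoff π (χ R)), (∀ x, Tendsto (fun R => χ R x) atTop (𝓝 1)) →
    ∀ α : TestForm V' a b,
      Tendsto (fun R => S.toLinearMap (cutoffPullback π (χ R) (hχ R) α)) atTop (𝓝 (T α))

end Analysis

end Super

/-!
Everything rests on a positivity property of constant forms. Call strongly positive the sums of
products of elementary forms `a(dx) ∧ a(dξ)`. If `Θ` is strongly positive of complementary bidegree,
then `(b, b') ↦ Θ ∧ σₘ b ∧ J(b')` is a positive semidefinite symmetric form (`topCoeff_nonneg`,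
`topCoeff_symm`), so the Cauchy–Schwarz inequality holds (`abs_topCoeff_le`). For convex `g` the form
`d d^# g` is strongly positive because the Hessian is positive semidefinite, and it is closed for both
`d` and `d^#`, so that `d d^#` can be integrated by parts against such forms
(`IsSmoothClosed.integral_mul_ddSharp`).

The intersection product. The Chern–Levine–Nirenberg inequality (`exists_chern_levine_nirenberg`)
bounds the mass of `d d^# g₁ ∧ … ∧ d d^# gₚ` on a ball by the suprema of the `gᵢ` on a larger one. Exchanging the functions
one at a time and integrating by parts shows that the pairing with a smooth, hence with a continuous
form, is uniformly continuous in the `gᵢ` for uniform convergence on a ball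
(`exists_uniform_continuity`). Convolution provides approximations, and so the limit exists, does not
depend on the approximation, and is bounded by the supremum of the form
(`existsUnique_intersectionProduct`).

The push-forward. The point is that for functions of linear growth the mass of
`d d^# g₁ ∧ … ∧ d d^# gₚ` against a horizontal form, one pulled back by `π`, is finite on all of
`π⁻¹(K)` for `K` compact (`exists_cylinder_bound`). Indeed, where a covector `a` is bounded,
`a(dx) ∧ a(dξ)` is dominated by `d d^# √(1 + a²)`, again of a function of linear growth; once all the
directions are used up in this way, the Chern–Levine–Nirenberg inequality on a ball of radius `R`
with suprema of size `R` gives a bound independent of `R`, and with `r` directions left a bound of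
order `Rʳ`. By polarization and the Riesz representation theorem the horizontal components of `S`
are differences of measures with finite mass over compact sets (`component_pullback_mem`), and
dominated convergence yields the push-forward (`existsUnique_pushforward`).

Positivity passes to the limit. For closedness, integration by parts leaves the term with the gradient
of a cutoff function of radius `R`. By the Cauchy–Schwarz inequality it is controlled by the geometric
mean of a mass of order `R⁻² · R`, where the gradient occurs twice and one direction is left, and a
bounded one, so it is of order `R^(-1/2)` (`exists_gradient_decay`). Finally, if `p < k`, then
`dim L < n - p`, and there are no nonzero test forms.
-/

namespace Super

/-! ### Constant forms and the top coefficient -/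

section ConstantForms

variable {V : Type*} [NormedAddCommGroup V] [InnerProductSpace ℝ V]

/-- The elementary positive `(1, 1)`-form `a(dx) ∧ a(dξ)` of a covector `a`. -/
noncomputable def elemForm (a : Dual ℝ V) : Covector V := dx V a * dxi V a

theorem bidegree_zero_right (m : ℕ) : bidegree V m 0 = LinearMap.range (dx V) ^ m := by
  simp [bidegree]

theorem commute_dx_mul_dxi (a b : Dual ℝ V) (u : Covector V) :
    Commute (dx V a * dxi V b) u := by
  induction u using ExteriorAlgebra.induction with
  | algebraMap r => exact Algebra.commute_algebraMap_right r _
  | ι v =>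
    have swap : ∀ s t : Dual ℝ V × Dual ℝ V,
        ExteriorAlgebra.ι ℝ s * ExteriorAlgebra.ι ℝ t =
          -(ExteriorAlgebra.ι ℝ t * ExteriorAlgebra.ι ℝ s) := fun s t =>
      eq_neg_of_add_eq_zero_left (ExteriorAlgebra.ι_add_mul_swap _ _)
    change _ * _ = _ * _
    simp only [dx, dxi, LinearMap.comp_apply]
    rw [mul_assoc, swap _ v, mul_neg, ← mul_assoc, swap _ v, neg_mul, neg_neg, mul_assoc]
  | mul u v hu hv => exact hu.mul_right hv
  | add u v hu hv => exact hu.add_right hv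

theorem commute_elemForm (a : Dual ℝ V) (u : Covector V) : Commute (elemForm a) u :=
  commute_dx_mul_dxi a a u

theorem sgn_succ (k : ℕ) : sgn (k + 1) * (-1) ^ k = sgn k := by
  have h : (k + 1) * (k + 1 - 1) / 2 = k * (k - 1) / 2 + k := by
    rcases k with _ | k
    · rfl
    · have : (k + 1 + 1) * (k + 1 + 1 - 1) = (k + 1) * (k + 1 - 1) + (k + 1) * 2 := by
        simp only [Nat.add_sub_cancel]; ring
      rw [this, Nat.add_mul_div_right _ _ (by norm_num)]
  rw [sgn, sgn, h, pow_add, mul_assoc, ← mul_pow]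
  simp

/-- A form of bidegree `(k, 0)` anticommutes `k` times with a `dξ`. -/
theorem mul_dxi_of_mem {k : ℕ} {b : Covector V} (hb : b ∈ bidegree V k 0) (a : Dual ℝ V) :
    b * dxi V a = (-1 : ℝ) ^ k • (dxi V a * b) := by
  rw [bidegree_zero_right] at hb
  induction hb using Submodule.pow_induction_on_left' with
  | algebraMap r => simpa using (Algebra.commutes r (dxi V a))
  | add x y i hx hy ihx ihy => rw [add_mul, ihx, ihy, mul_add, smul_add]
  | mem_mul x hx i y hy ih =>
    obtain ⟨c, rfl⟩ := hx
    rw [mul_assoc, ih, mul_smul_comm, ← mul_assoc, ← mul_assoc, dxi_mul_dx, neg_mul, pow_succ]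
    simp

/-- Forms of bidegree `(k, 0)` and `(0, l)` commute up to the sign `(-1)^(kl)`. -/
theorem mul_J_of_mem {k l : ℕ} {b c : Covector V} (hb : b ∈ bidegree V k 0)
    (hc : c ∈ bidegree V l 0) : b * J V c = (-1 : ℝ) ^ (k * l) • (J V c * b) := by
  rw [bidegree_zero_right] at hc
  induction hc using Submodule.pow_induction_on_left' with
  | algebraMap r => simpa using (Algebra.commutes r b).symm
  | add x y i hx hy ihx ihy => rw [map_add, mul_add, ihx, ihy, add_mul, smul_add]
  | mem_mul x hx i y hy ih =>
    obtain ⟨a, rfl⟩ := hx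
    rw [map_mul, J_dx, ← mul_assoc, mul_dxi_of_mem hb, smul_mul_assoc, mul_assoc, ih,
      mul_smul_comm, smul_smul, mul_assoc, ← pow_add, Nat.mul_succ, add_comm]

theorem J_J (u : Covector V) : J V (J V u) = u := by
  induction u using ExteriorAlgebra.induction with
  | algebraMap r => simp
  | ι v => simp [J]
  | mul u v hu hv => simp [hu, hv]
  | add u v hu hv => simp [hu, hv]

theorem J_pullback {V' : Type*} [NormedAddCommGroup V'] [InnerProductSpace ℝ V']
    (φ : V →ₗ[ℝ] V') (u : Covector V') : J V (pullback V φ u) = pullback V φ (J V' u) := by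
  induction u using ExteriorAlgebra.induction with
  | algebraMap r => simp
  | ι v => simp [J, pullback]
  | mul u v hu hv => simp [hu, hv]
  | add u v hu hv => simp [hu, hv]

theorem dx_mul_mem {k : ℕ} {b : Covector V} (a : Dual ℝ V) (hb : b ∈ bidegree V k 0) :
    dx V a * b ∈ bidegree V (k + 1) 0 := by
  have := mul_mem_bidegree (dx_mem_bidegree a) hb
  rwa [add_comm 1 k, add_zero] at this

theorem elemForm_mul (a : Dual ℝ V) {k : ℕ} {b : Covector V} (hb : b ∈ bidegree V k 0)
    (c : Covector V) :
    elemForm a * (sgn k • (b * J V c)) = sgn (k + 1) • ((dx V a * b) * J V (dx V a * c)) := by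
  rw [map_mul, J_dx, ← mul_assoc, mul_assoc (dx V a) b, mul_dxi_of_mem hb, mul_smul_comm,
    mul_smul_comm, smul_mul_assoc, smul_smul, sgn_succ, elemForm]
  simp only [mul_assoc]

theorem list_dx_mem (l : List (Dual ℝ V)) :
    (l.map (dx V)).prod ∈ bidegree V l.length 0 := by
  induction l with
  | nil => simp [bidegree]
  | cons a l ih => simpa using dx_mul_mem a ih

theorem list_dx_mul_mem {m n : ℕ} (l : List (Dual ℝ V)) (h : l.length + m = n) {b : Covector V}
    (hb : b ∈ bidegree V m 0) : (l.map (dx V)).prod * b ∈ bidegree V n 0 := by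
  have := mul_mem_bidegree (list_dx_mem l) hb
  rwa [h] at this

/-- Multiplication by elementary forms turns `σₘ b ∧ J(c)` into a form of the same shape; the signs `σ`
are made for this. -/
theorem list_elemForm_mul {m n : ℕ} (l : List (Dual ℝ V)) (h : l.length + m = n) {b : Covector V}
    (hb : b ∈ bidegree V m 0) (c : Covector V) :
    (l.map elemForm).prod * (sgn m • (b * J V c)) =
      sgn n • (((l.map (dx V)).prod * b) * J V ((l.map (dx V)).prod * c)) := by
  induction l generalizing n with
  | nil =>
    obtain rfl : m = n := by simpa using h
    simp
  | cons a l ih =>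
    obtain ⟨k, rfl⟩ : ∃ k, n = k + 1 := ⟨l.length + m, by rw [← h]; simp; omega⟩
    have hk : l.length + m = k := by simp at h; omega
    simp only [List.map_cons, List.prod_cons]
    rw [mul_assoc, ih hk, elemForm_mul a (list_dx_mul_mem l hk hb)]
    simp only [mul_assoc]

theorem list_elemForm_eq (l : List (Dual ℝ V)) :
    (l.map elemForm).prod =
      sgn l.length • ((l.map (dx V)).prod * J V (l.map (dx V)).prod) := by
  have := list_elemForm_mul (m := 0) l (n := l.length) (by simp) (b := 1)
    (by simp [bidegree]) 1
  simpa [sgn] using this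

theorem J_list_dx (l : List (Dual ℝ V)) : J V (l.map (dx V)).prod = (l.map (dxi V)).prod := by
  rw [map_list_prod, List.map_map]
  congr 1
  exact List.map_congr_left fun a _ => J_dx V a

/-- The forms of bidegree `(a, b)` are spanned by the products `dx_{a₁} ⋯ ∧ J (dx_{b₁} ⋯)`. -/
theorem bidegree_le_span (a b : ℕ) (S : Submodule ℝ (Covector V))
    (h : ∀ l l' : List (Dual ℝ V), l.length = a → l'.length = b →
      (l.map (dx V)).prod * J V (l'.map (dx V)).prod ∈ S) : bidegree V a b ≤ S := by
  have hspan : ∀ (f : Dual ℝ V →ₗ[ℝ] Covector V) (k : ℕ), LinearMap.range f ^ k =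
      Submodule.span ℝ {u | ∃ l : List (Dual ℝ V), l.length = k ∧ (l.map f).prod = u} := by
    intro f k
    have h0 : LinearMap.range f = Submodule.span ℝ (Set.range f) := by
      rw [← LinearMap.coe_range, Submodule.span_eq]
    rw [h0, Submodule.span_pow]
    congr 1
    ext u
    rw [Set.mem_pow]
    constructor
    · rintro ⟨g, rfl⟩
      choose c hc using fun i => (g i).2
      refine ⟨List.ofFn c, by simp, ?_⟩
      rw [List.map_ofFn]
      congr 2
      funext i
      exact hc i
    · rintro ⟨l, rfl, rfl⟩
      refine ⟨fun i => ⟨f (l.get i), ⟨_, rfl⟩⟩, ?_⟩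
      congr 1
      change List.ofFn (f ∘ l.get) = _
      rw [← List.map_ofFn, List.ofFn_get]
  rw [bidegree, hspan, hspan, Submodule.span_mul_span, Submodule.span_le]
  rintro _ ⟨_, ⟨l, hl, rfl⟩, _, ⟨l', hl', rfl⟩, rfl⟩
  have := h l l' hl hl'
  rwa [J_list_dx] at this

end ConstantForms

section TopForm

variable (V : Type*) [NormedAddCommGroup V] [InnerProductSpace ℝ V] [FiniteDimensional ℝ V]

/-- The `i`-th orthonormal coordinate function. -/
noncomputable abbrev coordFn (i : Fin (finrank ℝ V)) : Dual ℝ V :=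
  (stdOrthonormalBasis ℝ V).toBasis.coord i

theorem covectorBasis_false (i : Fin (finrank ℝ V)) :
    covectorBasis V (toLex (i, false)) = (coordFn V i, 0) := by
  simp [covectorBasis, Equiv.boolProdEquivSum]

theorem covectorBasis_true (i : Fin (finrank ℝ V)) :
    covectorBasis V (toLex (i, true)) = (0, coordFn V i) := by
  simp [covectorBasis, Equiv.boolProdEquivSum]

/-- The normalization of `topCoeff`: the coefficient of `ωₙ` itself is `1`. -/
theorem topCoeff_prod_coord :
    topCoeff V ((List.ofFn (coordFn V)).map elemForm).prod = 1 := by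
  have h : (covectorBasis V).ExteriorAlgebra Finset.univ =
      ((List.ofFn (coordFn V)).map elemForm).prod := by
    rw [ExteriorAlgebra.basis_apply]
    set emb := Set.powersetCard.ofFinEmbEquiv.symm
      (Set.powersetCard.prodEquiv.symm (Finset.univ : Finset (Fin (finrank ℝ V) ×ₗ Bool))).2
    -- the increasing enumeration of the index set is `(1, dx), (1, dξ), (2, dx), (2, dξ), …`
    have hL : List.ofFn emb = (List.finRange (finrank ℝ V)).flatMap
        fun i => [toLex (i, false), toLex (i, true)] := by
      refine List.SortedLT.eq_of_mem_iff ?_ ?_ ?_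
      · exact (List.sortedLT_ofFn_iff).2 emb.strictMono
      · refine List.Pairwise.sortedLT ?_
        rw [List.pairwise_flatMap]
        refine ⟨fun i _ => ?_, ?_⟩
        · simp [Prod.Lex.toLex_lt_toLex]
        · refine (List.sortedLT_finRange _).pairwise.imp ?_
          intro i j hij x hx y hy
          simp only [List.mem_cons, List.not_mem_nil, or_false] at hx hy
          rcases hx with rfl | rfl <;> rcases hy with rfl | rfl <;>
            exact Prod.Lex.toLex_lt_toLex.2 (Or.inl hij)
      · intro x
        obtain ⟨⟨i, s⟩, rfl⟩ := toLex.surjective x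
        constructor
        · intro _
          rw [List.mem_flatMap]
          refine ⟨i, List.mem_finRange i, ?_⟩
          cases s
          · exact List.mem_cons_self
          · exact List.mem_cons_of_mem _ List.mem_cons_self
        · intro _
          rw [List.mem_ofFn]
          exact (Set.powersetCard.mem_range_ofFinEmbEquiv_symm_iff_mem _ _).2 (Finset.mem_univ _)
    have h2 : (List.ofFn fun i => ExteriorAlgebra.ι ℝ (covectorBasis V (emb i))) =
        (List.ofFn emb).map fun j => ExteriorAlgebra.ι ℝ (covectorBasis V j) := by
      rw [List.map_ofFn]; rfl
    change (List.ofFn fun i => ExteriorAlgebra.ι ℝ (covectorBasis V (emb i))).prod = _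
    rw [h2, hL, List.map_flatMap, List.flatMap, List.prod_flatten, List.ofFn_eq_map]
    congr 1
    simp only [List.map_map]
    refine List.map_congr_left fun i _ => ?_
    simp [covectorBasis_false, covectorBasis_true, dx, dxi, elemForm]
  rw [← h, topCoeff]
  simp

variable {V}

/-- The forms of bidegree `(n, 0)` are the multiples of `dx₁ ∧ ⋯ ∧ dxₙ`. -/
theorem exists_smul_of_mem_top {c : Covector V} (hc : c ∈ bidegree V (finrank ℝ V) 0) :
    ∃ t : ℝ, c = t • ((List.ofFn (coordFn V)).map (dx V)).prod := by
  let A : Dual ℝ V [⋀^Fin (finrank ℝ V)]→ₗ[ℝ] Covector V :=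
    (ExteriorAlgebra.ιMulti ℝ (finrank ℝ V)).compLinearMap (LinearMap.inl ℝ (Dual ℝ V) (Dual ℝ V))
  have hA : ∀ v, A v = ((List.ofFn v).map (dx V)).prod := by
    intro v
    rw [List.map_ofFn]
    rfl
  let b : Basis (Fin (finrank ℝ V)) ℝ (Dual ℝ V) := (stdOrthonormalBasis ℝ V).toBasis.dualBasis
  have hb : ⇑b = coordFn V := by
    funext i
    simp [b]
  have hdet : ∀ v, A v = b.det v • ((List.ofFn (coordFn V)).map (dx V)).prod := by
    intro v
    have h : A = (LinearMap.toSpanSingleton ℝ (Covector V)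
        ((List.ofFn (coordFn V)).map (dx V)).prod).compAlternatingMap b.det := by
      refine Basis.ext_alternating b fun w hw => ?_
      let σ : Equiv.Perm (Fin (finrank ℝ V)) :=
        Equiv.ofBijective w (Finite.injective_iff_bijective.1 hw)
      have h1 : (fun i => b (w i)) = b ∘ σ := rfl
      rw [h1, AlternatingMap.map_perm, AlternatingMap.map_perm]
      congr 1
      rw [hA, hb]
      simp [← hb, Basis.det_self]
    rw [h]; rfl
  have hle : bidegree V (finrank ℝ V) 0 ≤
      Submodule.span ℝ {((List.ofFn (coordFn V)).map (dx V)).prod} := by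
    refine bidegree_le_span _ _ _ ?_
    intro l l' hl hl'
    obtain rfl : l' = [] := List.length_eq_zero_iff.1 hl'
    obtain ⟨v, rfl⟩ : ∃ v : Fin (finrank ℝ V) → Dual ℝ V, l = List.ofFn v := by
      rw [← hl]
      exact ⟨l.get, (List.ofFn_get l).symm⟩
    rw [← hA v, hdet v, List.map_nil, List.prod_nil, map_one, mul_one]
    exact Submodule.mem_span_singleton.2 ⟨_, rfl⟩
  obtain ⟨t, ht⟩ := Submodule.mem_span_singleton.1 (hle hc)
  exact ⟨t, ht.symm⟩

/-- Forms of bidegree `(m, 0)` with `m` larger than the dimension vanish. -/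
theorem bidegree_eq_bot {m b : ℕ} (h : finrank ℝ V < m) : bidegree V m b = ⊥ := by
  rw [eq_bot_iff]
  refine bidegree_le_span _ _ _ ?_
  intro l l' hl hl'
  have h0 : (l.map (dx V)).prod = 0 := by
    let A : Dual ℝ V [⋀^Fin l.length]→ₗ[ℝ] Covector V :=
      (ExteriorAlgebra.ιMulti ℝ l.length).compLinearMap
        (LinearMap.inl ℝ (Dual ℝ V) (Dual ℝ V))
    have hA : A l.get = (l.map (dx V)).prod := by
      conv_rhs => rw [← List.ofFn_get l, List.map_ofFn]
      rfl
    rw [← hA]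
    refine AlternatingMap.map_linearDependent A _ fun hli => ?_
    have := hli.fintype_card_le_finrank
    rw [Subspace.dual_finrank_eq, Fintype.card_fin] at this
    omega
  simp [h0]

/-- The coefficient of `dx₁ ∧ ⋯ ∧ dxₙ` in a form of bidegree `(n, 0)`. -/
noncomputable def volCoeff : Covector V →ₗ[ℝ] ℝ :=
  sgn (finrank ℝ V) • (topCoeff V ∘ₗ
    LinearMap.mulRight ℝ (J V ((List.ofFn (coordFn V)).map (dx V)).prod))

/-- On `(n, 0)`-forms, `(c, c') ↦ σₙ c ∧ J(c')` is the product of the coefficients: the sign `σₙ` is the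
one that reorders `dx₁ ∧ ⋯ ∧ dxₙ ∧ dξ₁ ∧ ⋯ ∧ dξₙ` into `ωₙ`. -/
theorem topCoeff_mul_J {c c' : Covector V} (hc : c ∈ bidegree V (finrank ℝ V) 0)
    (hc' : c' ∈ bidegree V (finrank ℝ V) 0) :
    topCoeff V (sgn (finrank ℝ V) • (c * J V c')) = volCoeff c * volCoeff c' := by
  have h1 := topCoeff_prod_coord V
  rw [list_elemForm_eq, List.length_ofFn] at h1
  obtain ⟨t, rfl⟩ := exists_smul_of_mem_top hc
  obtain ⟨t', rfl⟩ := exists_smul_of_mem_top hc'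
  have h2 : volCoeff ((List.ofFn (coordFn V)).map (dx V)).prod = 1 := by
    simpa [volCoeff] using h1
  rw [map_smul volCoeff, map_smul volCoeff, h2, map_smul (J V), smul_mul_smul_comm, smul_comm,
    map_smul, h1]
  simp

end TopForm

/-! ### Strongly positive forms -/

section StronglyPositive

variable (V : Type*) [NormedAddCommGroup V] [InnerProductSpace ℝ V]

/-- The strongly positive `(p, p)`-forms: sums of products of `p` elementary positive
`(1, 1)`-forms. -/
noncomputable def stronglyPositive (p : ℕ) : AddSubmonoid (Covector V) :=
  AddSubmonoid.closure {w | ∃ l : List (Dual ℝ V), l.length = p ∧ (l.map elemForm).prod = w}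

variable {V}

theorem list_elemForm_mem (l : List (Dual ℝ V)) :
    (l.map elemForm).prod ∈ stronglyPositive V l.length :=
  AddSubmonoid.subset_closure ⟨l, rfl, rfl⟩

theorem one_mem_stronglyPositive : (1 : Covector V) ∈ stronglyPositive V 0 :=
  list_elemForm_mem []

theorem elemForm_mem (a : Dual ℝ V) : elemForm a ∈ stronglyPositive V 1 := by
  simpa using list_elemForm_mem [a]

theorem mul_mem_stronglyPositive {p q r : ℕ} (h : p + q = r) {u v : Covector V}
    (hu : u ∈ stronglyPositive V p) (hv : v ∈ stronglyPositive V q) :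
    u * v ∈ stronglyPositive V r := by
  subst h
  refine AddSubmonoid.closure_induction (motive := fun u _ => u * v ∈ stronglyPositive V (p + q))
    ?_ (by simp) (fun x y _ _ hx hy => by rw [add_mul]; exact add_mem hx hy) hu
  rintro _ ⟨l, rfl, rfl⟩
  refine AddSubmonoid.closure_induction
    (motive := fun v _ => _ * v ∈ stronglyPositive V (l.length + q))
    ?_ (by simp) (fun x y _ _ hx hy => by rw [mul_add]; exact add_mem hx hy) hv
  rintro _ ⟨l', rfl, rfl⟩
  rw [← List.prod_append, ← List.map_append, ← List.length_append]
  exact list_elemForm_mem _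

theorem pow_mem_stronglyPositive {u : Covector V} (hu : u ∈ stronglyPositive V 1) (r : ℕ) :
    u ^ r ∈ stronglyPositive V r := by
  induction r with
  | zero => simpa using one_mem_stronglyPositive
  | succ r ih => rw [pow_succ]; exact mul_mem_stronglyPositive rfl ih hu

theorem list_prod_mem_stronglyPositive {l : List (Covector V)}
    (h : ∀ u ∈ l, u ∈ stronglyPositive V 1) : l.prod ∈ stronglyPositive V l.length := by
  induction l with
  | nil => simpa using one_mem_stronglyPositive
  | cons u l ih =>
    rw [List.prod_cons, List.length_cons]
    exact mul_mem_stronglyPositive (add_comm _ _) (h u List.mem_cons_self)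
      (ih fun v hv => h v (List.mem_cons_of_mem _ hv))

end StronglyPositive

section Positivity

variable {V : Type*} [NormedAddCommGroup V] [InnerProductSpace ℝ V] [FiniteDimensional ℝ V]

theorem sgn_mul_self (k : ℕ) : sgn k * sgn k = 1 := by
  rw [sgn, ← mul_pow]; simp

theorem abs_sgn (k : ℕ) : |sgn k| = 1 := by
  rw [sgn, abs_pow]; simp

/-- The pairing `(b, b') ↦ Θ ∧ σₘ b ∧ J b'` attached to a product of elementary forms is of rank
one. -/
theorem topCoeff_list_mul {m : ℕ} (l : List (Dual ℝ V)) (h : l.length + m = finrank ℝ V)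
    {b b' : Covector V} (hb : b ∈ bidegree V m 0) (hb' : b' ∈ bidegree V m 0) :
    topCoeff V ((l.map elemForm).prod * (sgn m • (b * J V b'))) =
      volCoeff ((l.map (dx V)).prod * b) * volCoeff ((l.map (dx V)).prod * b') := by
  rw [list_elemForm_mul l h hb, topCoeff_mul_J (list_dx_mul_mem l h hb)
    (list_dx_mul_mem l h hb')]

variable {p m : ℕ} (h : p + m = finrank ℝ V) {Θ : Covector V} (hΘ : Θ ∈ stronglyPositive V p)

include h hΘ

theorem topCoeff_nonneg {b : Covector V} (hb : b ∈ bidegree V m 0) :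
    0 ≤ topCoeff V (Θ * (sgn m • (b * J V b))) := by
  refine AddSubmonoid.closure_induction
    (motive := fun u _ => 0 ≤ topCoeff V (u * (sgn m • (b * J V b)))) ?_ (by simp) ?_ hΘ
  · rintro _ ⟨l, rfl, rfl⟩
    rw [topCoeff_list_mul l h hb hb]
    exact mul_self_nonneg _
  · intro x y _ _ hx hy
    rw [add_mul, map_add]
    exact add_nonneg hx hy

/-- The pairing `(b, b') ↦ Θ ∧ b ∧ J(b')` is symmetric, as it is a sum of pairings of rank one. -/
theorem topCoeff_symm {b b' : Covector V} (hb : b ∈ bidegree V m 0) (hb' : b' ∈ bidegree V m 0) :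
    topCoeff V (Θ * (b * J V b')) = topCoeff V (Θ * (b' * J V b)) := by
  have key : topCoeff V (Θ * (sgn m • (b * J V b'))) =
      topCoeff V (Θ * (sgn m • (b' * J V b))) := by
    refine AddSubmonoid.closure_induction
      (motive := fun u _ => topCoeff V (u * (sgn m • (b * J V b'))) =
        topCoeff V (u * (sgn m • (b' * J V b)))) ?_ (by simp) ?_ hΘ
    · rintro _ ⟨l, rfl, rfl⟩
      rw [topCoeff_list_mul l h hb hb', topCoeff_list_mul l h hb' hb, mul_comm]
    · intro x y _ _ hx hy
      rw [add_mul, map_add, hx, hy, add_mul, map_add]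
  have h0 : sgn m ≠ 0 := fun h0 => by simpa [h0] using sgn_mul_self m
  simpa [h0] using key

/-- The Cauchy–Schwarz inequality for the pairing attached to a strongly positive form. -/
theorem abs_topCoeff_le {b b' : Covector V} (hb : b ∈ bidegree V m 0) (hb' : b' ∈ bidegree V m 0)
    {t : ℝ} (ht : 0 < t) :
    |topCoeff V (Θ * (b * J V b'))| ≤
      (t * topCoeff V (Θ * (sgn m • (b * J V b))) +
        t⁻¹ * topCoeff V (Θ * (sgn m • (b' * J V b')))) / 2 := by
  have hs := topCoeff_symm h hΘ hb hb'
  have h1 := topCoeff_nonneg h hΘ (add_mem (Submodule.smul_mem _ t hb) hb')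
  have h2 := topCoeff_nonneg h hΘ (sub_mem (Submodule.smul_mem _ t hb) hb')
  simp only [map_add, map_sub, map_smul, mul_add, add_mul, mul_sub, sub_mul, smul_add, smul_sub,
    smul_mul_assoc, mul_smul_comm, smul_eq_mul] at h1 h2 ⊢
  rw [← hs] at h1 h2
  set X := topCoeff V (Θ * (b * J V b))
  set Y := topCoeff V (Θ * (b' * J V b'))
  set Z := topCoeff V (Θ * (b * J V b'))
  have hZ : |sgn m * Z| = |Z| := by rw [abs_mul, abs_sgn, one_mul]
  have e : (t * (sgn m * X) + t⁻¹ * (sgn m * Y)) / 2 =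
      t⁻¹ * ((t * (t * (sgn m * X)) + sgn m * Y) / 2) := by field_simp
  rw [← hZ, e, ← div_eq_inv_mul, le_div_iff₀ ht, ← abs_of_pos ht, ← abs_mul, abs_of_pos ht, abs_le]
  constructor <;> nlinarith

/-- Products with strongly positive forms only see the symmetric part of an `(m, m)`-form. -/
theorem topCoeff_J {w : Covector V} (hw : w ∈ bidegree V m m) :
    topCoeff V (Θ * J V w) = (-1) ^ m * topCoeff V (Θ * w) := by
  let S : Submodule ℝ (Covector V) := LinearMap.ker
    (topCoeff V ∘ₗ LinearMap.mulLeft ℝ Θ ∘ₗ (J V).toLinearMap -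
      (-1 : ℝ) ^ m • (topCoeff V ∘ₗ LinearMap.mulLeft ℝ Θ))
  have : bidegree V m m ≤ S := by
    refine bidegree_le_span _ _ _ fun l l' hl hl' => ?_
    have hb := list_dx_mem l
    have hb' := list_dx_mem l'
    rw [hl] at hb
    rw [hl'] at hb'
    have hpow : (-1 : ℝ) ^ m = (-1) ^ (m * m) := by
      rcases Nat.even_or_odd m with hm | hm
      · rw [hm.neg_one_pow, (hm.mul_right m).neg_one_pow]
      · rw [hm.neg_one_pow, (hm.mul hm).neg_one_pow]
    have hmul := mul_J_of_mem hb' hb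
    change _ - _ = (0 : ℝ)
    simp only [LinearMap.comp_apply, AlgHom.toLinearMap_apply, LinearMap.mulLeft_apply,
      LinearMap.smul_apply, smul_eq_mul]
    rw [map_mul (J V), J_J, topCoeff_symm h hΘ hb hb', hmul, hpow]
    simp only [mul_smul_comm, map_smul, smul_eq_mul]
    rw [← mul_assoc ((-1 : ℝ) ^ (m * m)), ← mul_pow]
    simp
  have := this hw
  exact sub_eq_zero.1 this

omit h in
theorem topCoeff_nonneg_of_eq (hp : p = finrank ℝ V) : 0 ≤ topCoeff V Θ := by
  have := topCoeff_nonneg (m := 0) (by rw [hp, add_zero]) hΘ (b := 1) (by simp [bidegree])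
  simpa [sgn] using this

end Positivity

section Hessian

variable {V : Type*} [NormedAddCommGroup V] [InnerProductSpace ℝ V] [FiniteDimensional ℝ V]

/-- The `(1, 1)`-form `∑ Aᵢⱼ dxᵢ ∧ dξⱼ` of a matrix. -/
noncomputable def matrixForm (A : Fin (finrank ℝ V) → Fin (finrank ℝ V) → ℝ) :
    Covector V :=
  ∑ i, ∑ j, A i j • (dx V (coordFn V i) * dxi V (coordFn V j))

variable (V) in
/-- The standard Kähler form `∑ dxᵢ ∧ dξᵢ`. -/
noncomputable def kahlerForm : Covector V := ∑ i, elemForm (coordFn V i)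

theorem kahlerForm_mem : kahlerForm V ∈ stronglyPositive V 1 :=
  sum_mem fun _ _ => elemForm_mem _

theorem elemForm_sum (v : Fin (finrank ℝ V) → ℝ) :
    elemForm (∑ i, v i • coordFn V i) = matrixForm fun i j => v i * v j := by
  simp only [elemForm, matrixForm, map_sum, map_smul, Finset.sum_mul_sum, smul_mul_smul_comm]

theorem elemForm_eq_matrixForm (a : Dual ℝ V) :
    elemForm a = matrixForm fun i j =>
      a (stdOrthonormalBasis ℝ V i) * a (stdOrthonormalBasis ℝ V j) := by
  rw [← elemForm_sum]
  congr 1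
  refine (stdOrthonormalBasis ℝ V).toBasis.ext fun k => ?_
  simp

/-- A positive semidefinite matrix is a sum of matrices `v vᵀ`, which give elementary forms. -/
theorem matrixForm_mem {A : Fin (finrank ℝ V) → Fin (finrank ℝ V) → ℝ}
    (hA : (Matrix.of A).PosSemidef) : matrixForm A ∈ stronglyPositive V 1 := by
  obtain ⟨r, v, hv⟩ := Matrix.posSemidef_iff_eq_sum_vecMulVec.1 hA
  have hA' : ∀ i j, A i j = ∑ k, v k i * v k j := fun i j => by
    have := congrFun (congrFun hv i) j
    simpa [Matrix.sum_apply, Matrix.vecMulVec_apply] using this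
  have : matrixForm (V := V) A = ∑ k, elemForm (∑ i, v k i • coordFn V i) := by
    simp only [elemForm_sum, matrixForm, hA', Finset.sum_smul]
    rw [Finset.sum_comm]
    conv_rhs => rw [Finset.sum_comm]; enter [2, i]; rw [Finset.sum_comm]
    rw [Finset.sum_comm]
  rw [this]
  exact sum_mem fun _ _ => elemForm_mem _

/-- A bounded `(1, 1)`-form is dominated by a multiple of the Kähler form. -/
theorem abs_topCoeff_matrixForm_le {p : ℕ} (h : p + 1 = finrank ℝ V) {Θ : Covector V}
    (hΘ : Θ ∈ stronglyPositive V p) {A : Fin (finrank ℝ V) → Fin (finrank ℝ V) → ℝ} {K : ℝ}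
    (hA : ∀ i j, |A i j| ≤ K) :
    |topCoeff V (Θ * matrixForm A)| ≤ finrank ℝ V * K * topCoeff V (Θ * kahlerForm V) := by
  set c : Fin (finrank ℝ V) → ℝ := fun i => topCoeff V (Θ * elemForm (coordFn V i)) with hc
  have hmem : ∀ i, dx V (coordFn V i) ∈ bidegree V 1 0 := fun i => dx_mem_bidegree _
  have h1 : ∀ i j, |topCoeff V (Θ * (dx V (coordFn V i) * dxi V (coordFn V j)))| ≤
      (c i + c j) / 2 := by
    intro i j
    have := abs_topCoeff_le h hΘ (hmem i) (hmem j) one_pos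
    simpa [sgn, J_dx, elemForm, hc] using this
  have h2 : topCoeff V (Θ * kahlerForm V) = ∑ i, c i := by
    simp [kahlerForm, Finset.mul_sum, hc]
  rw [h2]
  have h3 : topCoeff V (Θ * matrixForm A) =
      ∑ i, ∑ j, A i j * topCoeff V (Θ * (dx V (coordFn V i) * dxi V (coordFn V j))) := by
    simp [matrixForm, Finset.mul_sum]
  rw [h3]
  calc _ ≤ ∑ i, ∑ j, |A i j * topCoeff V (Θ * (dx V (coordFn V i) * dxi V (coordFn V j)))| :=
        (Finset.abs_sum_le_sum_abs _ _).trans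
          (Finset.sum_le_sum fun i _ => Finset.abs_sum_le_sum_abs _ _)
    _ ≤ ∑ i, ∑ j, K * ((c i + c j) / 2) := by
        gcongr with i _ j _
        rw [abs_mul]
        exact mul_le_mul (hA i j) (h1 i j) (abs_nonneg _) ((abs_nonneg _).trans (hA i j))
    _ = finrank ℝ V * K * ∑ i, c i := by
        simp only [← Finset.mul_sum, ← Finset.sum_div, Finset.sum_add_distrib, Finset.sum_const,
          Finset.card_univ, Fintype.card_fin, nsmul_eq_mul]
        ring

theorem topCoeff_elemForm_le {p : ℕ} (h : p + 1 = finrank ℝ V) {Θ : Covector V}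
    (hΘ : Θ ∈ stronglyPositive V p) {a : Dual ℝ V} {κ : ℝ}
    (ha : ∀ i, |a (stdOrthonormalBasis ℝ V i)| ≤ κ) :
    topCoeff V (Θ * elemForm a) ≤ finrank ℝ V * κ ^ 2 * topCoeff V (Θ * kahlerForm V) := by
  rw [elemForm_eq_matrixForm]
  refine (le_abs_self _).trans (abs_topCoeff_matrixForm_le h hΘ fun i j => ?_)
  rw [abs_mul, sq]
  exact mul_le_mul (ha i) (ha j) (abs_nonneg _) ((abs_nonneg _).trans (ha i))

theorem exists_topCoeff_list_le (l : List (Dual ℝ V)) :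
    ∃ K : ℝ, 0 ≤ K ∧ ∀ p, p + l.length = finrank ℝ V → ∀ Θ ∈ stronglyPositive V p,
      topCoeff V (Θ * (l.map elemForm).prod) ≤ K * topCoeff V (Θ * kahlerForm V ^ l.length) := by
  induction l with
  | nil => exact ⟨1, zero_le_one, fun p _ Θ _ => by simp⟩
  | cons a l ih =>
    obtain ⟨K, hK, ih⟩ := ih
    set κ : ℝ := ∑ i, |a (stdOrthonormalBasis ℝ V i)|
    refine ⟨K * (finrank ℝ V * κ ^ 2), by positivity, fun p hp Θ hΘ => ?_⟩
    rw [List.length_cons] at hp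
    have h1 := ih (p + 1) (by omega) _ (mul_mem_stronglyPositive rfl hΘ (elemForm_mem a))
    have h2 := topCoeff_elemForm_le (by omega) (mul_mem_stronglyPositive rfl hΘ
      (pow_mem_stronglyPositive kahlerForm_mem l.length)) (a := a) (κ := κ)
      (fun i => Finset.single_le_sum (f := fun i => |a (stdOrthonormalBasis ℝ V i)|)
        (fun j _ => abs_nonneg _) (Finset.mem_univ i))
    rw [List.map_cons, List.prod_cons, List.length_cons, pow_succ (kahlerForm V),
      ← mul_assoc Θ (kahlerForm V ^ _), mul_assoc K]
    rw [mul_assoc Θ (elemForm a) (_ ^ _), (commute_elemForm a (_ ^ _)).eq, ← mul_assoc] at h1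
    rw [← mul_assoc Θ (elemForm a)]
    exact h1.trans (mul_le_mul_of_nonneg_left h2 hK)

/-- Every form of bidegree `(m, m)` is dominated by a multiple of `ωᵐ`. -/
theorem exists_abs_topCoeff_le {p m : ℕ} (h : p + m = finrank ℝ V) {w : Covector V}
    (hw : w ∈ bidegree V m m) :
    ∃ K : ℝ, 0 ≤ K ∧ ∀ Θ ∈ stronglyPositive V p,
      |topCoeff V (Θ * w)| ≤ K * topCoeff V (Θ * kahlerForm V ^ m) := by
  let S : Submodule ℝ (Covector V) :=
    { carrier := {w | ∃ K : ℝ, 0 ≤ K ∧ ∀ Θ ∈ stronglyPositive V p,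
        |topCoeff V (Θ * w)| ≤ K * topCoeff V (Θ * kahlerForm V ^ m)}
      zero_mem' := ⟨0, le_rfl, fun Θ _ => by simp⟩
      add_mem' := by
        rintro u v ⟨K, hK, hu⟩ ⟨K', hK', hv⟩
        refine ⟨K + K', add_nonneg hK hK', fun Θ hΘ => ?_⟩
        rw [mul_add, map_add, add_mul]
        exact (abs_add_le _ _).trans (add_le_add (hu Θ hΘ) (hv Θ hΘ))
      smul_mem' := by
        rintro t u ⟨K, hK, hu⟩
        refine ⟨|t| * K, by positivity, fun Θ hΘ => ?_⟩
        rw [mul_smul_comm, map_smul, smul_eq_mul, abs_mul, mul_assoc]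
        exact mul_le_mul_of_nonneg_left (hu Θ hΘ) (abs_nonneg _) }
  refine (bidegree_le_span m m S fun l l' hl hl' => ?_) hw
  obtain ⟨K, hK, h1⟩ := exists_topCoeff_list_le l
  obtain ⟨K', hK', h2⟩ := exists_topCoeff_list_le l'
  refine ⟨(K + K') / 2, by positivity, fun Θ hΘ => ?_⟩
  have hb := list_dx_mem l
  have hb' := list_dx_mem l'
  have e1 := list_elemForm_eq l
  have e2 := list_elemForm_eq l'
  rw [hl] at hb e1
  rw [hl'] at hb' e2
  have h3 := abs_topCoeff_le h hΘ hb hb' one_pos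
  have h4 := h1 p (by rw [hl, h]) Θ hΘ
  have h5 := h2 p (by rw [hl', h]) Θ hΘ
  rw [hl, e1] at h4
  rw [hl', e2] at h5
  rw [inv_one] at h3
  linarith

end Hessian

/-! ### Calculus of super forms -/

section Calculus

variable {V : Type*} [NormedAddCommGroup V] [InnerProductSpace ℝ V]

theorem contDiff_fderiv_apply {F : Type*} [NormedAddCommGroup F] [NormedSpace ℝ F] {g : V → F}
    (hg : ContDiff ℝ ∞ g) (v : V) : ContDiff ℝ ∞ fun x => fderiv ℝ g x v :=
  (hg.fderiv_right (m := ∞) (by simp)).clm_apply contDiff_const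

theorem hasFDerivAt_of_smooth {F : Type*} [NormedAddCommGroup F] [NormedSpace ℝ F] {g : V → F}
    (hg : ContDiff ℝ ∞ g) (x : V) : HasFDerivAt g (fderiv ℝ g x) x :=
  (hg.differentiable (by simp) x).hasFDerivAt

theorem contDiff_linear {F G : Type*} [NormedAddCommGroup F] [NormedSpace ℝ F]
    [FiniteDimensional ℝ F] [NormedAddCommGroup G] [NormedSpace ℝ G] (A : F →ₗ[ℝ] G) {α : V → F}
    (hα : ContDiff ℝ ∞ α) : ContDiff ℝ ∞ fun y => A (α y) :=
  (LinearMap.toContinuousLinearMap A).contDiff.comp hα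

theorem fderiv_comp_linear {F G : Type*} [NormedAddCommGroup F] [NormedSpace ℝ F]
    [FiniteDimensional ℝ F] [NormedAddCommGroup G] [NormedSpace ℝ G] (A : F →ₗ[ℝ] G) {α : V → F}
    (hα : ContDiff ℝ ∞ α) (x v : V) :
    fderiv ℝ (fun y => A (α y)) x v = A (fderiv ℝ α x v) := by
  have h : HasFDerivAt (fun y => A (α y)) _ x :=
    (LinearMap.toContinuousLinearMap A).hasFDerivAt.comp x (hasFDerivAt_of_smooth hα x)
  rw [h.fderiv]
  rfl

theorem fderiv_fderiv_apply {g : V → ℝ} (hg : ContDiff ℝ ∞ g) (x v w : V) :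
    fderiv ℝ (fun y => fderiv ℝ g y w) x v = fderiv ℝ (fderiv ℝ g) x v w := by
  have h := (hasFDerivAt_of_smooth (hg.fderiv_right (m := ∞) (by simp)) x).clm_apply
    (hasFDerivAt_const w x)
  rw [h.fderiv]
  simp

theorem fderiv_fderiv_comm {g : V → ℝ} (hg : ContDiff ℝ ∞ g) (x v w : V) :
    fderiv ℝ (fun y => fderiv ℝ g y w) x v = fderiv ℝ (fun y => fderiv ℝ g y v) x w := by
  rw [fderiv_fderiv_apply hg, fderiv_fderiv_apply hg]
  refine (hg.contDiffAt.isSymmSndFDerivAt ?_) v w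
  rw [minSmoothness_of_isRCLikeNormedField]
  exact WithTop.coe_le_coe.2 le_top

theorem fderiv_fderiv_nonneg {g : V → ℝ} (hg : ContDiff ℝ ∞ g) (hc : ConvexOn ℝ univ g)
    (x w : V) : 0 ≤ fderiv ℝ (fun y => fderiv ℝ g y w) x w := by
  have hline : ∀ t : ℝ, HasDerivAt (fun t : ℝ => x + t • w) w t := fun t => by
    simpa using ((hasDerivAt_id t).smul_const w).const_add x
  have h1 : ∀ t : ℝ, HasDerivAt (fun t : ℝ => g (x + t • w)) (fderiv ℝ g (x + t • w) w) t :=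
    fun t => (hasFDerivAt_of_smooth hg _).comp_hasDerivAt t (hline t)
  have h2 : HasDerivAt (fun t : ℝ => fderiv ℝ g (x + t • w) w)
      (fderiv ℝ (fun y => fderiv ℝ g y w) x w) 0 := by
    have := (hasFDerivAt_of_smooth (contDiff_fderiv_apply hg w) (x + (0 : ℝ) • w)).comp_hasDerivAt
      0 (hline 0)
    rw [zero_smul, add_zero] at this
    exact this
  have hconv : ConvexOn ℝ univ fun t : ℝ => g (x + t • w) := by
    have := hc.comp_affineMap (AffineMap.lineMap x (x + w) : ℝ →ᵃ[ℝ] V)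
    simpa [Function.comp_def, AffineMap.lineMap_apply, add_comm] using this
  have hmono := hconv.monotoneOn_deriv (fun t _ => (h1 t).differentiableAt)
  have hd : deriv (fun t : ℝ => g (x + t • w)) = fun t => fderiv ℝ g (x + t • w) w :=
    funext fun t => (h1 t).deriv
  rw [hd] at hmono
  have hmono' : Monotone fun t : ℝ => fderiv ℝ g (x + t • w) w := fun a b hab =>
    hmono (mem_univ a) (mem_univ b) hab
  rw [← h2.deriv]
  exact hmono'.deriv_nonneg

variable [FiniteDimensional ℝ V]

/-- The Hessian matrix in the standard orthonormal coordinates. -/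
noncomputable def hessian (g : V → ℝ) (x : V) :
    Fin (finrank ℝ V) → Fin (finrank ℝ V) → ℝ := fun i j =>
  fderiv ℝ (fun y => fderiv ℝ g y (stdOrthonormalBasis ℝ V j)) x (stdOrthonormalBasis ℝ V i)

theorem contDiff_hessian {g : V → ℝ} (hg : ContDiff ℝ ∞ g) (i j : Fin (finrank ℝ V)) :
    ContDiff ℝ ∞ fun x => hessian g x i j :=
  contDiff_fderiv_apply (contDiff_fderiv_apply hg _) _

theorem hessian_symm {g : V → ℝ} (hg : ContDiff ℝ ∞ g) (x : V) (i j : Fin (finrank ℝ V)) :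
    hessian g x i j = hessian g x j i :=
  fderiv_fderiv_comm hg x _ _

theorem hessian_posSemidef {g : V → ℝ} (hg : ContDiff ℝ ∞ g) (hc : ConvexOn ℝ univ g) (x : V) :
    (Matrix.of (hessian g x)).PosSemidef := by
  refine Matrix.PosSemidef.of_dotProduct_mulVec_nonneg ?_ fun v => ?_
  · ext i j
    simp [hessian_symm hg x j i]
  · have h := fderiv_fderiv_nonneg hg hc x (∑ i, v i • stdOrthonormalBasis ℝ V i)
    rw [fderiv_fderiv_apply hg] at h
    simp only [map_sum, map_smul, sum_apply, smul_apply,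
      smul_eq_mul] at h
    refine le_of_le_of_eq h (Eq.symm ?_)
    simp only [dotProduct, Matrix.mulVec, Matrix.of_apply, hessian, fderiv_fderiv_apply hg, Pi.star_apply,
      star_trivial, Finset.mul_sum]
    rw [Finset.sum_comm]
    exact Finset.sum_congr rfl fun i _ => Finset.sum_congr rfl fun j _ => by ring

/-- Multiplication of constant forms as a continuous bilinear map. -/
noncomputable def mulCLM : Covector V →L[ℝ] Covector V →L[ℝ] Covector V :=
  LinearMap.toContinuousLinearMap
    (LinearMap.toContinuousLinearMap.toLinearMap ∘ₗ LinearMap.mul ℝ (Covector V))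

theorem fderiv_mul_apply {α β : V → Covector V} (hα : ContDiff ℝ ∞ α) (hβ : ContDiff ℝ ∞ β)
    (x v : V) : fderiv ℝ (fun y => α y * β y) x v =
      α x * fderiv ℝ β x v + fderiv ℝ α x v * β x := by
  have h := (mulCLM (V := V)).hasFDerivAt_of_bilinear (hasFDerivAt_of_smooth hα x)
    (hasFDerivAt_of_smooth hβ x)
  have h' : HasFDerivAt (fun y => α y * β y) _ x := h
  rw [h'.fderiv]
  rfl

theorem fderiv_sum_smul_apply {κ : Type*} (s : Finset κ) {c : κ → V → ℝ}
    (hc : ∀ k, ContDiff ℝ ∞ (c k)) (u : κ → Covector V) (x v : V) :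
    fderiv ℝ (fun y => ∑ k ∈ s, c k y • u k) x v = ∑ k ∈ s, fderiv ℝ (c k) x v • u k := by
  have h : HasFDerivAt (fun y => ∑ k ∈ s, c k y • u k) _ x :=
    HasFDerivAt.fun_sum fun k _ => (hasFDerivAt_of_smooth (hc k) x).smul_const (u k)
  rw [h.fderiv]
  simp

/-- The exterior derivative of a form with respect to a copy `E` of the differentials, which is
`d` for `E = dx` and `d^#` for `E = dξ`. -/
noncomputable def extDeriv (E : Dual ℝ V →ₗ[ℝ] Covector V) (α : V → Covector V) (x : V) :
    Covector V :=
  ∑ i, E (coordFn V i) * fderiv ℝ α x (stdOrthonormalBasis ℝ V i)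

theorem dSharp_algebraMap {g : V → ℝ} (hg : ContDiff ℝ ∞ g) (x : V) :
    dSharp (fun x => algebraMap ℝ (Covector V) (g x)) x =
      ∑ j, fderiv ℝ g x (stdOrthonormalBasis ℝ V j) • dxi V (coordFn V j) := by
  have h : ∀ v, fderiv ℝ (fun y => algebraMap ℝ (Covector V) (g y)) x v =
      algebraMap ℝ (Covector V) (fderiv ℝ g x v) := fun v =>
    fderiv_comp_linear (Algebra.linearMap ℝ (Covector V)) hg x v
  simp only [dSharp, d, AlgHom.commutes, h, map_sum, map_mul, J_dx]
  refine Finset.sum_congr rfl fun j _ => ?_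
  rw [← Algebra.commutes, ← Algebra.smul_def]

theorem ddSharp_eq {g : V → ℝ} (hg : ContDiff ℝ ∞ g) (x : V) :
    ddSharp g x = matrixForm (hessian g x) := by
  have h : dSharp (fun x => algebraMap ℝ (Covector V) (g x)) = fun x =>
      ∑ j, fderiv ℝ g x (stdOrthonormalBasis ℝ V j) • dxi V (coordFn V j) :=
    funext fun x => dSharp_algebraMap hg x
  rw [ddSharp, h, d, matrixForm]
  refine Finset.sum_congr rfl fun i _ => ?_
  rw [fderiv_sum_smul_apply _ fun k => contDiff_fderiv_apply hg _, Finset.mul_sum]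
  simp only [mul_smul_comm]
  rfl

theorem contDiff_matrixForm {A : V → Fin (finrank ℝ V) → Fin (finrank ℝ V) → ℝ}
    (hA : ∀ i j, ContDiff ℝ ∞ fun x => A x i j) : ContDiff ℝ ∞ fun x => matrixForm (A x) :=
  ContDiff.sum fun i _ => ContDiff.sum fun j _ => ContDiff.fun_smul (hA i j) contDiff_const

theorem contDiff_ddSharp {g : V → ℝ} (hg : ContDiff ℝ ∞ g) : ContDiff ℝ ∞ (ddSharp g) := by
  rw [show ddSharp g = fun x => matrixForm (hessian g x) from funext (ddSharp_eq hg)]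
  exact contDiff_matrixForm (contDiff_hessian hg)

theorem commute_matrixForm (A : Fin (finrank ℝ V) → Fin (finrank ℝ V) → ℝ)
    (u : Covector V) : Commute (matrixForm A) u :=
  Commute.sum_left _ _ _ fun _ _ => Commute.sum_left _ _ _ fun _ _ =>
    (commute_dx_mul_dxi _ _ u).smul_left _

theorem commute_ddSharp {g : V → ℝ} (hg : ContDiff ℝ ∞ g) (x : V) (u : Covector V) :
    Commute (ddSharp g x) u := by
  rw [ddSharp_eq hg]
  exact commute_matrixForm _ _

theorem ddSharp_mem {g : V → ℝ} (hg : ContDiff ℝ ∞ g) (hc : ConvexOn ℝ univ g) (x : V) :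
    ddSharp g x ∈ stronglyPositive V 1 := by
  rw [ddSharp_eq hg]
  exact matrixForm_mem (hessian_posSemidef hg hc x)

theorem hessian_sub {g h : V → ℝ} (hg : ContDiff ℝ ∞ g) (hh : ContDiff ℝ ∞ h) (x : V) :
    hessian (fun y => g y - h y) x = hessian g x - hessian h x := by
  have key : ∀ {g h : V → ℝ}, ContDiff ℝ ∞ g → ContDiff ℝ ∞ h → ∀ x v,
      fderiv ℝ (fun y => g y - h y) x v = fderiv ℝ g x v - fderiv ℝ h x v := by
    intro g h hg hh x v
    have : HasFDerivAt (fun y => g y - h y) _ x :=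
      (hasFDerivAt_of_smooth hg x).sub (hasFDerivAt_of_smooth hh x)
    rw [this.fderiv]; rfl
  ext i j
  simp only [hessian, key hg hh]
  exact key (contDiff_fderiv_apply hg _) (contDiff_fderiv_apply hh _) x _

theorem ddSharp_sub {g h : V → ℝ} (hg : ContDiff ℝ ∞ g) (hh : ContDiff ℝ ∞ h) (x : V) :
    ddSharp (fun y => g y - h y) x = ddSharp g x - ddSharp h x := by
  rw [ddSharp_eq hg, ddSharp_eq hh, ddSharp_eq (hg.sub hh), hessian_sub hg hh]
  simp [matrixForm, sub_smul, Finset.sum_sub_distrib]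

/-- A smooth form that is both `d`-closed and `d^#`-closed. -/
structure IsSmoothClosed (Θ : V → Covector V) : Prop where
  contDiff : ContDiff ℝ ∞ Θ
  d_eq_zero : ∀ x, extDeriv (dx V) Θ x = 0
  dSharp_eq_zero : ∀ x, extDeriv (dxi V) Θ x = 0

theorem isSmoothClosed_const (c : Covector V) : IsSmoothClosed fun _ : V => c where
  contDiff := contDiff_const
  d_eq_zero x := by simp [extDeriv]
  dSharp_eq_zero x := by simp [extDeriv]

theorem extDeriv_mul {E : Dual ℝ V →ₗ[ℝ] Covector V} {α β : V → Covector V}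
    (hα : ContDiff ℝ ∞ α) (hβ : ContDiff ℝ ∞ β) (hc : ∀ x u, Commute (α x) u) (x : V) :
    extDeriv E (fun y => α y * β y) x = extDeriv E α x * β x + α x * extDeriv E β x := by
  simp only [extDeriv, fderiv_mul_apply hα hβ, mul_add, Finset.sum_add_distrib, Finset.sum_mul,
    Finset.mul_sum, mul_assoc]
  rw [add_comm]
  congr 1
  refine Finset.sum_congr rfl fun i _ => ?_
  rw [← mul_assoc, ← (hc x (E _)).eq, mul_assoc]

theorem IsSmoothClosed.mul {α β : V → Covector V} (hα : IsSmoothClosed α) (hβ : IsSmoothClosed β)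
    (hc : ∀ x u, Commute (α x) u) : IsSmoothClosed fun x => α x * β x where
  contDiff := contDiff_mul hα.contDiff hβ.contDiff
  d_eq_zero x := by
    rw [extDeriv_mul hα.contDiff hβ.contDiff hc, hα.d_eq_zero, hβ.d_eq_zero]; simp
  dSharp_eq_zero x := by
    rw [extDeriv_mul hα.contDiff hβ.contDiff hc, hα.dSharp_eq_zero, hβ.dSharp_eq_zero]; simp

/-- The contraction of a symmetric and an antisymmetric array vanishes. -/
theorem sum_sum_smul_eq_zero {ι M : Type*} [Fintype ι] [AddCommGroup M] [Module ℝ M]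
    (s : ι → ι → ℝ) (u : ι → ι → M) (hs : ∀ i j, s i j = s j i) (hu : ∀ i j, u i j = -u j i) :
    ∑ i, ∑ j, s i j • u i j = 0 := by
  have h : ∑ i, ∑ j, s i j • u i j = -∑ i, ∑ j, s i j • u i j := by
    conv_lhs => rw [Finset.sum_comm]
    simp only [← Finset.sum_neg_distrib, ← smul_neg]
    exact Finset.sum_congr rfl fun i _ => Finset.sum_congr rfl fun j _ => by rw [hs, hu]
  have h2 : (2 : ℝ) • ∑ i, ∑ j, s i j • u i j = 0 := by
    rw [two_smul]
    nth_rewrite 1 [h]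
    exact neg_add_cancel _
  exact (smul_eq_zero.1 h2).resolve_left two_ne_zero

theorem fderiv_ddSharp {g : V → ℝ} (hg : ContDiff ℝ ∞ g) (x v : V) :
    fderiv ℝ (ddSharp g) x v = ∑ i, ∑ j, fderiv ℝ (fun y => hessian g y i j) x v •
      (dx V (coordFn V i) * dxi V (coordFn V j)) := by
  rw [show ddSharp g = fun x => ∑ k : Fin (finrank ℝ V) × Fin (finrank ℝ V), hessian g x k.1 k.2 •
    (dx V (coordFn V k.1) * dxi V (coordFn V k.2)) from
      funext fun x => by rw [ddSharp_eq hg, matrixForm, Fintype.sum_prod_type],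
    fderiv_sum_smul_apply _
      (c := fun (k : Fin (finrank ℝ V) × Fin (finrank ℝ V)) y => hessian g y k.1 k.2)
      fun k => contDiff_hessian hg k.1 k.2, Fintype.sum_prod_type]

/-- The form `d d^# g` is closed because the third derivatives of `g` are symmetric. -/
theorem isSmoothClosed_ddSharp {g : V → ℝ} (hg : ContDiff ℝ ∞ g) :
    IsSmoothClosed (ddSharp g) where
  contDiff := contDiff_ddSharp hg
  d_eq_zero x := by
    simp only [extDeriv, fderiv_ddSharp hg, Finset.mul_sum, mul_smul_comm, ← mul_assoc]
    have h : ∀ j, ∑ k, ∑ i, fderiv ℝ (fun y => hessian g y i j) x (stdOrthonormalBasis ℝ V k) •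
        (dx V (coordFn V k) * dx V (coordFn V i) * dxi V (coordFn V j)) = 0 := by
      intro j
      refine sum_sum_smul_eq_zero _ _ (fun k i => ?_) fun k i => ?_
      · exact fderiv_fderiv_comm (contDiff_fderiv_apply hg _) x _ _
      · rw [← neg_mul]
        congr 1
        exact eq_neg_of_add_eq_zero_left (ExteriorAlgebra.ι_add_mul_swap _ _)
    exact (Finset.sum_congr rfl fun k _ => Finset.sum_comm).trans
      (Finset.sum_comm.trans (Finset.sum_eq_zero fun j _ => h j))
  dSharp_eq_zero x := by
    simp only [extDeriv, fderiv_ddSharp hg, Finset.mul_sum, mul_smul_comm, ← mul_assoc]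
    have h : ∀ i, ∑ k, ∑ j, fderiv ℝ (fun y => hessian g y i j) x (stdOrthonormalBasis ℝ V k) •
        (dxi V (coordFn V k) * dx V (coordFn V i) * dxi V (coordFn V j)) = 0 := by
      intro i
      refine sum_sum_smul_eq_zero _ _ (fun k j => ?_) fun k j => ?_
      · have e : ∀ j, (fun y => hessian g y i j) = fun y => hessian g y j i := fun j =>
          funext fun y => hessian_symm hg y i j
        rw [e, e]
        exact fderiv_fderiv_comm (contDiff_fderiv_apply hg _) x _ _
      · have swap : dxi V (coordFn V k) * dxi V (coordFn V j) =
            -(dxi V (coordFn V j) * dxi V (coordFn V k)) :=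
          eq_neg_of_add_eq_zero_left (ExteriorAlgebra.ι_add_mul_swap _ _)
        rw [dxi_mul_dx, dxi_mul_dx, neg_mul, neg_mul, mul_assoc, mul_assoc, swap, mul_neg]
    exact Finset.sum_comm.trans (Finset.sum_eq_zero fun i _ => h i)

/-- The product `d d^# g₁ ∧ … ∧ d d^# gₚ` of a list of functions. -/
noncomputable def listDD (l : List (V → ℝ)) (x : V) : Covector V :=
  (l.map fun g => ddSharp g x).prod

theorem listDD_nil (x : V) : listDD ([] : List (V → ℝ)) x = 1 := rfl

theorem listDD_cons (g : V → ℝ) (l : List (V → ℝ)) (x : V) :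
    listDD (g :: l) x = ddSharp g x * listDD l x := by simp [listDD]

theorem listDD_append (l l' : List (V → ℝ)) (x : V) :
    listDD (l ++ l') x = listDD l x * listDD l' x := by simp [listDD]

theorem wedgeDDSharp_eq {p : ℕ} (g : Fin p → V → ℝ) (x : V) :
    wedgeDDSharp g x = listDD (List.ofFn g) x := by
  simp [wedgeDDSharp, listDD, List.map_ofFn, Function.comp_def]

theorem commute_listDD {l : List (V → ℝ)} (hl : ∀ g ∈ l, ContDiff ℝ ∞ g) (x : V)
    (u : Covector V) : Commute (listDD l x) u := by
  induction l with
  | nil => exact Commute.one_left u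
  | cons g l ih =>
    rw [listDD_cons]
    exact (commute_ddSharp (hl g List.mem_cons_self) x u).mul_left
      (ih fun h hh => hl h (List.mem_cons_of_mem _ hh))

theorem isSmoothClosed_listDD {l : List (V → ℝ)} (hl : ∀ g ∈ l, ContDiff ℝ ∞ g) :
    IsSmoothClosed (listDD l) := by
  induction l with
  | nil => exact isSmoothClosed_const 1
  | cons g l ih =>
    have hg := hl g List.mem_cons_self
    rw [show listDD (g :: l) = fun x => ddSharp g x * listDD l x from
      funext fun x => listDD_cons g l x]
    exact (isSmoothClosed_ddSharp hg).mul (ih fun h hh => hl h (List.mem_cons_of_mem _ hh))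
      (commute_ddSharp hg)

theorem isSmoothClosed_listDD_mul {l : List (V → ℝ)} (hl : ∀ g ∈ l, ContDiff ℝ ∞ g)
    (c : Covector V) : IsSmoothClosed fun x => listDD l x * c :=
  (isSmoothClosed_listDD hl).mul (isSmoothClosed_const c) (commute_listDD hl)

theorem listDD_mem {l : List (V → ℝ)} (hl : ∀ g ∈ l, ContDiff ℝ ∞ g ∧ ConvexOn ℝ univ g) (x : V) :
    listDD l x ∈ stronglyPositive V l.length := by
  have := list_prod_mem_stronglyPositive (l := l.map fun g => ddSharp g x) (by
    intro u hu
    obtain ⟨g, hg, rfl⟩ := List.mem_map.1 hu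
    exact ddSharp_mem (hl g hg).1 (hl g hg).2 x)
  rwa [List.length_map] at this

end Calculus

/-! ### Integration by parts -/

section IntegrationByParts

variable {V : Type*} [NormedAddCommGroup V] [InnerProductSpace ℝ V] [FiniteDimensional ℝ V]
  [MeasurableSpace V] [BorelSpace V]

theorem integral_mul_fderiv {f g : V → ℝ} (hf : ContDiff ℝ ∞ f) (hg : ContDiff ℝ ∞ g)
    (hs : HasCompactSupport f) (v : V) :
    ∫ x, f x * fderiv ℝ g x v = -∫ x, fderiv ℝ f x v * g x := by
  refine integral_mul_fderiv_eq_neg_fderiv_mul_of_integrable ?_ ?_ ?_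
    (fun x _ => hf.differentiable (by simp) x) (fun x _ => hg.differentiable (by simp) x)
  · exact ((contDiff_fderiv_apply hf v).continuous.mul hg.continuous).integrable_of_hasCompactSupport
      (hs.fderiv_apply (𝕜 := ℝ) v).mul_right
  · exact (hf.continuous.mul (contDiff_fderiv_apply hg v).continuous).integrable_of_hasCompactSupport
      hs.mul_right
  · exact (hf.continuous.mul hg.continuous).integrable_of_hasCompactSupport hs.mul_right

theorem integral_fderiv_eq_zero {f : V → ℝ} (hf : ContDiff ℝ ∞ f) (hs : HasCompactSupport f)
    (v : V) : ∫ x, fderiv ℝ f x v = 0 := by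
  have := integral_mul_fderiv hf (contDiff_const (c := (1 : ℝ))) hs v
  simpa using this

/-- The coefficient of `dxᵢ ∧ dξⱼ ∧ Θ`. -/
noncomputable def cofactor (Θ : V → Covector V) (i j : Fin (finrank ℝ V)) (x : V) : ℝ :=
  topCoeff V (dx V (coordFn V i) * dxi V (coordFn V j) * Θ x)

omit [MeasurableSpace V] [BorelSpace V] in
theorem topCoeff_ddSharp_mul {g : V → ℝ} (hg : ContDiff ℝ ∞ g) (Θ : V → Covector V) (x : V) :
    topCoeff V (ddSharp g x * Θ x) = ∑ i, ∑ j, hessian g x i j * cofactor Θ i j x := by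
  simp [ddSharp_eq hg, matrixForm, cofactor, Finset.sum_mul]

namespace IsSmoothClosed

variable {Θ : V → Covector V} (hΘ : IsSmoothClosed Θ)
include hΘ

omit [MeasurableSpace V] [BorelSpace V]

theorem contDiff_cofactor (i j : Fin (finrank ℝ V)) : ContDiff ℝ ∞ (cofactor Θ i j) :=
  contDiff_linear (topCoeff V ∘ₗ LinearMap.mulLeft ℝ
    (dx V (coordFn V i) * dxi V (coordFn V j))) hΘ.contDiff

theorem fderiv_cofactor (i j : Fin (finrank ℝ V)) (x v : V) : fderiv ℝ (cofactor Θ i j) x v =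
    topCoeff V (dx V (coordFn V i) * dxi V (coordFn V j) * fderiv ℝ Θ x v) :=
  fderiv_comp_linear (topCoeff V ∘ₗ LinearMap.mulLeft ℝ
    (dx V (coordFn V i) * dxi V (coordFn V j))) hΘ.contDiff x v

/-- `d Θ = 0` says that the columns of the cofactor matrix are divergence free. -/
theorem sum_fderiv_cofactor_left (j : Fin (finrank ℝ V)) (x : V) :
    ∑ i, fderiv ℝ (cofactor Θ i j) x (stdOrthonormalBasis ℝ V i) = 0 := by
  have h : ∑ i, fderiv ℝ (cofactor Θ i j) x (stdOrthonormalBasis ℝ V i) =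
      -topCoeff V (dxi V (coordFn V j) * extDeriv (dx V) Θ x) := by
    simp only [hΘ.fderiv_cofactor, extDeriv, Finset.mul_sum, map_sum, ← Finset.sum_neg_distrib]
    refine Finset.sum_congr rfl fun i _ => ?_
    rw [← mul_assoc, dxi_mul_dx, neg_mul, map_neg, neg_neg]
  rw [h, hΘ.d_eq_zero]
  simp

/-- `d^# Θ = 0` says that the rows of the cofactor matrix are divergence free. -/
theorem sum_fderiv_cofactor_right (i : Fin (finrank ℝ V)) (x : V) :
    ∑ j, fderiv ℝ (cofactor Θ i j) x (stdOrthonormalBasis ℝ V j) = 0 := by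
  have h : ∑ j, fderiv ℝ (cofactor Θ i j) x (stdOrthonormalBasis ℝ V j) =
      topCoeff V (dx V (coordFn V i) * extDeriv (dxi V) Θ x) := by
    simp only [hΘ.fderiv_cofactor, extDeriv, Finset.mul_sum, map_sum, mul_assoc]
  rw [h, hΘ.dSharp_eq_zero]
  simp

end IsSmoothClosed

omit [FiniteDimensional ℝ V] [MeasurableSpace V] [BorelSpace V] in
theorem fderiv_mul_real_apply {f g : V → ℝ} (hf : ContDiff ℝ ∞ f) (hg : ContDiff ℝ ∞ g)
    (x v : V) : fderiv ℝ (fun y => f y * g y) x v =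
      f x * fderiv ℝ g x v + fderiv ℝ f x v * g x := by
  have : HasFDerivAt (fun y => f y * g y) _ x :=
    (hasFDerivAt_of_smooth hf x).mul (hasFDerivAt_of_smooth hg x)
  rw [this.fderiv]
  simp [mul_comm]

/-- The operator `u ↦ d d^# u ∧ Θ` with a closed form `Θ` is symmetric. -/
theorem IsSmoothClosed.integral_mul_ddSharp {Θ : V → Covector V} (hΘ : IsSmoothClosed Θ)
    {φ u : V → ℝ} (hφ : ContDiff ℝ ∞ φ) (hs : HasCompactSupport φ) (hu : ContDiff ℝ ∞ u) :
    ∫ x, φ x * topCoeff V (ddSharp u x * Θ x) = ∫ x, u x * topCoeff V (ddSharp φ x * Θ x) := by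
  set e := stdOrthonormalBasis ℝ V
  set M := cofactor Θ with hM
  have sM : ∀ i j, ContDiff ℝ ∞ (M i j) := hΘ.contDiff_cofactor
  have sD : ∀ {g : V → ℝ}, ContDiff ℝ ∞ g → ∀ i, ContDiff ℝ ∞ fun x => fderiv ℝ g x (e i) :=
    fun hg i => contDiff_fderiv_apply hg _
  have cD : ∀ i, HasCompactSupport fun x => fderiv ℝ φ x (e i) :=
    fun i => hs.fderiv_apply (𝕜 := ℝ) _
  -- both sides equal `-∫ ∑ᵢⱼ ∂ᵢφ ∂ⱼu Mᵢⱼ`, where `M` has divergence-free rows and columns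
  have h1 : ∫ x, φ x * topCoeff V (ddSharp u x * Θ x) =
      -∑ j, ∑ i, ∫ x, fderiv ℝ φ x (e i) * M i j x * fderiv ℝ u x (e j) := by
    have e1 : ∀ x, φ x * topCoeff V (ddSharp u x * Θ x) =
        ∑ j, ∑ i, φ x * M i j x * fderiv ℝ (fun y => fderiv ℝ u y (e j)) x (e i) := by
      intro x
      rw [topCoeff_ddSharp_mul hu, Finset.sum_comm]
      simp only [Finset.mul_sum]
      exact Finset.sum_congr rfl fun j _ => Finset.sum_congr rfl fun i _ => by
        simp only [hessian, hM, e]; ring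
    have i1 : ∀ i j, Integrable fun x =>
        φ x * M i j x * fderiv ℝ (fun y => fderiv ℝ u y (e j)) x (e i) := fun i j =>
      ((hφ.continuous.mul (sM i j).continuous).mul
        (sD (sD hu j) i).continuous).integrable_of_hasCompactSupport hs.mul_right.mul_right
    have i2 : ∀ i j, Integrable fun x =>
        fderiv ℝ (fun y => φ y * M i j y) x (e i) * fderiv ℝ u x (e j) := fun i j =>
      ((sD (hφ.mul (sM i j)) i).continuous.mul
        (sD hu j).continuous).integrable_of_hasCompactSupport
        ((hs.mul_right.fderiv_apply (𝕜 := ℝ) _).mul_right)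
    have i3 : ∀ i j, Integrable fun x =>
        fderiv ℝ φ x (e i) * M i j x * fderiv ℝ u x (e j) := fun i j =>
      (((sD hφ i).continuous.mul (sM i j).continuous).mul
        (sD hu j).continuous).integrable_of_hasCompactSupport (cD i).mul_right.mul_right
    simp only [e1]
    rw [integral_finsetSum _ fun j _ => integrable_finsetSum _ fun i _ => i1 i j,
      ← Finset.sum_neg_distrib]
    refine Finset.sum_congr rfl fun j _ => ?_
    rw [integral_finsetSum _ fun i _ => i1 i j, ← integral_finsetSum _ fun i _ => i3 i j]
    rw [Finset.sum_congr rfl fun i _ => integral_mul_fderiv (hφ.mul (sM i j)) (sD hu j)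
      hs.mul_right (e i), Finset.sum_neg_distrib, ← integral_finsetSum _ fun i _ => i2 i j]
    congr 2
    funext x
    simp only [fderiv_mul_real_apply hφ (sM _ j), add_mul, Finset.sum_add_distrib]
    rw [← Finset.sum_mul, ← Finset.mul_sum, hΘ.sum_fderiv_cofactor_left]
    simp
  have h2 : ∫ x, u x * topCoeff V (ddSharp φ x * Θ x) =
      -∑ i, ∑ j, ∫ x, fderiv ℝ φ x (e i) * M i j x * fderiv ℝ u x (e j) := by
    have i1 : ∀ i j, Integrable fun x =>
        fderiv ℝ (fun y => fderiv ℝ φ y (e i) * M i j y) x (e j) * u x := fun i j =>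
      ((sD ((sD hφ i).mul (sM i j)) j).continuous.mul
        hu.continuous).integrable_of_hasCompactSupport
        (((cD i).mul_right.fderiv_apply (𝕜 := ℝ) _).mul_right)
    simp only [integral_mul_fderiv ((sD hφ _).mul (sM _ _)) hu ((cD _).mul_right),
      Finset.sum_neg_distrib, neg_neg]
    rw [← Finset.sum_congr rfl fun i _ => integral_finsetSum _ fun j _ => i1 i j,
      ← integral_finsetSum _ fun i _ => integrable_finsetSum _ fun j _ => i1 i j]
    congr 1
    funext x
    rw [topCoeff_ddSharp_mul hφ, Finset.mul_sum]
    refine Finset.sum_congr rfl fun i _ => ?_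
    simp only [fderiv_mul_real_apply (sD hφ i) (sM i _), add_mul, Finset.sum_add_distrib]
    rw [← Finset.sum_mul, ← Finset.mul_sum, hΘ.sum_fderiv_cofactor_right, mul_zero, zero_mul,
      zero_add, Finset.mul_sum]
    refine Finset.sum_congr rfl fun j _ => ?_
    rw [hessian_symm hφ]
    simp only [hessian, hM, e]
    ring
  rw [h1, h2, Finset.sum_comm]

/-- Stokes' formula for the product of a closed form with a compactly supported form. -/
theorem IsSmoothClosed.integral_mul_d {W : V → Covector V} (hW : IsSmoothClosed W)
    (hc : ∀ x u, Commute (W x) u) {β : V → Covector V} (hβ : ContDiff ℝ ∞ β)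
    (hs : HasCompactSupport β) : ∫ x, topCoeff V (W x * d β x) = 0 := by
  have hWβ := contDiff_mul hW.contDiff hβ
  have sWβ : HasCompactSupport fun x => W x * β x := by
    refine hs.mono ?_
    intro x hx hx'
    exact hx (by simp [hx'])
  have h1 : ∀ x, W x * d β x = extDeriv (dx V) (fun y => W y * β y) x := by
    intro x
    rw [extDeriv_mul hW.contDiff hβ hc, hW.d_eq_zero, zero_mul, zero_add]
    rfl
  have h2 : ∀ x, topCoeff V (W x * d β x) = ∑ i,
      fderiv ℝ (fun y => (topCoeff V ∘ₗ LinearMap.mulLeft ℝ (dx V (coordFn V i))) (W y * β y)) x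
        (stdOrthonormalBasis ℝ V i) := by
    intro x
    simp only [h1, extDeriv, map_sum, fderiv_comp_linear _ hWβ]
    rfl
  simp only [h2]
  have smooth : ∀ i, ContDiff ℝ ∞ fun y =>
      (topCoeff V ∘ₗ LinearMap.mulLeft ℝ (dx V (coordFn V i))) (W y * β y) :=
    fun i => contDiff_linear _ hWβ
  have supp : ∀ i, HasCompactSupport fun y =>
      (topCoeff V ∘ₗ LinearMap.mulLeft ℝ (dx V (coordFn V i))) (W y * β y) :=
    fun i => sWβ.comp_left (map_zero _)
  rw [integral_finsetSum]
  · exact Finset.sum_eq_zero fun i _ => integral_fderiv_eq_zero (smooth i) (supp i) _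
  · exact fun i _ => (contDiff_fderiv_apply (smooth i) _).continuous.integrable_of_hasCompactSupport
      ((supp i).fderiv_apply (𝕜 := ℝ) _)

end IntegrationByParts

/-! ### The Chern–Levine–Nirenberg inequality -/

section Cutoff

variable {V : Type*} [NormedAddCommGroup V] [InnerProductSpace ℝ V] [FiniteDimensional ℝ V]

theorem hessian_eq_zero {g : V → ℝ} {x : V} (hx : x ∉ tsupport g) (i j : Fin (finrank ℝ V)) :
    hessian g x i j = 0 := by
  have h1 : x ∉ tsupport fun y => fderiv ℝ g y (stdOrthonormalBasis ℝ V j) := fun h =>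
    hx (tsupport_fderiv_apply_subset ℝ _ h)
  have h2 := image_eq_zero_of_notMem_tsupport fun h => h1 (tsupport_fderiv_apply_subset ℝ
    (stdOrthonormalBasis ℝ V i) h)
  exact h2

omit [FiniteDimensional ℝ V] in
theorem fderiv_comp_smul {F : Type*} [NormedAddCommGroup F] [NormedSpace ℝ F] {g : V → F}
    (hg : ContDiff ℝ ∞ g) (s : ℝ) (x v : V) :
    fderiv ℝ (fun y => g (s • y)) x v = s • fderiv ℝ g (s • x) v := by
  have h1 : HasFDerivAt (fun y : V => s • y) (s • ContinuousLinearMap.id ℝ V) x :=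
    (hasFDerivAt_id x).const_smul s
  have h : HasFDerivAt (fun y => g (s • y)) _ x :=
    (hasFDerivAt_of_smooth hg (s • x)).comp x h1
  rw [h.fderiv]
  simp

variable (V) in
/-- Cutoff functions of the balls of radius `R`, with the expected size of their derivatives. -/
theorem exists_smooth_cutoff : ∃ K : ℝ, 0 ≤ K ∧ ∀ R : ℝ, 0 < R → ∃ χ : V → ℝ,
    ContDiff ℝ ∞ χ ∧ HasCompactSupport χ ∧ (∀ x, χ x ∈ Icc (0 : ℝ) 1) ∧
    (∀ x ∈ Metric.closedBall (0 : V) R, χ x = 1) ∧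
    (tsupport χ ⊆ Metric.closedBall 0 (2 * R)) ∧
    (∀ x i, |fderiv ℝ χ x (stdOrthonormalBasis ℝ V i)| ≤ K / R) ∧
    (∀ x i j, |hessian χ x i j| ≤ K / R ^ 2) := by
  let f : ContDiffBump (0 : V) := ⟨1, 2, one_pos, one_lt_two⟩
  have sf : ContDiff ℝ ∞ f := f.contDiff
  have cf : HasCompactSupport f := f.hasCompactSupport
  have h1 : ∀ i, ∃ C, ∀ x, |fderiv ℝ f x (stdOrthonormalBasis ℝ V i)| ≤ C := fun i =>
    (cf.fderiv_apply (𝕜 := ℝ) (stdOrthonormalBasis ℝ V i)).exists_bound_of_continuous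
      (contDiff_fderiv_apply sf _).continuous
  have h2 : ∀ i j, ∃ C, ∀ x, |hessian f x i j| ≤ C := fun i j =>
    ((cf.fderiv_apply (𝕜 := ℝ) (stdOrthonormalBasis ℝ V j)).fderiv_apply (𝕜 := ℝ)
      (stdOrthonormalBasis ℝ V i)).exists_bound_of_continuous (contDiff_hessian sf i j).continuous
  choose C1 hC1 using h1
  choose C2 hC2 using h2
  have p1 : ∀ i, 0 ≤ C1 i := fun i => (abs_nonneg _).trans (hC1 i 0)
  have p2 : ∀ i j, 0 ≤ C2 i j := fun i j => (abs_nonneg _).trans (hC2 i j 0)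
  refine ⟨∑ i, C1 i + ∑ i, ∑ j, C2 i j, add_nonneg (Finset.sum_nonneg fun i _ => p1 i)
    (Finset.sum_nonneg fun i _ => Finset.sum_nonneg fun j _ => p2 i j), fun R hR => ?_⟩
  have s0 : ContDiff ℝ ∞ fun y : V => f (R⁻¹ • y) :=
    sf.comp (contDiff_const_smul R⁻¹)
  have hsupp : tsupport (fun y : V => f (R⁻¹ • y)) ⊆ Metric.closedBall 0 (2 * R) := by
    refine closure_minimal ?_ Metric.isClosed_closedBall
    intro x hx
    have : R⁻¹ • x ∈ Function.support f := hx
    rw [f.support_eq, mem_ball_zero_iff, norm_smul, norm_inv, Real.norm_of_nonneg hR.le,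
      inv_mul_lt_iff₀ hR] at this
    rw [mem_closedBall_zero_iff]
    change ‖x‖ < R * 2 at this
    linarith
  refine ⟨fun y => f (R⁻¹ • y), s0,
    (isCompact_closedBall (0 : V) (2 * R)).of_isClosed_subset (isClosed_tsupport _) hsupp,
    fun x => ⟨f.nonneg, f.le_one⟩, fun x hx => ?_, hsupp, fun x i => ?_, fun x i j => ?_⟩
  · refine f.one_of_mem_closedBall ?_
    rw [mem_closedBall_zero_iff] at hx ⊢
    rw [norm_smul, norm_inv, Real.norm_of_nonneg hR.le, inv_mul_le_iff₀ hR]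
    change _ ≤ R * 1
    linarith
  · rw [fderiv_comp_smul sf, smul_eq_mul, abs_mul, abs_of_pos (inv_pos.2 hR), ← div_eq_inv_mul]
    gcongr
    exact (hC1 i _).trans ((Finset.single_le_sum (fun i _ => p1 i) (Finset.mem_univ i)).trans
      (le_add_of_nonneg_right
        (Finset.sum_nonneg fun i _ => Finset.sum_nonneg fun j _ => p2 i j)))
  · have : hessian (fun y => f (R⁻¹ • y)) x i j = R⁻¹ * (R⁻¹ * hessian f (R⁻¹ • x) i j) := by
      simp only [hessian, fderiv_comp_smul sf]
      have h3 := fderiv_comp_linear (LinearMap.lsmul ℝ ℝ R⁻¹)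
        ((contDiff_fderiv_apply sf (stdOrthonormalBasis ℝ V j)).comp
          (contDiff_const_smul (R⁻¹))) x (stdOrthonormalBasis ℝ V i)
      have h4 := fderiv_comp_smul (contDiff_fderiv_apply sf (stdOrthonormalBasis ℝ V j)) R⁻¹ x
        (stdOrthonormalBasis ℝ V i)
      simp only [Function.comp_def] at h3
      rw [h4] at h3
      exact h3
    rw [this, abs_mul, abs_mul, abs_of_pos (inv_pos.2 hR), ← mul_assoc, ← mul_inv, ← sq,
      ← div_eq_inv_mul]
    gcongr
    refine (hC2 i j _).trans (le_trans ?_ (le_add_of_nonneg_left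
      (Finset.sum_nonneg fun i _ => p1 i)))
    exact (Finset.single_le_sum (fun j _ => p2 i j) (Finset.mem_univ j)).trans
      (Finset.single_le_sum (f := fun i => ∑ j, C2 i j)
        (fun i _ => Finset.sum_nonneg fun j _ => p2 i j) (Finset.mem_univ i))

end Cutoff

section CLN

variable {V : Type*} [NormedAddCommGroup V] [InnerProductSpace ℝ V] [FiniteDimensional ℝ V]

/-- A smooth convex function. -/
def SmoothConvex (g : V → ℝ) : Prop := ContDiff ℝ ∞ g ∧ ConvexOn ℝ univ g

/-- The density of `d d^# g₁ ∧ … ∧ d d^# gₚ ∧ c` for a constant form `c`. -/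
noncomputable def density (l : List (V → ℝ)) (c : Covector V) (x : V) : ℝ :=
  topCoeff V (listDD l x * c)

theorem contDiff_density {l : List (V → ℝ)} (hl : ∀ g ∈ l, ContDiff ℝ ∞ g) (c : Covector V) :
    ContDiff ℝ ∞ (density l c) :=
  contDiff_linear (topCoeff V) (isSmoothClosed_listDD_mul hl c).contDiff

theorem density_nonneg {l : List (V → ℝ)} (hl : ∀ g ∈ l, SmoothConvex g) {c : Covector V} {r : ℕ}
    (hc : c ∈ stronglyPositive V r) (h : l.length + r = finrank ℝ V) (x : V) :
    0 ≤ density l c x :=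
  topCoeff_nonneg_of_eq (mul_mem_stronglyPositive h (listDD_mem hl x) hc) rfl

theorem kahlerForm_pow_mem (r : ℕ) : kahlerForm V ^ r ∈ stronglyPositive V r :=
  pow_mem_stronglyPositive kahlerForm_mem r

/-- Where the Hessian of `φ` is bounded, `d d^# φ` is dominated by a multiple of the Kähler form. -/
theorem abs_topCoeff_ddSharp_mul_le {l : List (V → ℝ)} (hl : ∀ g ∈ l, SmoothConvex g)
    {c : Covector V} {r : ℕ} (hc : c ∈ stronglyPositive V r)
    (h : l.length + 1 + r = finrank ℝ V) {φ : V → ℝ} (hφ : ContDiff ℝ ∞ φ) {K : ℝ} {x : V}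
    (hK : ∀ i j, |hessian φ x i j| ≤ K) :
    |topCoeff V (ddSharp φ x * (listDD l x * c))| ≤
      finrank ℝ V * K * density l (c * kahlerForm V) x := by
  have h1 := abs_topCoeff_matrixForm_le (p := l.length + r) (by omega)
    (mul_mem_stronglyPositive rfl (listDD_mem hl x) hc) hK
  rw [ddSharp_eq hφ, (commute_matrixForm _ _).eq, density, ← mul_assoc]
  exact h1

variable [MeasurableSpace V] [BorelSpace V]

/-- The Chern–Levine–Nirenberg inequality for convex functions bounded by `M` on a larger ball. The
functions are removed one at a time: `d d^#` is moved from `g` to a cutoff function `χ`, whose Hessian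
is of size `R⁻²`, at the price of doubling the radius. -/
theorem exists_chern_levine_nirenberg (j : ℕ) : ∃ C : ℝ, 0 ≤ C ∧ ∀ (l : List (V → ℝ)) (r : ℕ) (R M : ℝ),
    l.length = j → j + r = finrank ℝ V → 0 < R → 0 ≤ M →
    (∀ g ∈ l, SmoothConvex g ∧ ∀ x ∈ Metric.closedBall (0 : V) (2 ^ j * R), |g x| ≤ M) →
    ∫ x in Metric.closedBall (0 : V) R, density l (kahlerForm V ^ r) x ≤
      C * (M / R ^ 2) ^ j * R ^ finrank ℝ V := by
  induction j with
  | zero =>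
    refine ⟨volume.real (Metric.closedBall (0 : V) 1) * topCoeff V (kahlerForm V ^ finrank ℝ V),
      mul_nonneg measureReal_nonneg
        (topCoeff_nonneg_of_eq (kahlerForm_pow_mem _) rfl), ?_⟩
    intro l r R M hl hr hR hM _
    obtain rfl := List.length_eq_zero_iff.1 hl
    obtain rfl : r = finrank ℝ V := by omega
    simp only [density, listDD_nil, one_mul, setIntegral_const, smul_eq_mul, pow_zero, mul_one]
    rw [Measure.addHaar_real_closedBall' _ _ hR.le]
    exact le_of_eq (by ring)
  | succ j ih =>
    obtain ⟨C, hC, ih⟩ := ih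
    obtain ⟨K, hK, hcut⟩ := exists_smooth_cutoff V
    refine ⟨finrank ℝ V * K * C * 2 ^ finrank ℝ V, by positivity, ?_⟩
    intro l r R M hl hr hR hM hg
    obtain ⟨g, t, rfl⟩ : ∃ g t, l = g :: t := by
      cases l with
      | nil => simp at hl
      | cons g t => exact ⟨g, t, rfl⟩
    have ht : t.length = j := by simpa using hl
    obtain ⟨χ, sχ, cχ, bχ, oneχ, suppχ, -, hχ⟩ := hcut R hR
    have hgs := (hg g List.mem_cons_self).1
    have hts : ∀ h ∈ t, SmoothConvex h := fun h hh => (hg h (List.mem_cons_of_mem _ hh)).1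
    have sall : ∀ h ∈ g :: t, ContDiff ℝ ∞ h := fun h hh => (hg h hh).1.1
    have stail : ∀ h ∈ t, ContDiff ℝ ∞ h := fun h hh => (hts h hh).1
    have cont := (contDiff_density sall (kahlerForm V ^ r)).continuous
    have nonneg : ∀ x, 0 ≤ density (g :: t) (kahlerForm V ^ r) x :=
      density_nonneg (fun h hh => (hg h hh).1) (kahlerForm_pow_mem r) (by simp; omega)
    have int1 : Integrable fun x => χ x * density (g :: t) (kahlerForm V ^ r) x :=
      (sχ.continuous.mul cont).integrable_of_hasCompactSupport cχ.mul_right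
    set B := Metric.closedBall (0 : V) R
    set B2 := Metric.closedBall (0 : V) (2 * R)
    -- the integral over the smaller ball is at most the integral against the cutoff function
    have le_cutoff : ∫ x in B, density (g :: t) (kahlerForm V ^ r) x ≤
        ∫ x, χ x * density (g :: t) (kahlerForm V ^ r) x := by
      rw [setIntegral_congr_fun (g := fun x => χ x * density (g :: t) (kahlerForm V ^ r) x)
        Metric.isClosed_closedBall.measurableSet fun x hx => by
          simp only [oneχ x hx, one_mul]]
      exact setIntegral_le_integral int1 (Eventually.of_forall fun x =>
        mul_nonneg (bχ x).1 (nonneg x))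
    have by_parts : ∫ x, χ x * density (g :: t) (kahlerForm V ^ r) x =
        ∫ x, g x * topCoeff V (ddSharp χ x * (listDD t x * kahlerForm V ^ r)) := by
      rw [← (isSmoothClosed_listDD_mul stail _).integral_mul_ddSharp sχ cχ hgs.1]
      simp only [density, listDD_cons, mul_assoc]
    have cont2 : Continuous fun x =>
        g x * topCoeff V (ddSharp χ x * (listDD t x * kahlerForm V ^ r)) :=
      hgs.1.continuous.mul (contDiff_linear (topCoeff V) (contDiff_mul (contDiff_ddSharp sχ)
        (isSmoothClosed_listDD_mul stail _).contDiff)).continuous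
    have cont3 := (contDiff_density stail (kahlerForm V ^ (r + 1))).continuous
    have le_outer : ∫ x, g x * topCoeff V (ddSharp χ x * (listDD t x * kahlerForm V ^ r)) ≤
        ∫ x in B2, M * (finrank ℝ V * (K / R ^ 2)) * density t (kahlerForm V ^ (r + 1)) x := by
      rw [← setIntegral_eq_integral_of_forall_compl_eq_zero (s := B2)]
      · refine setIntegral_mono_on (cont2.continuousOn.integrableOn_compact
          (isCompact_closedBall _ _)) ((continuous_const.mul cont3).continuousOn.integrableOn_compact
          (isCompact_closedBall _ _)) Metric.isClosed_closedBall.measurableSet fun x hx => ?_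
        refine (le_abs_self _).trans ?_
        rw [abs_mul, mul_assoc]
        refine mul_le_mul ((hg g List.mem_cons_self).2 x ?_) ?_ (abs_nonneg _) hM
        · refine Metric.closedBall_subset_closedBall ?_ hx
          rw [pow_succ]
          nlinarith [one_le_pow₀ (M₀ := ℝ) (n := j) one_le_two]
        · rw [pow_succ (kahlerForm V)]
          exact abs_topCoeff_ddSharp_mul_le hts (kahlerForm_pow_mem r) (by omega) sχ (hχ x)
      · intro x hx
        have : ddSharp χ x = 0 := by
          rw [ddSharp_eq sχ]
          simp [matrixForm, hessian_eq_zero fun h => hx (suppχ h)]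
        simp [this]
    have ih_bound := ih t (r + 1) (2 * R) M ht (by omega) (by positivity) hM fun h hh =>
      ⟨hts h hh, fun x hx => (hg h (List.mem_cons_of_mem _ hh)).2 x (by
        rwa [pow_succ, mul_assoc])⟩
    refine (le_cutoff.trans (by_parts.trans_le le_outer)).trans ?_
    rw [integral_const_mul]
    refine (mul_le_mul_of_nonneg_left ih_bound (by positivity)).trans ?_
    have h5 : (M / (2 * R) ^ 2) ^ j ≤ (M / R ^ 2) ^ j := by
      gcongr
      nlinarith
    calc _ ≤ M * (finrank ℝ V * (K / R ^ 2)) * (C * (M / R ^ 2) ^ j *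
          (2 * R) ^ finrank ℝ V) := by gcongr
      _ = _ := by rw [mul_pow, pow_succ]; ring

end CLN

/-! ### Mass bounds on unbounded cylinders -/

section Cylinder

theorem hasDerivAt_sqrt_one_add_sq (t : ℝ) :
    HasDerivAt (fun t : ℝ => √(1 + t ^ 2)) (t / √(1 + t ^ 2)) t := by
  have h0 : (1 + t ^ 2) ≠ 0 := by positivity
  have h1 : HasDerivAt (fun t : ℝ => 1 + t ^ 2) (2 * t) t := by
    simpa using ((hasDerivAt_id t).pow 2).const_add 1
  convert h1.sqrt h0 using 1
  field_simp

theorem hasDerivAt_div_sqrt_one_add_sq (t : ℝ) :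
    HasDerivAt (fun t : ℝ => t / √(1 + t ^ 2)) ((√(1 + t ^ 2) ^ 3)⁻¹) t := by
  have h0 : 0 < 1 + t ^ 2 := by positivity
  have hs : √(1 + t ^ 2) ≠ 0 := (Real.sqrt_pos.2 h0).ne'
  refine ((hasDerivAt_id t).div (hasDerivAt_sqrt_one_add_sq t) hs).congr_deriv ?_
  change (1 * √(1 + t ^ 2) - t * (t / √(1 + t ^ 2))) / √(1 + t ^ 2) ^ 2 = _
  have h2 : √(1 + t ^ 2) ^ 2 = 1 + t ^ 2 := Real.sq_sqrt h0.le
  field_simp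
  rw [h2]
  ring

theorem convexOn_sqrt_one_add_sq : ConvexOn ℝ univ fun t : ℝ => √(1 + t ^ 2) := by
  refine convexOn_of_hasDerivWithinAt2_nonneg (f' := fun t => t / √(1 + t ^ 2))
    (f'' := fun t => (√(1 + t ^ 2) ^ 3)⁻¹) convex_univ ?_ ?_ ?_ ?_
  · exact fun t _ => (hasDerivAt_sqrt_one_add_sq t).continuousAt.continuousWithinAt
  · exact fun t _ => (hasDerivAt_sqrt_one_add_sq t).hasDerivWithinAt
  · exact fun t _ => (hasDerivAt_div_sqrt_one_add_sq t).hasDerivWithinAt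
  · exact fun t _ => by positivity

variable {V : Type*} [NormedAddCommGroup V] [InnerProductSpace ℝ V] [FiniteDimensional ℝ V]

/-- The Lelong class potential `√(1 + a²)` of a covector `a`. Its form `d d^#` is a positive multiple
of the elementary form of `a`. -/
noncomputable def ridge (a : Dual ℝ V) (x : V) : ℝ := √(1 + a x ^ 2)

theorem contDiff_dual (a : Dual ℝ V) : ContDiff ℝ ∞ a :=
  (LinearMap.toContinuousLinearMap a).contDiff

theorem smoothConvex_ridge (a : Dual ℝ V) : SmoothConvex (ridge a) := by
  refine ⟨?_, convexOn_sqrt_one_add_sq.comp_linearMap a⟩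
  refine ContDiff.sqrt (contDiff_const.add ((contDiff_dual a).pow 2)) fun x => ?_
  positivity

theorem abs_ridge_le (a : Dual ℝ V) (x : V) :
    |ridge a x| ≤ 1 + ‖LinearMap.toContinuousLinearMap a‖ * ‖x‖ := by
  have h1 : |a x| ≤ ‖LinearMap.toContinuousLinearMap a‖ * ‖x‖ :=
    (LinearMap.toContinuousLinearMap a).le_opNorm x
  rw [ridge, abs_of_nonneg (Real.sqrt_nonneg _)]
  refine (Real.sqrt_le_left (by positivity)).2 ?_
  nlinarith [abs_nonneg (a x), sq_abs (a x)]

theorem ddSharp_ridge (a : Dual ℝ V) (x : V) :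
    ddSharp (ridge a) x = (√(1 + a x ^ 2) ^ 3)⁻¹ • elemForm a := by
  have ha : ∀ x : V, HasFDerivAt a (LinearMap.toContinuousLinearMap a) x := fun x =>
    (LinearMap.toContinuousLinearMap a).hasFDerivAt
  have h1 : ∀ y v, fderiv ℝ (ridge a) y v = a y / √(1 + a y ^ 2) * a v := by
    intro y v
    have h : HasFDerivAt (ridge a) _ y :=
      (hasDerivAt_sqrt_one_add_sq (a y)).comp_hasFDerivAt y (ha y)
    rw [h.fderiv]
    rfl
  have h2 : ∀ y v w, fderiv ℝ (fun z => a z / √(1 + a z ^ 2) * a w) y v =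
      (√(1 + a y ^ 2) ^ 3)⁻¹ * (a v * a w) := by
    intro y v w
    have h : HasFDerivAt (fun z => a z / √(1 + a z ^ 2) * a w) _ y :=
      ((hasDerivAt_div_sqrt_one_add_sq (a y)).comp_hasFDerivAt y (ha y)).mul_const (a w)
    rw [h.fderiv]
    simp
    ring
  rw [ddSharp_eq (smoothConvex_ridge a).1, elemForm_eq_matrixForm, matrixForm, matrixForm,
    Finset.smul_sum]
  refine Finset.sum_congr rfl fun i _ => ?_
  rw [Finset.smul_sum]
  refine Finset.sum_congr rfl fun j _ => ?_
  rw [smul_smul]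
  congr 1
  simp only [hessian, h1, h2]

theorem listDD_ridge (a : List (Dual ℝ V)) (x : V) :
    listDD (a.map ridge) x =
      (a.map fun b => (√(1 + b x ^ 2) ^ 3)⁻¹).prod • (a.map elemForm).prod := by
  induction a with
  | nil => simp [listDD_nil]
  | cons b a ih =>
    simp only [List.map_cons, listDD_cons, List.prod_cons, ih, ddSharp_ridge, smul_mul_smul_comm]

/-- The part of a cylinder `{|b| ≤ B for b ∈ a}` in a ball. -/
def cylinder (a : List (Dual ℝ V)) (B R : ℝ) : Set V :=
  Metric.closedBall 0 R ∩ {x | ∀ b ∈ a, |b x| ≤ B}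

theorem isCompact_cylinder (a : List (Dual ℝ V)) (B R : ℝ) : IsCompact (cylinder a B R) := by
  refine (isCompact_closedBall 0 R).inter_right ?_
  have : {x : V | ∀ b ∈ a, |b x| ≤ B} = ⋂ b ∈ a, {x | |b x| ≤ B} := by ext; simp
  rw [this]
  exact isClosed_biInter fun b _ => isClosed_le (contDiff_dual b).continuous.abs continuous_const

variable [MeasurableSpace V] [BorelSpace V]

/-- The mass of `d d^# g₁ ∧ … ∧ d d^# gₚ ∧ a₁(dx) ∧ a₁(dξ) ∧ …` on the cylinder where the `aᵢ` are
bounded grows only with the number `r` of remaining directions. On the cylinder each `aᵢ(dx) ∧ aᵢ(dξ)`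
is dominated by `d d^#` of a function of linear growth, which makes the bound on balls applicable. -/
theorem exists_cylinder_bound (p r : ℕ) (a : List (Dual ℝ V)) (h : p + a.length + r = finrank ℝ V)
    (B M : ℝ) (hM : 0 ≤ M) : ∃ C : ℝ, 0 ≤ C ∧ ∀ (l : List (V → ℝ)) (R : ℝ), l.length = p → 1 ≤ R →
      (∀ g ∈ l, SmoothConvex g ∧
        ∀ x ∈ Metric.closedBall (0 : V) (2 ^ finrank ℝ V * R), |g x| ≤ M * R) →
      ∫ x in cylinder a B R, density l ((a.map elemForm).prod * kahlerForm V ^ r) x ≤ C * R ^ r := by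
  obtain ⟨C, hC, hcln⟩ := exists_chern_levine_nirenberg (V := V) (p + a.length)
  set A : ℝ := (a.map fun b => ‖LinearMap.toContinuousLinearMap b‖).sum with hA
  have hA0 : ∀ b ∈ a, ‖LinearMap.toContinuousLinearMap b‖ ≤ A := fun b hb =>
    List.single_le_sum (by simp) _ (List.mem_map_of_mem hb)
  have hA1 : 0 ≤ A := List.sum_nonneg (by simp)
  set M' : ℝ := M + (1 + A * 2 ^ finrank ℝ V) with hM'
  set κ : ℝ := √(1 + B ^ 2) ^ 3 with hκ
  have hκ0 : 0 < κ := by positivity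
  refine ⟨κ ^ a.length * (C * M' ^ (p + a.length)), by positivity, ?_⟩
  intro l R hl hR hg
  have hR0 : 0 < R := by linarith
  have hall : ∀ g ∈ l ++ a.map ridge, SmoothConvex g ∧
      ∀ x ∈ Metric.closedBall (0 : V) (2 ^ (p + a.length) * R), |g x| ≤ M' * R := by
    intro g hgm
    have hsub : Metric.closedBall (0 : V) (2 ^ (p + a.length) * R) ⊆
        Metric.closedBall (0 : V) (2 ^ finrank ℝ V * R) := by
      refine Metric.closedBall_subset_closedBall ?_
      gcongr
      · exact one_le_two
      · omega
    rcases List.mem_append.1 hgm with hgl | hgr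
    · refine ⟨(hg g hgl).1, fun x hx => ((hg g hgl).2 x (hsub hx)).trans ?_⟩
      gcongr
      rw [hM']
      linarith [show 0 ≤ A * 2 ^ finrank ℝ V by positivity]
    · obtain ⟨b, hb, rfl⟩ := List.mem_map.1 hgr
      refine ⟨smoothConvex_ridge b, fun x hx => (abs_ridge_le b x).trans ?_⟩
      have hx' : ‖x‖ ≤ 2 ^ finrank ℝ V * R := by simpa using hsub hx
      have : ‖LinearMap.toContinuousLinearMap b‖ * ‖x‖ ≤ A * (2 ^ finrank ℝ V * R) :=
        mul_le_mul (hA0 b hb) hx' (norm_nonneg _) hA1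
      rw [hM']
      nlinarith [mul_nonneg hM hR0.le]
  have hlen : (l ++ a.map ridge).length = p + a.length := by simp [hl]
  have h1 := hcln (l ++ a.map ridge) r R (M' * R) hlen h hR0 (by positivity) hall
  have sl : ∀ g ∈ l, ContDiff ℝ ∞ g := fun g hgl => (hg g hgl).1.1
  have sall : ∀ g ∈ l ++ a.map ridge, ContDiff ℝ ∞ g := fun g hgl => (hall g hgl).1.1
  have nonneg1 : ∀ x, 0 ≤ density l ((a.map elemForm).prod * kahlerForm V ^ r) x :=
    density_nonneg (fun g hgl => (hg g hgl).1)
      (mul_mem_stronglyPositive rfl (list_elemForm_mem a) (kahlerForm_pow_mem r)) (by omega)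
  have nonneg2 : ∀ x, 0 ≤ density (l ++ a.map ridge) (kahlerForm V ^ r) x :=
    density_nonneg (fun g hgl => (hall g hgl).1) (kahlerForm_pow_mem r) (by omega)
  have eq : ∀ x, density (l ++ a.map ridge) (kahlerForm V ^ r) x =
      (a.map fun b => (√(1 + b x ^ 2) ^ 3)⁻¹).prod *
        density l ((a.map elemForm).prod * kahlerForm V ^ r) x := by
    intro x
    simp only [density, listDD_append, listDD_ridge, mul_smul_comm, smul_mul_assoc, map_smul,
      smul_eq_mul, mul_assoc]
  have prod_ge : ∀ (a : List (Dual ℝ V)) (x : V), (∀ b ∈ a, |b x| ≤ B) →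
      κ⁻¹ ^ a.length ≤ (a.map fun b => (√(1 + b x ^ 2) ^ 3)⁻¹).prod := by
    intro a x hx
    induction a with
    | nil => simp
    | cons b a ih =>
      rw [List.length_cons, pow_succ', List.map_cons, List.prod_cons]
      refine mul_le_mul ?_ (ih fun c hc => hx c (List.mem_cons_of_mem _ hc)) (by positivity)
        (by positivity)
      have : b x ^ 2 ≤ B ^ 2 := sq_le_sq' (abs_le.1 (hx b List.mem_cons_self)).1
        (abs_le.1 (hx b List.mem_cons_self)).2
      rw [hκ]
      gcongr
  have cont1 := (contDiff_density sl ((a.map elemForm).prod * kahlerForm V ^ r)).continuous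
  have cont2 := (contDiff_density sall (kahlerForm V ^ r)).continuous
  have hcyl := isCompact_cylinder a B R
  calc ∫ x in cylinder a B R, density l ((a.map elemForm).prod * kahlerForm V ^ r) x
      ≤ ∫ x in cylinder a B R,
          κ ^ a.length * density (l ++ a.map ridge) (kahlerForm V ^ r) x := by
        refine setIntegral_mono_on (cont1.continuousOn.integrableOn_compact hcyl)
          ((continuous_const.mul cont2).continuousOn.integrableOn_compact hcyl)
          hcyl.measurableSet fun x hx => ?_
        rw [eq, ← mul_assoc]
        refine le_mul_of_one_le_left (nonneg1 x) ?_
        have := mul_le_mul_of_nonneg_left (prod_ge a x hx.2) (pow_nonneg hκ0.le a.length)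
        rwa [← mul_pow, mul_inv_cancel₀ hκ0.ne', one_pow] at this
    _ = κ ^ a.length * ∫ x in cylinder a B R,
          density (l ++ a.map ridge) (kahlerForm V ^ r) x := integral_const_mul _ _
    _ ≤ κ ^ a.length * ∫ x in Metric.closedBall 0 R,
          density (l ++ a.map ridge) (kahlerForm V ^ r) x := by
        refine mul_le_mul_of_nonneg_left ?_ (by positivity)
        exact setIntegral_mono_set (cont2.continuousOn.integrableOn_compact
          (isCompact_closedBall _ _)) (Eventually.of_forall nonneg2)
          (show cylinder a B R ≤ Metric.closedBall 0 R from inter_subset_left).eventuallyLE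
    _ ≤ κ ^ a.length * (C * (M' * R / R ^ 2) ^ (p + a.length) * R ^ finrank ℝ V) :=
        mul_le_mul_of_nonneg_left h1 (by positivity)
    _ = κ ^ a.length * (C * M' ^ (p + a.length)) * R ^ r := by
        have : M' * R / R ^ 2 = M' * R⁻¹ := by field_simp
        rw [this, mul_pow, ← h, pow_add R (p + a.length) r, inv_pow]
        field_simp

end Cylinder

/-! ### Regularization by convolution -/

section Mollify

variable {V : Type*} [NormedAddCommGroup V] [InnerProductSpace ℝ V] [FiniteDimensional ℝ V]
  [MeasurableSpace V] [BorelSpace V]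

variable (V) in
/-- A bump function supported in the ball of radius `1 / (j + 1)`. -/
noncomputable def smallBump (j : ℕ) : ContDiffBump (0 : V) where
  rIn := 1 / (2 * (j + 1))
  rOut := 1 / (j + 1)
  rIn_pos := by positivity
  rIn_lt_rOut := by
    apply one_div_lt_one_div_of_lt <;> linarith [(Nat.cast_nonneg j : (0 : ℝ) ≤ j)]

/-- The mollification of `f` at scale `1 / (j + 1)`. -/
noncomputable def mollify (f : V → ℝ) (j : ℕ) : V → ℝ :=
  convolution ((smallBump V j).normed volume) f (ContinuousLinearMap.lsmul ℝ ℝ) volume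

theorem contDiff_mollify {f : V → ℝ} (hf : Continuous f) (j : ℕ) : ContDiff ℝ ∞ (mollify f j) :=
  (smallBump V j).hasCompactSupport_normed.contDiff_convolution_left _
    (smallBump V j).contDiff_normed hf.locallyIntegrable

theorem abs_mollify_sub_le {f : V → ℝ} (hf : Continuous f) {j : ℕ} {x : V} {ε : ℝ}
    (h : ∀ y, dist y x < 1 / (j + 1) → |f y - f x| ≤ ε) : |mollify f j x - f x| ≤ ε :=
  (smallBump V j).dist_normed_convolution_le hf.aestronglyMeasurable fun y hy => h y hy

theorem tendstoUniformlyOn_mollify {f : V → ℝ} (hf : Continuous f) {K : Set V}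
    (hK : IsCompact K) : TendstoUniformlyOn (mollify f) f atTop K := by
  rw [Metric.tendstoUniformlyOn_iff]
  intro ε hε
  have h := hK.uniformContinuousAt_of_continuousAt f (fun x _ => hf.continuousAt)
    (Metric.dist_mem_uniformity (half_pos hε))
  obtain ⟨δ, hδ, h⟩ := Metric.mem_uniformity_dist.1 h
  obtain ⟨N, hN⟩ := exists_nat_one_div_lt hδ
  filter_upwards [eventually_ge_atTop N] with j hj x hx
  have : |mollify f j x - f x| ≤ ε / 2 := by
    refine abs_mollify_sub_le hf fun y hy => ?_
    have hy' : dist x y < δ := by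
      rw [dist_comm]
      refine (hy.trans_le ?_).trans hN
      exact Nat.one_div_le_one_div hj
    have := (show dist (f x) (f y) < ε / 2 from h hy' hx).le
    rwa [dist_comm] at this
  rw [dist_comm, Real.dist_eq]
  linarith

theorem convexOn_mollify {f : V → ℝ} (hf : Continuous f) (hc : ConvexOn ℝ univ f) (j : ℕ) :
    ConvexOn ℝ univ (mollify f j) := by
  set b := (smallBump V j).normed volume with hb
  have hbc : Continuous b := (smallBump V j).continuous_normed
  have int : ∀ x, Integrable fun t => b t * f (x - t) := fun x =>
    (hbc.mul (hf.comp (continuous_const.sub continuous_id))).integrable_of_hasCompactSupport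
      (smallBump V j).hasCompactSupport_normed.mul_right
  refine ⟨convex_univ, fun x _ y _ s t hs ht hst => ?_⟩
  change ∫ u, b u * f (s • x + t • y - u) ≤
    s * (∫ u, b u * f (x - u)) + t * (∫ u, b u * f (y - u))
  rw [← integral_const_mul, ← integral_const_mul,
    ← integral_add ((int x).const_mul s) ((int y).const_mul t)]
  refine integral_mono (int _) (((int x).const_mul s).add ((int y).const_mul t)) fun u => ?_
  have h1 : s • x + t • y - u = s • (x - u) + t • (y - u) := by
    have : u = s • u + t • u := by rw [← add_smul, hst, one_smul]
    rw [smul_sub, smul_sub]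
    nth_rewrite 1 [this]
    abel
  have h2 := hc.2 (mem_univ (x - u)) (mem_univ (y - u)) hs ht hst
  simp only [smul_eq_mul] at h2
  have h3 := mul_le_mul_of_nonneg_left h2 ((smallBump V j).nonneg_normed (μ := volume) u)
  simp only [h1]
  calc _ ≤ _ := h3
    _ = _ := by simp only [hb]; ring

theorem isSmoothConvexApprox_mollify {f : V → ℝ} (hc : ConvexOn ℝ univ f) :
    IsSmoothConvexApprox f (mollify f) := by
  have hf : Continuous f := continuousOn_univ.1 (hc.continuousOn isOpen_univ)
  exact ⟨fun j => ⟨convexOn_mollify hf hc j, contDiff_mollify hf j⟩,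
    fun K hK => tendstoUniformlyOn_mollify hf hK⟩

theorem exists_smooth_approx {φ : V → ℝ} (hφ : Continuous φ) {R : ℝ}
    (hs : tsupport φ ⊆ Metric.closedBall 0 R) {ε : ℝ} (hε : 0 < ε) :
    ∃ ψ : V → ℝ, ContDiff ℝ ∞ ψ ∧ tsupport ψ ⊆ Metric.closedBall 0 (R + 1) ∧
      ∀ x, |φ x - ψ x| ≤ ε := by
  have h := tendstoUniformlyOn_mollify hφ (isCompact_closedBall (0 : V) (R + 1))
  obtain ⟨j, hj⟩ := ((Metric.tendstoUniformlyOn_iff.1 h) ε hε).exists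
  have zero : ∀ x ∉ Metric.closedBall (0 : V) R, φ x = 0 := fun x hx =>
    image_eq_zero_of_notMem_tsupport fun h => hx (hs h)
  have far : ∀ x ∉ Metric.closedBall (0 : V) (R + 1), φ x = 0 ∧ mollify φ j x = 0 := by
    intro x hx
    rw [mem_closedBall_zero_iff, not_le] at hx
    have h0 : φ x = 0 := zero x (by rw [mem_closedBall_zero_iff]; linarith)
    refine ⟨h0, ?_⟩
    have := abs_mollify_sub_le hφ (j := j) (x := x) (ε := 0) fun y hy => by
      have h1 : (1 : ℝ) / (j + 1) ≤ 1 := by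
        rw [div_le_one (by positivity)]
        linarith [(Nat.cast_nonneg j : (0 : ℝ) ≤ j)]
      have h2 : ‖x‖ ≤ ‖y‖ + dist y x := by
        rw [dist_comm, dist_eq_norm]
        linarith [norm_sub_norm_le x y]
      rw [zero y (by rw [mem_closedBall_zero_iff]; linarith), h0]
      simp
    rw [h0, sub_zero] at this
    exact abs_eq_zero.1 (le_antisymm this (abs_nonneg _))
  refine ⟨mollify φ j, contDiff_mollify hφ j, ?_, fun x => ?_⟩
  · refine closure_minimal (fun x hx => ?_) Metric.isClosed_closedBall
    by_contra hx'
    exact hx (far x hx').2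
  · by_cases hx : x ∈ Metric.closedBall (0 : V) (R + 1)
    · exact (hj x hx).le
    · rw [(far x hx).1, (far x hx).2]
      simpa using hε.le

end Mollify

/-! ### Continuity of the intersection product under uniform convergence -/

section Continuity

variable {V : Type*} [NormedAddCommGroup V] [InnerProductSpace ℝ V] [FiniteDimensional ℝ V]
  [MeasurableSpace V] [BorelSpace V]

/-- The smooth convex functions bounded by `M` on the ball of radius `ρ`. -/
def BoundedConvex (ρ M : ℝ) (g : V → ℝ) : Prop :=
  SmoothConvex g ∧ ∀ x ∈ Metric.closedBall (0 : V) ρ, |g x| ≤ M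

theorem exists_local_mass_bound {p m : ℕ} (h : p + m = finrank ℝ V) {c : Covector V}
    (hc : c ∈ bidegree V m m) {R ρ M : ℝ} (hR : 0 < R) (hρ : 2 ^ finrank ℝ V * R ≤ ρ)
    (hM : 0 ≤ M) :
    ∃ C : ℝ, 0 ≤ C ∧ ∀ l : List (V → ℝ), l.length = p → (∀ g ∈ l, BoundedConvex ρ M g) →
      ∫ x in Metric.closedBall (0 : V) R, |density l c x| ≤ C := by
  obtain ⟨C, hC, hcln⟩ := exists_chern_levine_nirenberg (V := V) p
  obtain ⟨K, hK, hdom⟩ := exists_abs_topCoeff_le h hc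
  refine ⟨K * (C * (M / R ^ 2) ^ p * R ^ finrank ℝ V), by positivity, fun l hl hg => ?_⟩
  have sl : ∀ g ∈ l, ContDiff ℝ ∞ g := fun g hgl => (hg g hgl).1.1
  have h1 := hcln l m R M hl h hR hM fun g hgl => ⟨(hg g hgl).1, fun x hx =>
    (hg g hgl).2 x (Metric.closedBall_subset_closedBall (le_trans (by
      gcongr
      · exact one_le_two
      · omega) hρ) hx)⟩
  refine le_trans ?_ (mul_le_mul_of_nonneg_left h1 hK)
  rw [← integral_const_mul]
  refine setIntegral_mono_on
    ((contDiff_density sl c).continuous.abs.continuousOn.integrableOn_compact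
      (isCompact_closedBall _ _))
    ((continuous_const.mul (contDiff_density sl _).continuous).continuousOn.integrableOn_compact
      (isCompact_closedBall _ _)) Metric.isClosed_closedBall.measurableSet fun x _ => ?_
  exact hdom _ (by have := listDD_mem (fun g hgl => (hg g hgl).1) x; rwa [hl] at this)

/-- The pairing `∫ φ d d^# g₁ ∧ … ∧ d d^# gₚ ∧ c`. -/
noncomputable def pairing (l : List (V → ℝ)) (φ : V → ℝ) (c : Covector V) : ℝ :=
  ∫ x, φ x * density l c x

omit [MeasurableSpace V] [BorelSpace V] in
theorem hasCompactSupport_of_tsupport {F : Type*} [Zero F] {φ : V → F} {R : ℝ}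
    (hs : tsupport φ ⊆ Metric.closedBall 0 R) : HasCompactSupport φ :=
  (isCompact_closedBall (0 : V) R).of_isClosed_subset (isClosed_tsupport _) hs

omit [InnerProductSpace ℝ V] [FiniteDimensional ℝ V] [MeasurableSpace V] [BorelSpace V] in
theorem eq_zero_of_tsupport {F : Type*} [Zero F] {φ : V → F} {R : ℝ}
    (hs : tsupport φ ⊆ Metric.closedBall 0 R) {x : V} (hx : x ∉ Metric.closedBall (0 : V) R) :
    φ x = 0 :=
  image_eq_zero_of_notMem_tsupport fun h => hx (hs h)

theorem integrable_mul_density {l : List (V → ℝ)} (hl : ∀ g ∈ l, ContDiff ℝ ∞ g) {φ : V → ℝ}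
    (hφ : Continuous φ) (hs : HasCompactSupport φ) (c : Covector V) :
    Integrable fun x => φ x * density l c x :=
  (hφ.mul (contDiff_density hl c).continuous).integrable_of_hasCompactSupport hs.mul_right

theorem abs_pairing_le {l : List (V → ℝ)} (hl : ∀ g ∈ l, ContDiff ℝ ∞ g) {φ : V → ℝ}
    (hφ : Continuous φ) {R : ℝ} (hs : tsupport φ ⊆ Metric.closedBall 0 R) {ε : ℝ}
    (hε : ∀ x, |φ x| ≤ ε) (c : Covector V) :
    |pairing l φ c| ≤ ε * ∫ x in Metric.closedBall (0 : V) R, |density l c x| := by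
  rw [pairing, ← setIntegral_eq_integral_of_forall_compl_eq_zero
    (s := Metric.closedBall (0 : V) R) fun x hx => by rw [eq_zero_of_tsupport hs hx, zero_mul]]
  refine (abs_integral_le_integral_abs).trans ?_
  rw [← integral_const_mul]
  have cd := (contDiff_density hl c).continuous
  refine setIntegral_mono_on ((hφ.mul cd).abs.continuousOn.integrableOn_compact
    (isCompact_closedBall _ _)) ((continuous_const.mul cd.abs).continuousOn.integrableOn_compact
    (isCompact_closedBall _ _)) Metric.isClosed_closedBall.measurableSet fun x _ => ?_
  rw [abs_mul]
  exact mul_le_mul_of_nonneg_right (hε x) (abs_nonneg _)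

omit [MeasurableSpace V] [BorelSpace V] in
theorem density_middle {l t : List (V → ℝ)} (hl : ∀ g ∈ l, ContDiff ℝ ∞ g) (g : V → ℝ)
    (c : Covector V) (x : V) :
    density (l ++ g :: t) c x = topCoeff V (ddSharp g x * (listDD (l ++ t) x * c)) := by
  rw [density, listDD_append, listDD_cons, ← mul_assoc, (commute_listDD hl x _).eq, listDD_append,
    mul_assoc, mul_assoc, mul_assoc]

omit [FiniteDimensional ℝ V] [MeasurableSpace V] [BorelSpace V] in
theorem dx_mul_dxi_mul_mem {m : ℕ} {c : Covector V} (hc : c ∈ bidegree V m m) (a b : Dual ℝ V) :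
    dx V a * dxi V b * c ∈ bidegree V (m + 1) (m + 1) := by
  have h1 : dxi V b ∈ bidegree V 0 1 := by simp [bidegree]
  have := mul_mem_bidegree (mul_mem_bidegree (dx_mem_bidegree a) h1) hc
  simpa [add_comm] using this

/-- Replacing one of the functions changes the pairing with a smooth function by at most a multiple
of the uniform distance. -/
theorem exists_replace_bound {p m : ℕ} (h : p + 1 + m = finrank ℝ V) {c : Covector V}
    (hc : c ∈ bidegree V m m) {φ : V → ℝ} (hφ : ContDiff ℝ ∞ φ) {R ρ M : ℝ} (hR : 0 < R)
    (hs : tsupport φ ⊆ Metric.closedBall 0 R) (hρ : 2 ^ finrank ℝ V * R ≤ ρ) (hM : 0 ≤ M) :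
    ∃ C : ℝ, 0 ≤ C ∧ ∀ (l t : List (V → ℝ)) (g g' : V → ℝ) (δ : ℝ), l.length + t.length = p →
      (∀ f ∈ l ++ t, BoundedConvex ρ M f) → ContDiff ℝ ∞ g → ContDiff ℝ ∞ g' → 0 ≤ δ →
      (∀ x ∈ Metric.closedBall (0 : V) ρ, |g x - g' x| ≤ δ) →
      |pairing (l ++ g :: t) φ c - pairing (l ++ g' :: t) φ c| ≤ C * δ := by
  have cφ := hasCompactSupport_of_tsupport hs
  have hbound : ∀ i j, ∃ K, ∀ x, |hessian φ x i j| ≤ K := fun i j =>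
    ((cφ.fderiv_apply (𝕜 := ℝ) (stdOrthonormalBasis ℝ V j)).fderiv_apply (𝕜 := ℝ)
      (stdOrthonormalBasis ℝ V i)).exists_bound_of_continuous (contDiff_hessian hφ i j).continuous
  choose K hK using hbound
  have hK0 : ∀ i j, 0 ≤ K i j := fun i j => (abs_nonneg _).trans (hK i j 0)
  choose C hC hmass using fun i j => exists_local_mass_bound (p := p) (by omega)
    (dx_mul_dxi_mul_mem hc (coordFn V i) (coordFn V j)) hR hρ hM
  refine ⟨∑ i, ∑ j, K i j * C i j, Finset.sum_nonneg fun i _ => Finset.sum_nonneg fun j _ =>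
    mul_nonneg (hK0 i j) (hC i j), ?_⟩
  intro l t g g' δ hlen hlt hg hg' hδ hdist
  have sl : ∀ f ∈ l, ContDiff ℝ ∞ f := fun f hf => (hlt f (List.mem_append_left _ hf)).1.1
  have slt : ∀ f ∈ l ++ t, ContDiff ℝ ∞ f := fun f hf => (hlt f hf).1.1
  have sall : ∀ f : V → ℝ, ContDiff ℝ ∞ f → ∀ u ∈ l ++ f :: t, ContDiff ℝ ∞ u := by
    intro f hf u hu
    rcases List.mem_append.1 hu with h1 | h1
    · exact sl u h1
    · rcases List.mem_cons.1 h1 with rfl | h2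
      · exact hf
      · exact slt u (List.mem_append_right _ h2)
  have e1 : pairing (l ++ g :: t) φ c - pairing (l ++ g' :: t) φ c =
      ∫ x, (g x - g' x) * topCoeff V (ddSharp φ x * (listDD (l ++ t) x * c)) := by
    rw [pairing, pairing, ← integral_sub
      (integrable_mul_density (sall g hg) hφ.continuous cφ c)
      (integrable_mul_density (sall g' hg') hφ.continuous cφ c),
      ← (isSmoothClosed_listDD_mul slt c).integral_mul_ddSharp hφ cφ (hg.sub hg')]
    congr 1
    funext x
    rw [density_middle sl, density_middle sl, ddSharp_sub hg hg', sub_mul, map_sub, mul_sub]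
  have e2 : ∀ x, topCoeff V (ddSharp φ x * (listDD (l ++ t) x * c)) = ∑ i, ∑ j,
      hessian φ x i j * density (l ++ t) (dx V (coordFn V i) * dxi V (coordFn V j) * c) x := by
    intro x
    rw [ddSharp_eq hφ, matrixForm, Finset.sum_mul, map_sum]
    refine Finset.sum_congr rfl fun i _ => ?_
    rw [Finset.sum_mul, map_sum]
    refine Finset.sum_congr rfl fun j _ => ?_
    rw [smul_mul_assoc, map_smul, smul_eq_mul, density, ← mul_assoc (listDD _ x),
      ← (commute_dx_mul_dxi _ _ (listDD (l ++ t) x)).eq,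
      mul_assoc (dx V (coordFn V i) * dxi V (coordFn V j)) (listDD _ x)]
  have cdens : ∀ i j, Continuous
      (density (l ++ t) (dx V (coordFn V i) * dxi V (coordFn V j) * c)) := fun i j =>
    (contDiff_density slt _).continuous
  have cont : Continuous fun x =>
      (g x - g' x) * topCoeff V (ddSharp φ x * (listDD (l ++ t) x * c)) :=
    (hg.continuous.sub hg'.continuous).mul (contDiff_linear (topCoeff V)
      (contDiff_mul (contDiff_ddSharp hφ) (isSmoothClosed_listDD_mul slt c).contDiff)).continuous
  have hsub : Metric.closedBall (0 : V) R ⊆ Metric.closedBall 0 ρ := by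
    refine Metric.closedBall_subset_closedBall (le_trans ?_ hρ)
    nlinarith [one_le_pow₀ (M₀ := ℝ) (n := finrank ℝ V) one_le_two]
  have iabs : ∀ i j, IntegrableOn (fun x => K i j *
      |density (l ++ t) (dx V (coordFn V i) * dxi V (coordFn V j) * c) x|)
      (Metric.closedBall (0 : V) R) := fun i j =>
    (continuous_const.mul (cdens i j).abs).continuousOn.integrableOn_compact
      (isCompact_closedBall _ _)
  rw [e1, ← setIntegral_eq_integral_of_forall_compl_eq_zero
    (s := Metric.closedBall (0 : V) R) fun x hx => by
      have : x ∉ tsupport φ := fun h => hx (hs h)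
      simp only [e2, hessian_eq_zero this]
      simp]
  calc _ ≤ ∫ x in Metric.closedBall (0 : V) R,
        |(g x - g' x) * topCoeff V (ddSharp φ x * (listDD (l ++ t) x * c))| :=
        abs_integral_le_integral_abs
    _ ≤ ∫ x in Metric.closedBall (0 : V) R, δ * ∑ i, ∑ j, K i j *
        |density (l ++ t) (dx V (coordFn V i) * dxi V (coordFn V j) * c) x| := by
        refine setIntegral_mono_on (cont.abs.continuousOn.integrableOn_compact
          (isCompact_closedBall _ _)) ?_ Metric.isClosed_closedBall.measurableSet fun x hx => ?_
        · exact (integrable_finsetSum _ fun i _ => integrable_finsetSum _ fun j _ =>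
            iabs i j).const_mul δ
        · rw [abs_mul, e2]
          refine mul_le_mul (hdist x (hsub hx)) ?_ (abs_nonneg _) hδ
          refine (Finset.abs_sum_le_sum_abs _ _).trans (Finset.sum_le_sum fun i _ =>
            (Finset.abs_sum_le_sum_abs _ _).trans (Finset.sum_le_sum fun j _ => ?_))
          rw [abs_mul]
          exact mul_le_mul_of_nonneg_right (hK i j x) (abs_nonneg _)
    _ = δ * ∑ i, ∑ j, K i j * ∫ x in Metric.closedBall (0 : V) R,
        |density (l ++ t) (dx V (coordFn V i) * dxi V (coordFn V j) * c) x| := by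
        rw [integral_const_mul, integral_finsetSum _ fun i _ =>
          integrable_finsetSum _ fun j _ => iabs i j]
        congr 1
        refine Finset.sum_congr rfl fun i _ => ?_
        rw [integral_finsetSum _ fun j _ => iabs i j]
        exact Finset.sum_congr rfl fun j _ => integral_const_mul _ _
    _ ≤ δ * ∑ i, ∑ j, K i j * C i j := by
        refine mul_le_mul_of_nonneg_left (Finset.sum_le_sum fun i _ => Finset.sum_le_sum fun j _ =>
          mul_le_mul_of_nonneg_left (hmass i j _ (by simpa using hlen) hlt) (hK0 i j)) hδ
    _ = _ := mul_comm _ _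

/-- The pairing with a smooth function is Lipschitz in the functions, for the uniform norm. -/
theorem exists_lipschitz_bound {p m : ℕ} (h : p + m = finrank ℝ V) {c : Covector V}
    (hc : c ∈ bidegree V m m) {φ : V → ℝ} (hφ : ContDiff ℝ ∞ φ) {R ρ M : ℝ} (hR : 0 < R)
    (hs : tsupport φ ⊆ Metric.closedBall 0 R) (hρ : 2 ^ finrank ℝ V * R ≤ ρ) (hM : 0 ≤ M) :
    ∃ C : ℝ, 0 ≤ C ∧ ∀ (l l' : List (V → ℝ)) (δ : ℝ), l.length = p → 0 ≤ δ →
      (∀ f ∈ l, BoundedConvex ρ M f) → (∀ f ∈ l', BoundedConvex ρ M f) →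
      List.Forall₂ (fun g g' => ∀ x ∈ Metric.closedBall (0 : V) ρ, |g x - g' x| ≤ δ) l l' →
      |pairing l φ c - pairing l' φ c| ≤ C * δ := by
  rcases p with _ | p
  · refine ⟨0, le_rfl, fun l l' δ hl _ _ _ hll => ?_⟩
    obtain rfl := List.length_eq_zero_iff.1 hl
    obtain rfl := List.forall₂_nil_left_iff.1 hll
    simp
  · obtain ⟨C, hC, hrep⟩ := exists_replace_bound h hc hφ hR hs hρ hM
    -- the functions are replaced one at a time
    have key : ∀ (l l' : List (V → ℝ)) (δ : ℝ), 0 ≤ δ → (∀ f ∈ l, BoundedConvex ρ M f) →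
        (∀ f ∈ l', BoundedConvex ρ M f) →
        List.Forall₂ (fun g g' => ∀ x ∈ Metric.closedBall (0 : V) ρ, |g x - g' x| ≤ δ) l l' →
        ∀ pre : List (V → ℝ), (∀ f ∈ pre, BoundedConvex ρ M f) → pre.length + l.length = p + 1 →
        |pairing (pre ++ l) φ c - pairing (pre ++ l') φ c| ≤ l.length * (C * δ) := by
      intro l l' δ hδ hl hl' hll
      induction hll with
      | nil => intro pre _ _; simp
      | @cons g g' t t' hgg htt ih =>
        intro pre hpre hlen
        have hg := hl g List.mem_cons_self
        have hg' := hl' g' List.mem_cons_self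
        have ht : ∀ f ∈ t, BoundedConvex ρ M f := fun f hf => hl f (List.mem_cons_of_mem _ hf)
        have h1 := hrep pre t g g' δ (by simp at hlen; omega) (fun f hf =>
          (List.mem_append.1 hf).elim (hpre f) (ht f)) hg.1.1 hg'.1.1 hδ hgg
        have h2 := ih ht (fun f hf => hl' f (List.mem_cons_of_mem _ hf)) (pre ++ [g'])
          (fun f hf => (List.mem_append.1 hf).elim (hpre f) fun h3 => by
            rw [List.mem_singleton.1 h3]; exact hg') (by simp at hlen ⊢; omega)
        rw [List.append_assoc, List.append_assoc, List.singleton_append,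
          List.singleton_append] at h2
        refine (abs_sub_le _ (pairing (pre ++ g' :: t) φ c) _).trans ?_
        rw [List.length_cons]
        push_cast
        linarith
    refine ⟨(p + 1 : ℕ) * C, by positivity, fun l l' δ hl hδ hb hb' hll => ?_⟩
    have := key l l' δ hδ hb hb' hll [] (by simp) (by simpa using hl)
    rw [hl, ← mul_assoc] at this
    simpa using this

/-- The pairing with a continuous function is uniformly continuous in the functions. -/
theorem exists_uniform_continuity {p m : ℕ} (h : p + m = finrank ℝ V) {c : Covector V}
    (hc : c ∈ bidegree V m m) {φ : V → ℝ} (hφ : Continuous φ) {R ρ M : ℝ} (hR : 0 < R)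
    (hs : tsupport φ ⊆ Metric.closedBall 0 R) (hρ : 2 ^ finrank ℝ V * (R + 1) ≤ ρ) (hM : 0 ≤ M)
    {ε : ℝ} (hε : 0 < ε) :
    ∃ δ : ℝ, 0 < δ ∧ ∀ l l' : List (V → ℝ), l.length = p →
      (∀ f ∈ l, BoundedConvex ρ M f) → (∀ f ∈ l', BoundedConvex ρ M f) →
      List.Forall₂ (fun g g' => ∀ x ∈ Metric.closedBall (0 : V) ρ, |g x - g' x| ≤ δ) l l' →
      |pairing l φ c - pairing l' φ c| ≤ ε := by
  have hR1 : 0 < R + 1 := by linarith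
  obtain ⟨C, hC, hmass⟩ := exists_local_mass_bound (p := p) h hc hR1 hρ hM
  set η := ε / (4 * (C + 1)) with hη
  have hη0 : 0 < η := by positivity
  obtain ⟨ψ, sψ, suppψ, hψ⟩ := exists_smooth_approx hφ hs hη0
  obtain ⟨C', hC', hlip⟩ := exists_lipschitz_bound h hc sψ hR1 suppψ hρ hM
  refine ⟨ε / (2 * (C' + 1)), by positivity, fun l l' hl hb hb' hll => ?_⟩
  have cφ := hasCompactSupport_of_tsupport hs
  have cψ := hasCompactSupport_of_tsupport suppψ
  have hdiff : tsupport (fun x => φ x - ψ x) ⊆ Metric.closedBall 0 (R + 1) := by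
    refine closure_minimal (fun x hx => ?_) Metric.isClosed_closedBall
    by_contra hx'
    refine hx ?_
    change φ x - ψ x = 0
    rw [eq_zero_of_tsupport suppψ hx', eq_zero_of_tsupport hs fun h' => hx'
      (Metric.closedBall_subset_closedBall (by linarith) h'), sub_zero]
  have key : ∀ l : List (V → ℝ), l.length = p → (∀ f ∈ l, BoundedConvex ρ M f) →
      |pairing l φ c - pairing l ψ c| ≤ ε / 4 := by
    intro l hl hb
    have sl : ∀ f ∈ l, ContDiff ℝ ∞ f := fun f hf => (hb f hf).1.1
    have e : pairing l φ c - pairing l ψ c = pairing l (fun x => φ x - ψ x) c := by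
      rw [pairing, pairing, pairing, ← integral_sub (integrable_mul_density sl hφ cφ c)
        (integrable_mul_density sl sψ.continuous cψ c)]
      simp only [sub_mul]
    rw [e]
    refine (abs_pairing_le sl (hφ.sub sψ.continuous) hdiff hψ c).trans ?_
    refine (mul_le_mul_of_nonneg_left (hmass l hl hb) hη0.le).trans ?_
    have : η * (C + 1) = ε / 4 := by rw [hη]; field_simp
    nlinarith
  have h1 := key l hl hb
  have h2 := key l' (hll.length_eq ▸ hl) hb'
  have h3 := hlip l l' _ hl (by positivity) hb hb' hll
  have h4 : C' * (ε / (2 * (C' + 1))) ≤ ε / 2 := by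
    rw [mul_div_assoc', div_le_div_iff₀ (by positivity) two_pos]
    nlinarith
  have h5 := abs_le.1 h1
  have h6 := abs_le.1 h2
  have h7 := abs_le.1 (h3.trans h4)
  rw [abs_le]
  constructor <;> linarith [h5.1, h5.2, h6.1, h6.2, h7.1, h7.2]

end Continuity

/-! ### Existence and uniqueness of the intersection product -/

section Existence

variable {V : Type*} [NormedAddCommGroup V] [InnerProductSpace ℝ V] [FiniteDimensional ℝ V]

theorem IsSmoothConvexApprox.eventually_close {f : V → ℝ} {g : ℕ → V → ℝ}
    (h : IsSmoothConvexApprox f g) (ρ : ℝ) {δ : ℝ} (hδ : 0 < δ) :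
    ∀ᶠ j in atTop, ∀ x ∈ Metric.closedBall (0 : V) ρ, |g j x - f x| ≤ δ := by
  filter_upwards [Metric.tendstoUniformlyOn_iff.1 (h.2 _ (isCompact_closedBall (0 : V) ρ)) δ hδ]
    with j hj x hx
  rw [← Real.dist_eq, dist_comm]
  exact (hj x hx).le

theorem IsSmoothConvexApprox.eventually_bounded {f : V → ℝ} {g : ℕ → V → ℝ}
    (h : IsSmoothConvexApprox f g) {ρ M : ℝ} (hM : ∀ x ∈ Metric.closedBall (0 : V) ρ, |f x| ≤ M) :
    ∀ᶠ j in atTop, BoundedConvex ρ (M + 1) (g j) := by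
  filter_upwards [h.eventually_close ρ one_pos] with j hj
  refine ⟨⟨(h.1 j).2, (h.1 j).1⟩, fun x hx => ?_⟩
  have h1 := abs_le.1 (hj x hx)
  have h2 := abs_le.1 (hM x hx)
  rw [abs_le]
  constructor <;> linarith [h1.1, h1.2, h2.1, h2.2]

theorem exists_bound_on_ball {p : ℕ} {f : Fin p → V → ℝ} (hf : ∀ i, ConvexOn ℝ univ (f i))
    (ρ : ℝ) : ∃ M : ℝ, 0 ≤ M ∧ ∀ i, ∀ x ∈ Metric.closedBall (0 : V) ρ, |f i x| ≤ M := by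
  have h : ∀ i, ∃ M, ∀ x ∈ Metric.closedBall (0 : V) ρ, |f i x| ≤ M := fun i =>
    (isCompact_closedBall (0 : V) ρ).exists_bound_of_continuousOn
      (((hf i).continuousOn isOpen_univ).mono (subset_univ _))
  choose M hM using h
  refine ⟨∑ i, |M i|, Finset.sum_nonneg fun i _ => abs_nonneg _, fun i x hx => ?_⟩
  exact ((hM i x hx).trans (le_abs_self _)).trans
    (Finset.single_le_sum (f := fun i => |M i|) (fun i _ => abs_nonneg _) (Finset.mem_univ i))

theorem eventually_bounded_ofFn {p : ℕ} {f : Fin p → V → ℝ} {g : Fin p → ℕ → V → ℝ}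
    (hg : ∀ i, IsSmoothConvexApprox (f i) (g i)) {ρ M : ℝ}
    (hM : ∀ i, ∀ x ∈ Metric.closedBall (0 : V) ρ, |f i x| ≤ M) :
    ∀ᶠ j in atTop, ∀ u ∈ List.ofFn fun i => g i j, BoundedConvex ρ (M + 1) u := by
  filter_upwards [eventually_all.2 fun i => (hg i).eventually_bounded (hM i)] with j hj u hu
  obtain ⟨i, rfl⟩ := List.mem_ofFn.1 hu
  exact hj i

omit [FiniteDimensional ℝ V] in
theorem smooth_ofFn {p : ℕ} {f : Fin p → V → ℝ} {g : Fin p → ℕ → V → ℝ}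
    (hg : ∀ i, IsSmoothConvexApprox (f i) (g i)) (j : ℕ) :
    ∀ u ∈ List.ofFn fun i => g i j, SmoothConvex u := by
  intro u hu
  obtain ⟨i, rfl⟩ := List.mem_ofFn.1 hu
  exact ⟨((hg i).1 j).2, ((hg i).1 j).1⟩

variable [MeasurableSpace V] [BorelSpace V]

omit [InnerProductSpace ℝ V] [FiniteDimensional ℝ V] [MeasurableSpace V] [BorelSpace V] in
theorem exists_pos_radius {F : Type*} [Zero F] [TopologicalSpace F] {φ : V → F}
    (hs : HasCompactSupport φ) :
    ∃ R : ℝ, 0 < R ∧ tsupport φ ⊆ Metric.closedBall 0 R := by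
  obtain ⟨R, hR⟩ := IsCompact.isBounded hs |>.subset_closedBall (0 : V)
  exact ⟨max R 1, by positivity,
    hR.trans (Metric.closedBall_subset_closedBall (le_max_left _ _))⟩

/-- Two approximations of the same functions have the same limit: the pairings depend uniformly
continuously on the functions. -/
theorem eventually_pairing_close {p m : ℕ} (h : p + m = finrank ℝ V) {f : Fin p → V → ℝ}
    (hf : ∀ i, ConvexOn ℝ univ (f i)) {c : Covector V} (hc : c ∈ bidegree V m m) {φ : V → ℝ}
    (hφ : Continuous φ) (hs : HasCompactSupport φ) {g g' : Fin p → ℕ → V → ℝ}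
    (hg : ∀ i, IsSmoothConvexApprox (f i) (g i)) (hg' : ∀ i, IsSmoothConvexApprox (f i) (g' i))
    {ε : ℝ} (hε : 0 < ε) : ∃ N : ℕ, ∀ j ≥ N, ∀ k ≥ N,
      |pairing (List.ofFn fun i => g i j) φ c - pairing (List.ofFn fun i => g' i k) φ c| ≤ ε := by
  obtain ⟨R, hR, hsR⟩ := exists_pos_radius hs
  set ρ := 2 ^ finrank ℝ V * (R + 1)
  obtain ⟨M, hM, hfM⟩ := exists_bound_on_ball hf ρ
  obtain ⟨δ, hδ, huc⟩ := exists_uniform_continuity h hc hφ hR hsR (le_refl ρ)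
    (by linarith : 0 ≤ M + 1) hε
  have h1 := eventually_bounded_ofFn hg hfM
  have h2 := eventually_bounded_ofFn hg' hfM
  have h3 := eventually_all.2 fun i => (hg i).eventually_close ρ (half_pos hδ)
  have h4 := eventually_all.2 fun i => (hg' i).eventually_close ρ (half_pos hδ)
  obtain ⟨N, hN⟩ := eventually_atTop.1 (h1.and (h2.and (h3.and h4)))
  refine ⟨N, fun j hj k hk => huc _ _ (by simp) (hN j hj).1 (hN k hk).2.1 ?_⟩
  rw [List.forall₂_iff_get]
  refine ⟨by simp, fun i hi hi' x hx => ?_⟩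
  have h5 := (hN j hj).2.2.1 ⟨i, by simpa using hi⟩ x hx
  have h6 := (hN k hk).2.2.2 ⟨i, by simpa using hi⟩ x hx
  simp only [List.get_eq_getElem, List.getElem_ofFn]
  have h7 := abs_le.1 h5
  have h8 := abs_le.1 h6
  rw [abs_le]
  constructor <;> linarith [h7.1, h7.2, h8.1, h8.2]

theorem exists_pairing_limit {p m : ℕ} (h : p + m = finrank ℝ V) {f : Fin p → V → ℝ}
    (hf : ∀ i, ConvexOn ℝ univ (f i)) {c : Covector V} (hc : c ∈ bidegree V m m) {φ : V → ℝ}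
    (hφ : Continuous φ) (hs : HasCompactSupport φ) : ∃ s : ℝ, ∀ g : Fin p → ℕ → V → ℝ,
      (∀ i, IsSmoothConvexApprox (f i) (g i)) →
      Tendsto (fun j => pairing (List.ofFn fun i => g i j) φ c) atTop (𝓝 s) := by
  have h0 : ∀ i, IsSmoothConvexApprox (f i) (mollify (f i)) := fun i =>
    isSmoothConvexApprox_mollify (hf i)
  have hcau : CauchySeq fun j => pairing (List.ofFn fun i => mollify (f i) j) φ c := by
    rw [Metric.cauchySeq_iff']
    intro ε hε
    obtain ⟨N, hN⟩ := eventually_pairing_close h hf hc hφ hs h0 h0 (half_pos hε)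
    exact ⟨N, fun j hj => (hN j hj N le_rfl).trans_lt (half_lt_self hε)⟩
  obtain ⟨s, hs'⟩ := cauchySeq_tendsto_of_complete hcau
  refine ⟨s, fun g hg => ?_⟩
  refine hs'.congr_dist ?_
  rw [Metric.tendsto_atTop]
  intro ε hε
  obtain ⟨N, hN⟩ := eventually_pairing_close h hf hc hφ hs h0 hg (half_pos hε)
  refine ⟨N, fun j hj => ?_⟩
  rw [Real.dist_eq, sub_zero, Real.dist_eq, abs_abs]
  exact (hN j hj j hj).trans_lt (half_lt_self hε)

/-- The coefficients of a form in a basis of the constant forms of its bidegree. -/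
noncomputable def coefficient {a b : ℕ} (α : V → bidegree V a b)
    (k : Fin (finrank ℝ (bidegree V a b))) (x : V) : ℝ :=
  (finBasis ℝ (bidegree V a b)).coord k (α x)

omit [MeasurableSpace V] [BorelSpace V] in
theorem sum_coefficient {a b : ℕ} (α : V → bidegree V a b) (x : V) :
    (α x : Covector V) =
      ∑ k, coefficient α k x • (finBasis ℝ (bidegree V a b) k : Covector V) := by
  have h := congrArg (bidegree V a b).subtype ((finBasis ℝ (bidegree V a b)).sum_repr (α x))
  rw [map_sum] at h
  exact h.symm

omit [MeasurableSpace V] [BorelSpace V] in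
theorem continuous_coefficient {a b : ℕ} (α : ContForm V a b)
    (k : Fin (finrank ℝ (bidegree V a b))) : Continuous (coefficient α k) :=
  (LinearMap.continuous_of_finiteDimensional _).comp α.continuous

omit [MeasurableSpace V] [BorelSpace V] in
theorem hasCompactSupport_coefficient {a b : ℕ} (α : ContForm V a b)
    (k : Fin (finrank ℝ (bidegree V a b))) : HasCompactSupport (coefficient α k) :=
  α.hasCompactSupport.comp_left (map_zero _)

/-- The pairing of `d d^# g₁ ∧ … ∧ d d^# gₚ` with a form. -/
noncomputable def formPairing (l : List (V → ℝ)) (α : V → Covector V) : ℝ :=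
  ∫ x, topCoeff V (listDD l x * α x)

theorem superIntegral_wedge {p : ℕ} (g : Fin p → V → ℝ) (α : V → Covector V) :
    superIntegral (fun x => wedgeDDSharp g x * α x) = formPairing (List.ofFn g) α := by
  simp only [superIntegral, wedgeDDSharp_eq, formPairing]

theorem integrable_formPairing {l : List (V → ℝ)} (hl : ∀ g ∈ l, ContDiff ℝ ∞ g)
    {α : V → Covector V} (hα : Continuous α) (hs : HasCompactSupport α) :
    Integrable fun x => topCoeff V (listDD l x * α x) := by
  have h1 : Continuous fun x => listDD l x * α x :=
    ((mulCLM (V := V)).continuous.comp (isSmoothClosed_listDD hl).contDiff.continuous).clm_apply hα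
  refine Continuous.integrable_of_hasCompactSupport
    ((LinearMap.continuous_of_finiteDimensional (topCoeff V)).comp h1) ?_
  refine hs.mono fun x hx hx' => hx ?_
  simp [hx']

theorem formPairing_eq_sum {l : List (V → ℝ)} (hl : ∀ g ∈ l, ContDiff ℝ ∞ g) {m : ℕ}
    (α : ContForm V m m) : formPairing l (fun x => (α x : Covector V)) =
      ∑ k, pairing l (coefficient α k) (finBasis ℝ (bidegree V m m) k : Covector V) := by
  simp only [pairing]
  rw [← integral_finsetSum _ fun k _ => integrable_mul_density hl (continuous_coefficient α k)
    (hasCompactSupport_coefficient α k) _, formPairing]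
  congr 1
  funext x
  rw [sum_coefficient α x, Finset.mul_sum, map_sum]
  simp [density]

omit [MeasurableSpace V] [BorelSpace V] in
theorem continuous_coe_contForm {a b : ℕ} (α : ContForm V a b) :
    Continuous fun x => (α x : Covector V) := continuous_subtype_val.comp α.continuous

omit [MeasurableSpace V] [BorelSpace V] in
theorem hasCompactSupport_coe_contForm {a b : ℕ} (α : ContForm V a b) :
    HasCompactSupport fun x => (α x : Covector V) :=
  α.hasCompactSupport.comp_left (g := ((↑) : bidegree V a b → Covector V)) rfl

theorem exists_formPairing_limit {p m : ℕ} (h : p + m = finrank ℝ V) {f : Fin p → V → ℝ}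
    (hf : ∀ i, ConvexOn ℝ univ (f i)) (α : ContForm V m m) : ∃ s : ℝ, ∀ g : Fin p → ℕ → V → ℝ,
      (∀ i, IsSmoothConvexApprox (f i) (g i)) →
      Tendsto (fun j => formPairing (List.ofFn fun i => g i j) fun x => (α x : Covector V))
        atTop (𝓝 s) := by
  choose s hs using fun k => exists_pairing_limit h hf (finBasis ℝ (bidegree V m m) k).2
    (continuous_coefficient α k) (hasCompactSupport_coefficient α k)
  refine ⟨∑ k, s k, fun g hg => ?_⟩
  simp only [fun j => formPairing_eq_sum (fun u hu => (smooth_ofFn hg j u hu).1) α]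
  exact tendsto_finsetSum _ fun k _ => hs k g hg

theorem exists_abs_linear_le {F : Type*} [NormedAddCommGroup F] [NormedSpace ℝ F]
    [FiniteDimensional ℝ F] (A : F →ₗ[ℝ] ℝ) : ∃ K : ℝ, 0 ≤ K ∧ ∀ u, |A u| ≤ K * ‖u‖ :=
  ⟨_, norm_nonneg (LinearMap.toContinuousLinearMap A),
    (LinearMap.toContinuousLinearMap A).le_opNorm⟩

theorem exists_formPairing_bound {p m : ℕ} (h : p + m = finrank ℝ V) {R ρ M : ℝ} (hR : 0 < R)
    (hρ : 2 ^ finrank ℝ V * R ≤ ρ) (hM : 0 ≤ M) : ∃ C : ℝ, 0 ≤ C ∧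
      ∀ l : List (V → ℝ), l.length = p → (∀ g ∈ l, BoundedConvex ρ M g) →
      ∀ α : ContForm V m m, tsupport α ⊆ Metric.closedBall 0 R → ∀ B : ℝ, (∀ x, ‖α x‖ ≤ B) →
        |formPairing l fun x => (α x : Covector V)| ≤ C * B := by
  choose C hC hmass using fun k => exists_local_mass_bound h
    (finBasis ℝ (bidegree V m m) k).2 hR hρ hM
  choose A hA hAle using fun k => exists_abs_linear_le ((finBasis ℝ (bidegree V m m)).coord k)
  refine ⟨∑ k, A k * C k, Finset.sum_nonneg fun k _ => mul_nonneg (hA k) (hC k), ?_⟩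
  intro l hl hg α hα B hB
  have hB0 : 0 ≤ B := (norm_nonneg _).trans (hB 0)
  have sl : ∀ g ∈ l, ContDiff ℝ ∞ g := fun g hgl => (hg g hgl).1.1
  rw [formPairing_eq_sum sl, Finset.sum_mul]
  refine (Finset.abs_sum_le_sum_abs _ _).trans (Finset.sum_le_sum fun k _ => ?_)
  have h1 : ∀ x, |coefficient α k x| ≤ A k * B := fun x =>
    (hAle k (α x)).trans (mul_le_mul_of_nonneg_left (hB x) (hA k))
  have h2 : tsupport (coefficient α k) ⊆ Metric.closedBall 0 R :=
    (closure_mono (Function.support_comp_subset (map_zero _) α)).trans hα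
  refine (abs_pairing_le sl (continuous_coefficient α k) h2 h1 _).trans ?_
  have h3 : 0 ≤ A k * B := mul_nonneg (hA k) hB0
  exact (mul_le_mul_of_nonneg_left (hmass k l hl hg) h3).trans_eq
    (mul_right_comm _ _ _)

theorem formPairing_add {l : List (V → ℝ)} (hl : ∀ g ∈ l, ContDiff ℝ ∞ g) {m : ℕ}
    (α β : ContForm V m m) : formPairing l (fun x => ((α + β) x : Covector V)) =
      formPairing l (fun x => (α x : Covector V)) + formPairing l fun x => (β x : Covector V) := by
  rw [formPairing, formPairing, formPairing, ← integral_add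
    (integrable_formPairing hl (continuous_coe_contForm α) (hasCompactSupport_coe_contForm α))
    (integrable_formPairing hl (continuous_coe_contForm β) (hasCompactSupport_coe_contForm β))]
  refine integral_congr_ae (ae_of_all _ fun x => ?_)
  change topCoeff V (listDD l x * ((α x : Covector V) + (β x : Covector V))) = _
  rw [mul_add, map_add]

theorem formPairing_smul (l : List (V → ℝ)) {m : ℕ} (t : ℝ) (α : ContForm V m m) :
    formPairing l (fun x => ((t • α) x : Covector V)) =
      t * formPairing l fun x => (α x : Covector V) := by
  rw [formPairing, formPairing, ← integral_const_mul]
  refine integral_congr_ae (ae_of_all _ fun x => ?_)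
  change topCoeff V (listDD l x * (t • (α x : Covector V))) = _
  rw [mul_smul_comm, map_smul, smul_eq_mul]

theorem existsUnique_intersectionProduct {p m : ℕ} (h : p + m = finrank ℝ V) {f : Fin p → V → ℝ}
    (hf : ∀ i, ConvexOn ℝ univ (f i)) :
    ∃! S : MeasureCurrent V m m, HasIntersectionProduct f S := by
  have h0 : ∀ i, IsSmoothConvexApprox (f i) (mollify (f i)) := fun i =>
    isSmoothConvexApprox_mollify (hf i)
  have smooth0 : ∀ j, ∀ u ∈ List.ofFn fun i => mollify (f i) j, ContDiff ℝ ∞ u := fun j u hu =>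
    (smooth_ofFn h0 j u hu).1
  choose s hs using exists_formPairing_limit (m := m) h hf
  have hadd : ∀ α β, s (α + β) = s α + s β := fun α β =>
    tendsto_nhds_unique (hs (α + β) _ h0) (((hs α _ h0).add (hs β _ h0)).congr fun j =>
      (formPairing_add (smooth0 j) α β).symm)
  have hsmul : ∀ (t : ℝ) α, s (t • α) = t * s α := fun t α =>
    tendsto_nhds_unique (hs (t • α) _ h0) (((hs α _ h0).const_mul t).congr fun j =>
      (formPairing_smul _ t α).symm)
  have hbdd : ∀ K : Set V, IsCompact K → ∃ C : ℝ, ∀ α : ContForm V m m, tsupport α ⊆ K →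
      ∀ B : ℝ, (∀ x, ‖α x‖ ≤ B) → |s α| ≤ C * B := by
    intro K hK
    obtain ⟨R, hR⟩ := hK.isBounded.subset_closedBall (0 : V)
    have hR' : 0 < max R 1 := lt_max_of_lt_right one_pos
    obtain ⟨M, hM, hfM⟩ := exists_bound_on_ball hf (2 ^ finrank ℝ V * max R 1)
    obtain ⟨C, hC, hb⟩ := exists_formPairing_bound (m := m) h hR' le_rfl
      (add_nonneg hM zero_le_one)
    refine ⟨C, fun α hα B hB => ?_⟩
    refine le_of_tendsto (hs α _ h0).abs ?_
    filter_upwards [eventually_bounded_ofFn h0 hfM] with j hj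
    exact hb _ (List.length_ofFn) hj α ((hα.trans hR).trans
      (Metric.closedBall_subset_closedBall (le_max_left _ _))) B hB
  refine ⟨⟨⟨⟨s, hadd⟩, hsmul⟩, hbdd⟩, fun g hg α => ?_, fun S' hS' => ?_⟩
  · simp only [superIntegral_wedge]
    exact hs α g hg
  · refine MeasureCurrent.ext (LinearMap.ext fun α => ?_)
    have h1 := hS' _ h0 α
    simp only [superIntegral_wedge] at h1
    exact tendsto_nhds_unique h1 (hs α _ h0)

end Existence

/-! ### Functionals represented by measures with finite mass on tubes -/

section Tubes

variable {V V' : Type*} [NormedAddCommGroup V] [InnerProductSpace ℝ V] [FiniteDimensional ℝ V]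
  [NormedAddCommGroup V'] [InnerProductSpace ℝ V']

/-- The tube over the ball of radius `R` in the target of `π`. -/
def tube (π : V →L[ℝ] V') (R : ℝ) : Set V := {x | ‖π x‖ ≤ R}

omit [FiniteDimensional ℝ V] in
theorem isClosed_tube (π : V →L[ℝ] V') (R : ℝ) : IsClosed (tube π R) :=
  isClosed_le π.continuous.norm continuous_const

/-- A continuous function with compact support that is `1` on the part of the tube of radius `R` in
the ball of radius `N`, and vanishes outside the tube of radius `R + 1`. -/
noncomputable def tubeBump (π : V →L[ℝ] V') (R N : ℝ) : C_c(V, ℝ) where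
  toFun x := max 0 (min 1 (R + 1 - ‖π x‖)) * max 0 (min 1 (N + 1 - ‖x‖))
  continuous_toFun := by fun_prop
  hasCompactSupport' := by
    refine HasCompactSupport.intro (isCompact_closedBall (0 : V) (N + 1)) fun x hx => ?_
    rw [mem_closedBall_zero_iff, not_le] at hx
    have : min 1 (N + 1 - ‖x‖) ≤ 0 := (min_le_right _ _).trans (by linarith)
    simp [max_eq_left this]

theorem tubeBump_apply (π : V →L[ℝ] V') (R N : ℝ) (x : V) : tubeBump π R N x =
    max 0 (min 1 (R + 1 - ‖π x‖)) * max 0 (min 1 (N + 1 - ‖x‖)) := rfl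

theorem tubeBump_mem_Icc (π : V →L[ℝ] V') (R N : ℝ) (x : V) : tubeBump π R N x ∈ Icc (0 : ℝ) 1 := by
  rw [tubeBump_apply]
  exact ⟨mul_nonneg (le_max_left _ _) (le_max_left _ _), mul_le_one₀
    (max_le zero_le_one (min_le_left _ _)) (le_max_left _ _) (max_le zero_le_one (min_le_left _ _))⟩

theorem tubeBump_eq_one {π : V →L[ℝ] V'} {R N : ℝ} {x : V} (hx : x ∈ tube π R)
    (hN : x ∈ Metric.closedBall (0 : V) N) : tubeBump π R N x = 1 := by
  rw [mem_closedBall_zero_iff] at hN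
  have h : ‖π x‖ ≤ R := hx
  rw [tubeBump_apply, min_eq_left (by linarith), min_eq_left (by linarith)]
  simp

theorem mem_tube_of_tubeBump_ne_zero {π : V →L[ℝ] V'} {R N : ℝ} {x : V}
    (hx : tubeBump π R N x ≠ 0) : x ∈ tube π (R + 1) := by
  by_contra h
  have h' : R + 1 < ‖π x‖ := not_le.1 h
  refine hx ?_
  have : min 1 (R + 1 - ‖π x‖) ≤ 0 := (min_le_right _ _).trans (by linarith)
  rw [tubeBump_apply, max_eq_left this, zero_mul]

variable [MeasurableSpace V] [BorelSpace V]

/-- All tubes have finite mass. -/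
def TubeFinite (π : V →L[ℝ] V') (ν : Measure V) : Prop := ∀ R, ν (tube π R) < ⊤

omit [FiniteDimensional ℝ V] [BorelSpace V] in
theorem TubeFinite.add {π : V →L[ℝ] V'} {ν ν' : Measure V} (h : TubeFinite π ν)
    (h' : TubeFinite π ν') : TubeFinite π (ν + ν') := fun R => by
  rw [Measure.add_apply]
  exact ENNReal.add_lt_top.2 ⟨h R, h' R⟩

omit [FiniteDimensional ℝ V] [BorelSpace V] in
theorem TubeFinite.smul {π : V →L[ℝ] V'} {ν : Measure V} (h : TubeFinite π ν) (t : NNReal) :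
    TubeFinite π (t • ν) := fun R => by
  rw [Measure.smul_apply, ENNReal.smul_def, smul_eq_mul]
  exact ENNReal.mul_lt_top ENNReal.coe_lt_top (h R)

omit [FiniteDimensional ℝ V] in
theorem TubeFinite.integrable {π : V →L[ℝ] V'} {ν : Measure V} (h : TubeFinite π ν) {φ : V → ℝ}
    (hφ : AEStronglyMeasurable φ ν) {R M : ℝ} (hM : ∀ x, |φ x| ≤ M)
    (hs : ∀ x, φ x ≠ 0 → x ∈ tube π R) : Integrable φ ν := by
  have h1 : Integrable ((tube π R).indicator fun _ => M) ν :=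
    (integrable_indicator_iff (isClosed_tube π R).measurableSet).2
      (integrableOn_const (h R).ne)
  refine h1.mono' hφ (ae_of_all _ fun x => ?_)
  by_cases hx : φ x = 0
  · rw [hx, norm_zero]
    exact indicator_nonneg (fun _ _ => (abs_nonneg _).trans (hM x)) x
  · rw [indicator_of_mem (hs x hx)]
    exact hM x

omit [FiniteDimensional ℝ V] [MeasurableSpace V] [BorelSpace V] in
theorem exists_subset_tube (π : V →L[ℝ] V') {K : Set V} (hK : IsCompact K) :
    ∃ R, K ⊆ tube π R := by
  obtain ⟨R, hR⟩ := hK.exists_bound_of_continuousOn π.continuous.continuousOn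
  exact ⟨R, hR⟩

omit [FiniteDimensional ℝ V] in
theorem TubeFinite.integrable_compactlySupported {π : V →L[ℝ] V'} {ν : Measure V}
    (h : TubeFinite π ν) (φ : C_c(V, ℝ)) : Integrable φ ν := by
  obtain ⟨M, hM⟩ := φ.hasCompactSupport.exists_bound_of_continuous φ.continuous
  obtain ⟨R, hR⟩ := exists_subset_tube π φ.hasCompactSupport
  exact h.integrable φ.continuous.aestronglyMeasurable hM fun x hx =>
    hR (subset_tsupport _ hx)

/-- The functionals `φ ↦ ∫ φ dν₁ - ∫ φ dν₂`, where `ν₁` and `ν₂` have finite mass on all tubes. -/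
def tubeFunctionals (π : V →L[ℝ] V') : Submodule ℝ (C_c(V, ℝ) →ₗ[ℝ] ℝ) where
  carrier := {Λ | ∃ ν₁ ν₂ : Measure V, TubeFinite π ν₁ ∧ TubeFinite π ν₂ ∧
    ∀ φ : C_c(V, ℝ), Λ φ = ∫ x, φ x ∂ν₁ - ∫ x, φ x ∂ν₂}
  zero_mem' := ⟨0, 0, by simp [TubeFinite], by simp [TubeFinite], by simp⟩
  add_mem' := by
    rintro Λ Λ' ⟨ν₁, ν₂, h₁, h₂, h⟩ ⟨ν₁', ν₂', h₁', h₂', h'⟩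
    refine ⟨ν₁ + ν₁', ν₂ + ν₂', h₁.add h₁', h₂.add h₂', fun φ => ?_⟩
    rw [integral_add_measure (h₁.integrable_compactlySupported φ)
      (h₁'.integrable_compactlySupported φ), integral_add_measure
      (h₂.integrable_compactlySupported φ) (h₂'.integrable_compactlySupported φ),
      LinearMap.add_apply, h, h']
    ring
  smul_mem' := by
    rintro t Λ ⟨ν₁, ν₂, h₁, h₂, h⟩
    rcases le_total 0 t with ht | ht
    · refine ⟨t.toNNReal • ν₁, t.toNNReal • ν₂, h₁.smul _, h₂.smul _, fun φ => ?_⟩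
      rw [integral_smul_nnreal_measure, integral_smul_nnreal_measure, LinearMap.smul_apply, h,
        NNReal.smul_def, NNReal.smul_def, Real.coe_toNNReal _ ht, smul_eq_mul, smul_eq_mul,
        smul_eq_mul]
      ring
    · refine ⟨(-t).toNNReal • ν₂, (-t).toNNReal • ν₁, h₂.smul _, h₁.smul _, fun φ => ?_⟩
      rw [integral_smul_nnreal_measure, integral_smul_nnreal_measure, LinearMap.smul_apply, h,
        NNReal.smul_def, NNReal.smul_def, Real.coe_toNNReal _ (neg_nonneg.2 ht), smul_eq_mul,
        smul_eq_mul, smul_eq_mul]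
      ring

/-- A positive functional that is bounded on the functions with values in `[0, 1]` supported in any
given tube is represented by a measure with finite mass on tubes. -/
theorem mem_tubeFunctionals_of_nonneg {π : V →L[ℝ] V'} {Λ : C_c(V, ℝ) →ₗ[ℝ] ℝ}
    (h0 : ∀ φ : C_c(V, ℝ), (∀ x, 0 ≤ φ x) → 0 ≤ Λ φ)
    (hb : ∀ R, ∃ C, ∀ φ : C_c(V, ℝ), (∀ x, φ x ∈ Icc (0 : ℝ) 1) →
      (∀ x, φ x ≠ 0 → x ∈ tube π R) → Λ φ ≤ C) : Λ ∈ tubeFunctionals π := by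
  let Λ' : C_c(V, ℝ) →ₚ[ℝ] ℝ := PositiveLinearMap.mk₀ Λ fun φ hφ => h0 φ hφ
  refine ⟨RealRMK.rieszMeasure Λ', 0, fun R => ?_, by simp [TubeFinite], fun φ => ?_⟩
  · obtain ⟨C, hC⟩ := hb (R + 1)
    have hU : tube π R = ⋃ N : ℕ, tube π R ∩ Metric.closedBall (0 : V) N := by
      rw [← inter_iUnion, Metric.iUnion_closedBall_nat, inter_univ]
    have hmono : Monotone fun N : ℕ => tube π R ∩ Metric.closedBall (0 : V) N := fun i j hij =>
      inter_subset_inter_right _ (Metric.closedBall_subset_closedBall (by exact_mod_cast hij))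
    have hle : ∀ N : ℕ, RealRMK.rieszMeasure Λ' (tube π R ∩ Metric.closedBall (0 : V) N) ≤
        ENNReal.ofReal C := by
      intro N
      refine (RealRMK.rieszMeasure_le_of_eq_one Λ' (f := tubeBump π R N)
        (fun x => (tubeBump_mem_Icc π R N x).1)
        ((isCompact_closedBall (0 : V) N).inter_left (isClosed_tube π R))
        fun x hx => tubeBump_eq_one hx.1 hx.2).trans ?_
      exact ENNReal.ofReal_le_ofReal (hC _ (tubeBump_mem_Icc π R N) fun x hx =>
        mem_tube_of_tubeBump_ne_zero hx)
    rw [hU, hmono.measure_iUnion]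
    exact (iSup_le hle).trans_lt ENNReal.ofReal_lt_top
  · rw [RealRMK.integral_rieszMeasure, integral_zero_measure, sub_zero]
    rfl

end Tubes

/-! ### The horizontal components of the intersection product -/

section Horizontal

variable {V V' : Type*} [NormedAddCommGroup V] [InnerProductSpace ℝ V] [FiniteDimensional ℝ V]
  [NormedAddCommGroup V'] [InnerProductSpace ℝ V'] [FiniteDimensional ℝ V']

/-- The form with continuous coefficients `φ w`, where `w` is a constant form. -/
noncomputable def scaledForm {a b : ℕ} (φ : C_c(V, ℝ)) (w : bidegree V a b) : ContForm V a b where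
  toFun x := φ x • w
  continuous_toFun := φ.continuous.smul continuous_const
  hasCompactSupport' := φ.hasCompactSupport.smul_right

theorem scaledForm_apply {a b : ℕ} (φ : C_c(V, ℝ)) (w : bidegree V a b) (x : V) :
    scaledForm φ w x = φ x • w := rfl

/-- The functional `φ ↦ ⟨S, φ w⟩`. -/
noncomputable def MeasureCurrent.component {a b : ℕ} (S : MeasureCurrent V a b) :
    bidegree V a b →ₗ[ℝ] C_c(V, ℝ) →ₗ[ℝ] ℝ :=
  LinearMap.mk₂ ℝ (fun w φ => S.toLinearMap (scaledForm φ w))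
    (fun w w' φ => by
      rw [← map_add]
      congr 1
      ext1 x
      exact smul_add _ _ _)
    (fun t w φ => by
      rw [← map_smul]
      congr 1
      ext1 x
      exact smul_comm _ _ _)
    (fun w φ φ' => by
      rw [← map_add]
      congr 1
      ext1 x
      exact add_smul _ _ _)
    (fun t w φ => by
      rw [← map_smul]
      congr 1
      ext1 x
      exact mul_smul _ _ _)

/-- The pull-back of constant forms of a given bidegree. -/
noncomputable def pullbackHom (π : V →L[ℝ] V') (a b : ℕ) : bidegree V' a b →ₗ[ℝ] bidegree V a b :=
  (pullback V π.toLinearMap).toLinearMap.restrict fun _ hu => pullback_mem_bidegree _ hu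

omit [FiniteDimensional ℝ V] [FiniteDimensional ℝ V'] in
theorem pullbackHom_coe (π : V →L[ℝ] V') {a b : ℕ} (w : bidegree V' a b) :
    (pullbackHom π a b w : Covector V) = pullback V π.toLinearMap w := rfl

omit [FiniteDimensional ℝ V] in
/-- Functions of the Lelong class are bounded by a multiple of the radius on large balls. The lower
bound follows from convexity, as `f x ≥ 2 f 0 - f (-x)`. -/
theorem exists_growth {p : ℕ} {f : Fin p → V → ℝ} (hf : ∀ i, f i ∈ LelongClass V) :
    ∃ M : ℝ, 0 ≤ M ∧ ∀ R, 1 ≤ R → ∀ i, ∀ x ∈ Metric.closedBall (0 : V) (2 ^ finrank ℝ V * R),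
      |f i x| ≤ M * R := by
  have h1 : ∀ i, ∃ M : ℝ, 0 ≤ M ∧ ∀ R, 1 ≤ R →
      ∀ x ∈ Metric.closedBall (0 : V) (2 ^ finrank ℝ V * R), |f i x| ≤ M * R := by
    intro i
    obtain ⟨hc, C, D, hC, hle⟩ := hf i
    refine ⟨C * 2 ^ finrank ℝ V + |D| + 2 * |f i 0|, by positivity, fun R hR x hx => ?_⟩
    rw [mem_closedBall_zero_iff] at hx
    have h2 := hle x
    have h3 := hle (-x)
    rw [norm_neg] at h3
    have h4 := hc.2 (mem_univ x) (mem_univ (-x)) (by norm_num : (0 : ℝ) ≤ 1 / 2)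
      (by norm_num : (0 : ℝ) ≤ 1 / 2) (by norm_num)
    rw [← smul_add, add_neg_cancel, smul_zero, smul_eq_mul, smul_eq_mul] at h4
    have h5 : C * ‖x‖ ≤ C * (2 ^ finrank ℝ V * R) := mul_le_mul_of_nonneg_left hx hC
    have h6 : |D| ≤ |D| * R := le_mul_of_one_le_right (abs_nonneg _) hR
    have h7 : |f i 0| ≤ |f i 0| * R := le_mul_of_one_le_right (abs_nonneg _) hR
    have h8 := le_abs_self D
    have h9 := neg_abs_le (f i 0)
    rw [abs_le]
    constructor <;> linarith [abs_nonneg (f i 0)]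
  choose M hM0 hM using h1
  refine ⟨∑ i, M i, Finset.sum_nonneg fun i _ => hM0 i, fun R hR i x hx => ?_⟩
  exact (hM i R hR x hx).trans (mul_le_mul_of_nonneg_right
    (Finset.single_le_sum (fun i _ => hM0 i) (Finset.mem_univ i)) (by linarith))

variable [MeasurableSpace V] [BorelSpace V] {p m : ℕ} {f : Fin p → V → ℝ} {S : MeasureCurrent V m m}

theorem HasIntersectionProduct.tendsto (hS : HasIntersectionProduct f S)
    (hf : ∀ i, ConvexOn ℝ univ (f i)) (α : ContForm V m m) :
    Tendsto (fun j => formPairing (List.ofFn fun i => mollify (f i) j) fun x => (α x : Covector V))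
      atTop (𝓝 (S.toLinearMap α)) := by
  have := hS _ (fun i => isSmoothConvexApprox_mollify (hf i)) α
  simpa only [superIntegral_wedge] using this

/-- The intersection product is nonnegative on the forms which are nonnegative on all strongly
positive forms. -/
theorem HasIntersectionProduct.nonneg (hS : HasIntersectionProduct f S)
    (hf : ∀ i, ConvexOn ℝ univ (f i)) {α : ContForm V m m}
    (hα : ∀ x, ∀ Θ ∈ stronglyPositive V p, 0 ≤ topCoeff V (Θ * (α x : Covector V))) :
    0 ≤ S.toLinearMap α := by
  refine ge_of_tendsto' (hS.tendsto hf α) fun j => integral_nonneg fun x => hα x _ ?_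
  have := listDD_mem (smooth_ofFn (fun i => isSmoothConvexApprox_mollify (hf i)) j) x
  rwa [List.length_ofFn] at this

/-- The intersection product does not distinguish forms that pair equally with all strongly positive
forms. -/
theorem HasIntersectionProduct.congr (hS : HasIntersectionProduct f S)
    (hf : ∀ i, ConvexOn ℝ univ (f i)) {α β : ContForm V m m}
    (h : ∀ x, ∀ Θ ∈ stronglyPositive V p,
      topCoeff V (Θ * (α x : Covector V)) = topCoeff V (Θ * (β x : Covector V))) :
    S.toLinearMap α = S.toLinearMap β := by
  refine tendsto_nhds_unique (hS.tendsto hf α) ((hS.tendsto hf β).congr fun j => ?_)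
  refine integral_congr_ae (ae_of_all _ fun x => (h x _ ?_).symm)
  have := listDD_mem (smooth_ofFn (fun i => isSmoothConvexApprox_mollify (hf i)) j) x
  rwa [List.length_ofFn] at this

/-- Bounds for smooth convex functions with a uniform linear growth pass to the intersection
product of functions in the Lelong class. -/
theorem HasIntersectionProduct.exists_growth_bound (hS : HasIntersectionProduct f S)
    (hf : ∀ i, f i ∈ LelongClass V) : ∃ M : ℝ, 0 ≤ M ∧ ∀ R, 1 ≤ R → ∀ (α : ContForm V m m) (s : Set ℝ),
      IsClosed s → (∀ l : List (V → ℝ), l.length = p →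
        (∀ g ∈ l, BoundedConvex (2 ^ finrank ℝ V * R) (M * R) g) →
        formPairing l (fun x => (α x : Covector V)) ∈ s) → S.toLinearMap α ∈ s := by
  obtain ⟨M, hM, hfM⟩ := exists_growth hf
  refine ⟨M + 1, by linarith, fun R hR α s hcl hs => ?_⟩
  refine hcl.mem_of_tendsto (hS.tendsto (fun i => (hf i).1) α) ?_
  filter_upwards [eventually_bounded_ofFn (fun i => isSmoothConvexApprox_mollify (hf i).1)
    (hfM R hR)] with j hj
  refine hs _ List.length_ofFn fun g hg => ⟨(hj g hg).1, fun x hx => ?_⟩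
  exact ((hj g hg).2 x hx).trans (by linarith)

end Horizontal

section Representation

variable {V V' : Type*} [NormedAddCommGroup V] [InnerProductSpace ℝ V] [FiniteDimensional ℝ V]
  [NormedAddCommGroup V'] [InnerProductSpace ℝ V']

omit [FiniteDimensional ℝ V] in
theorem mul_J_mem_bidegree {m : ℕ} {b b' : Covector V} (hb : b ∈ bidegree V m 0)
    (hb' : b' ∈ bidegree V m 0) : b * J V b' ∈ bidegree V m m := by
  simpa using mul_mem_bidegree hb (J_mem_bidegree hb')

/-- The constant form `b ∧ J(b')` for `(m, 0)`-forms `b` and `b'`. -/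
noncomputable def mixedForm {m : ℕ} (b b' : bidegree V m 0) : bidegree V m m :=
  ⟨b * J V b', mul_J_mem_bidegree b.2 b'.2⟩

variable [FiniteDimensional ℝ V'] [MeasurableSpace V] [BorelSpace V] {p m : ℕ} {f : Fin p → V → ℝ}
  {S : MeasureCurrent V m m}

omit [FiniteDimensional ℝ V'] in
theorem HasIntersectionProduct.component_square_nonneg (hS : HasIntersectionProduct f S)
    (hf : ∀ i, ConvexOn ℝ univ (f i)) (h : p + m = finrank ℝ V) (b : bidegree V m 0)
    {φ : C_c(V, ℝ)} (hφ : ∀ x, 0 ≤ φ x) : 0 ≤ S.component (sgn m • mixedForm b b) φ := by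
  refine hS.nonneg hf fun x Θ hΘ => ?_
  change 0 ≤ topCoeff V (Θ * (φ x • (sgn m • ((b : Covector V) * J V b))))
  rw [mul_smul_comm, map_smul]
  exact smul_nonneg (hφ x) (topCoeff_nonneg h hΘ b.2)

theorem HasIntersectionProduct.component_symm (hS : HasIntersectionProduct f S)
    (hf : ∀ i, ConvexOn ℝ univ (f i)) (h : p + m = finrank ℝ V) (b b' : bidegree V m 0) :
    S.component (mixedForm b b') = S.component (mixedForm b' b) := by
  refine LinearMap.ext fun φ => hS.congr hf fun x Θ hΘ => ?_
  change topCoeff V (Θ * (φ x • ((b : Covector V) * J V b'))) =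
    topCoeff V (Θ * (φ x • ((b' : Covector V) * J V b)))
  rw [mul_smul_comm, mul_smul_comm, map_smul, map_smul, topCoeff_symm h hΘ b.2 b'.2]

omit [MeasurableSpace V] [BorelSpace V] in
theorem mixedForm_add_self (b b' : bidegree V m 0) : mixedForm (b + b') (b + b') =
    mixedForm b b + mixedForm b b' + (mixedForm b' b + mixedForm b' b') := by
  ext1
  change ((b : Covector V) + b') * J V ((b : Covector V) + b') = _
  rw [map_add, add_mul, mul_add, mul_add]
  rfl

omit [FiniteDimensional ℝ V] [MeasurableSpace V] [BorelSpace V] in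
theorem mixedForm_sub_self (b b' : bidegree V m 0) : mixedForm (b - b') (b - b') =
    mixedForm b b - mixedForm b b' - (mixedForm b' b - mixedForm b' b') := by
  ext1
  change ((b : Covector V) - b') * J V ((b : Covector V) - b') = _
  rw [map_sub, sub_mul, mul_sub, mul_sub]
  rfl

/-- A bound for the functional `φ ↦ ⟨S, φ σₘ b ∧ J(b)⟩` on each tube. -/
def BoundedOnTubes (π : V →L[ℝ] V') (S : MeasureCurrent V m m) (b : bidegree V m 0) : Prop :=
  ∀ R, ∃ C, ∀ φ : C_c(V, ℝ), (∀ x, φ x ∈ Icc (0 : ℝ) 1) →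
    (∀ x, φ x ≠ 0 → x ∈ tube π R) → S.component (sgn m • mixedForm b b) φ ≤ C

omit [FiniteDimensional ℝ V'] in
/-- The parallelogram identity bounds both `b + b'` and `b - b'`, since both terms are nonnegative. -/
theorem BoundedOnTubes.add_sub (hS : HasIntersectionProduct f S)
    (hf : ∀ i, ConvexOn ℝ univ (f i)) (h : p + m = finrank ℝ V) {π : V →L[ℝ] V'}
    {b b' : bidegree V m 0} (hb : BoundedOnTubes π S b) (hb' : BoundedOnTubes π S b') :
    BoundedOnTubes π S (b + b') ∧ BoundedOnTubes π S (b - b') := by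
  have key : ∀ φ, S.component (sgn m • mixedForm (b + b') (b + b')) φ +
      S.component (sgn m • mixedForm (b - b') (b - b')) φ =
      2 * S.component (sgn m • mixedForm b b) φ + 2 * S.component (sgn m • mixedForm b' b') φ := by
    intro φ
    simp only [mixedForm_add_self, mixedForm_sub_self, map_smul, map_add, map_sub,
      LinearMap.smul_apply, LinearMap.add_apply, LinearMap.sub_apply, smul_eq_mul]
    ring
  constructor
  · intro R
    obtain ⟨C, hC⟩ := hb R
    obtain ⟨C', hC'⟩ := hb' R
    refine ⟨2 * C + 2 * C', fun φ h1 h2 => ?_⟩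
    linarith [key φ, hC φ h1 h2, hC' φ h1 h2,
      hS.component_square_nonneg hf h (b - b') fun x => (h1 x).1]
  · intro R
    obtain ⟨C, hC⟩ := hb R
    obtain ⟨C', hC'⟩ := hb' R
    refine ⟨2 * C + 2 * C', fun φ h1 h2 => ?_⟩
    linarith [key φ, hC φ h1 h2, hC' φ h1 h2,
      hS.component_square_nonneg hf h (b + b') fun x => (h1 x).1]

omit [FiniteDimensional ℝ V'] in
/-- The mixed components follow from the positive ones by polarization. -/
theorem component_mem_tubeFunctionals (hS : HasIntersectionProduct f S)
    (hf : ∀ i, ConvexOn ℝ univ (f i)) (h : p + m = finrank ℝ V) {π : V →L[ℝ] V'}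
    {b b' : bidegree V m 0} (hb : BoundedOnTubes π S b) (hb' : BoundedOnTubes π S b') :
    S.component (mixedForm b b') ∈ tubeFunctionals π := by
  obtain ⟨h1, h2⟩ := hb.add_sub hS hf h hb'
  have m1 := mem_tubeFunctionals_of_nonneg
    (fun φ hφ => hS.component_square_nonneg hf h (b + b') hφ) h1
  have m2 := mem_tubeFunctionals_of_nonneg
    (fun φ hφ => hS.component_square_nonneg hf h (b - b') hφ) h2
  have key : S.component (mixedForm b b') = (sgn m / 4) •
      (S.component (sgn m • mixedForm (b + b') (b + b')) -
        S.component (sgn m • mixedForm (b - b') (b - b'))) := by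
    refine LinearMap.ext fun φ => ?_
    simp only [mixedForm_add_self, mixedForm_sub_self, map_smul, map_add, map_sub,
      hS.component_symm hf h b' b,
      LinearMap.smul_apply, LinearMap.add_apply, LinearMap.sub_apply, smul_eq_mul]
    linear_combination (-(S.component (mixedForm b b') φ)) * sgn_mul_self m
  rw [key]
  exact Submodule.smul_mem _ _ (Submodule.sub_mem _ m1 m2)

omit [FiniteDimensional ℝ V] [FiniteDimensional ℝ V'] [MeasurableSpace V] [BorelSpace V] in
theorem pullback_list_dx (π : V →L[ℝ] V') (l : List (Dual ℝ V')) :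
    pullback V π.toLinearMap (l.map (dx V')).prod =
      ((l.map fun b => b ∘ₗ π.toLinearMap).map (dx V)).prod := by
  rw [map_list_prod, List.map_map, List.map_map]
  congr 1
  exact List.map_congr_left fun b _ => pullback_dx V π.toLinearMap b

omit [FiniteDimensional ℝ V] [MeasurableSpace V] [BorelSpace V] in
theorem exists_bound_on_tube (π : V →L[ℝ] V') (l : List (Dual ℝ V')) (R : ℝ) :
    ∃ B : ℝ, ∀ x ∈ tube π R, ∀ b ∈ l.map fun b => b ∘ₗ π.toLinearMap, |b x| ≤ B := by
  induction l with
  | nil => exact ⟨0, by simp⟩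
  | cons a l ih =>
    obtain ⟨B, hB⟩ := ih
    obtain ⟨K, hK, hle⟩ := exists_abs_linear_le a
    refine ⟨max B (K * R), fun x hx b hb => ?_⟩
    rcases List.mem_cons.1 hb with rfl | hb'
    · exact ((hle (π x)).trans (mul_le_mul_of_nonneg_left hx hK)).trans (le_max_right _ _)
    · exact (hB x hx b hb').trans (le_max_left _ _)

/-- On tubes, the products of covectors pulled back by `π` are dominated by `d d^#` of functions of
linear growth. -/
theorem boundedOnTubes_of_list (hS : HasIntersectionProduct f S) (hf : ∀ i, f i ∈ LelongClass V)
    (π : V →L[ℝ] V') (l : List (Dual ℝ V')) (hl : l.length = m) (h : p + m = finrank ℝ V)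
    {b : bidegree V m 0} (hb : (b : Covector V) = pullback V π.toLinearMap (l.map (dx V')).prod) :
    BoundedOnTubes π S b := by
  intro R
  set a := l.map fun b => b ∘ₗ π.toLinearMap with ha
  have hla : a.length = m := by rw [ha, List.length_map, hl]
  obtain ⟨B, hB⟩ := exists_bound_on_tube π l R
  obtain ⟨M, hM, hgrow⟩ := hS.exists_growth_bound hf
  obtain ⟨C, hC, hcyl⟩ := exists_cylinder_bound p 0 a (by rw [hla, h, add_zero]) B M hM
  refine ⟨C, fun φ hφ hs => ?_⟩
  obtain ⟨ρ, hρ⟩ := IsCompact.isBounded φ.hasCompactSupport |>.subset_closedBall (0 : V)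
  set r := max ρ 1
  have hr : Metric.closedBall (0 : V) ρ ⊆ Metric.closedBall 0 r :=
    Metric.closedBall_subset_closedBall (le_max_left _ _)
  refine hgrow r (le_max_right _ _) _ (Iic C) isClosed_Iic fun g hg hgb => ?_
  rw [mem_Iic]
  have sg : ∀ u ∈ g, ContDiff ℝ ∞ u := fun u hu => (hgb u hu).1.1
  have hcyl' := hcyl g r hg (le_max_right _ _) hgb
  rw [pow_zero, pow_zero, mul_one, mul_one] at hcyl'
  have hint : formPairing g (fun x =>
      (scaledForm φ (sgn m • mixedForm b b) x : Covector V)) =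
      ∫ x, φ x * density g (a.map elemForm).prod x := by
    refine integral_congr_ae (ae_of_all _ fun x => ?_)
    change topCoeff V (listDD g x * (φ x • (sgn m • ((b : Covector V) * J V b)))) =
      φ x * topCoeff V (listDD g x * (a.map elemForm).prod)
    rw [mul_smul_comm, map_smul, smul_eq_mul, hb, pullback_list_dx, list_elemForm_eq, hla]
  have hzero : ∀ x ∉ cylinder a B r, φ x = 0 := by
    intro x hx
    by_contra hne
    exact hx ⟨hr (hρ (subset_tsupport _ hne)), hB x (hs x hne)⟩
  rw [hint, ← setIntegral_eq_integral_of_forall_compl_eq_zero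
    (s := cylinder a B r) fun x hx => by rw [hzero x hx, zero_mul]]
  refine le_trans ?_ hcyl'
  have cd := (contDiff_density sg (a.map elemForm).prod).continuous
  have hK := isCompact_cylinder a B r
  refine setIntegral_mono_on ((φ.continuous.mul cd).continuousOn.integrableOn_compact hK)
    (cd.continuousOn.integrableOn_compact hK) hK.measurableSet fun x _ => ?_
  refine mul_le_of_le_one_left ?_ (hφ x).2
  have := density_nonneg (V := V) (l := g) (r := m) (fun u hu => (hgb u hu).1)
    (c := (a.map elemForm).prod) (by rw [← hla]; exact list_elemForm_mem a) (by rw [hg, h]) x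
  exact this

/-- The horizontal components of `S` have finite mass on tubes, since the forms pulled back by `π` are
spanned by the products `π^* b ∧ J(π^* b')`. -/
theorem component_pullback_mem (hS : HasIntersectionProduct f S) (hf : ∀ i, f i ∈ LelongClass V)
    (π : V →L[ℝ] V') (h : p + m = finrank ℝ V) (w : bidegree V' m m) :
    S.component (pullbackHom π m m w) ∈ tubeFunctionals π := by
  have hle : bidegree V' m m ≤
      ((tubeFunctionals π).comap (S.component ∘ₗ pullbackHom π m m)).map
        (bidegree V' m m).subtype := by
    refine bidegree_le_span m m _ fun l l' hl hl' => ?_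
    have hb : (l.map (dx V')).prod ∈ bidegree V' m 0 := hl ▸ list_dx_mem l
    have hb' : (l'.map (dx V')).prod ∈ bidegree V' m 0 := hl' ▸ list_dx_mem l'
    refine ⟨⟨_, mul_J_mem_bidegree hb hb'⟩, ?_, rfl⟩
    have e : pullbackHom π m m ⟨_, mul_J_mem_bidegree hb hb'⟩ =
        mixedForm ⟨_, pullback_mem_bidegree π.toLinearMap hb⟩
          ⟨_, pullback_mem_bidegree π.toLinearMap hb'⟩ := by
      ext1
      rw [pullbackHom_coe, map_mul, ← J_pullback]
      rfl
    change S.component (pullbackHom π m m _) ∈ tubeFunctionals π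
    rw [e]
    exact component_mem_tubeFunctionals hS (fun i => (hf i).1) h
      (boundedOnTubes_of_list hS hf π l hl h rfl) (boundedOnTubes_of_list hS hf π l' hl' h rfl)
  obtain ⟨w', hw', e⟩ := hle w.2
  rwa [← show w' = w from Subtype.ext e]

end Representation

/-! ### Existence and uniqueness of the push-forward -/

section Pushforward

theorem exists_integral_functional {E F : Type*} [NormedAddCommGroup E] [NormedSpace ℝ E]
    [FiniteDimensional ℝ E] [MeasurableSpace E] [BorelSpace E] [NormedAddCommGroup F]
    [NormedSpace ℝ F] [FiniteDimensional ℝ F] (μ : Measure E) [IsLocallyFiniteMeasure μ]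
    (A : F →ₗ[ℝ] ℝ) : ∃ T : 𝓓((⊤ : Opens E), F) →L[ℝ] ℝ,
      ∀ α : 𝓓((⊤ : Opens E), F), T α = ∫ x, A (α x) ∂μ := by
  refine ⟨TestFunction.integralAgainstBilinCLM
    ((ContinuousLinearMap.mul ℝ ℝ).comp (LinearMap.toContinuousLinearMap A)) μ fun _ => 1,
    fun α => ?_⟩
  rw [TestFunction.integralAgainstBilinCLM_eq_integral
    ((locallyIntegrable_const (1 : ℝ)).locallyIntegrableOn _)]
  simp

variable {V V' : Type*} [NormedAddCommGroup V] [InnerProductSpace ℝ V] [FiniteDimensional ℝ V]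
  [NormedAddCommGroup V'] [InnerProductSpace ℝ V'] [FiniteDimensional ℝ V']

omit [FiniteDimensional ℝ V] [FiniteDimensional ℝ V'] in
theorem TubeFinite.isLocallyFiniteMeasure_map [MeasurableSpace V] [BorelSpace V]
    [MeasurableSpace V'] [BorelSpace V'] {π : V →L[ℝ] V'} {ν : Measure V} (h : TubeFinite π ν) :
    IsLocallyFiniteMeasure (ν.map π) := by
  refine ⟨fun x => ⟨Metric.ball x 1, Metric.ball_mem_nhds x one_pos, ?_⟩⟩
  rw [Measure.map_apply π.continuous.measurable Metric.isOpen_ball.measurableSet]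
  refine (measure_mono fun y hy => ?_).trans_lt (h (‖x‖ + 1))
  have h1 : ‖π y - x‖ < 1 := mem_ball_iff_norm.1 hy
  have h2 := norm_le_norm_add_norm_sub' (π y) x
  change ‖π y‖ ≤ ‖x‖ + 1
  linarith

omit [FiniteDimensional ℝ V] [FiniteDimensional ℝ V'] in
theorem isCutoff_of_hasCompactSupport (π : V →L[ℝ] V') {χ : V → ℝ} (hc : Continuous χ)
    (hs : HasCompactSupport χ) (h : ∀ x, χ x ∈ Icc (0 : ℝ) 1) : IsCutoff π χ :=
  ⟨hc, h, fun _ hK => IsCompact.inter_right hs (hK.isClosed.preimage π.continuous)⟩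

omit [FiniteDimensional ℝ V'] in
/-- Smooth cutoff functions with compact support which exhaust `V` and whose gradients decay like
the inverse of the radius. -/
theorem exists_cutoff_family (π : V →L[ℝ] V') : ∃ K : ℝ, 0 ≤ K ∧ ∃ χ : ℝ → V → ℝ,
    (∀ R, IsCutoff π (χ R)) ∧ (∀ R, ContDiff ℝ ∞ (χ R)) ∧
    (∀ R, tsupport (χ R) ⊆ Metric.closedBall 0 (2 * max R 1)) ∧
    (∀ R x i, |fderiv ℝ (χ R) x (stdOrthonormalBasis ℝ V i)| ≤ K / max R 1) ∧
    ∀ x, Tendsto (fun R => χ R x) atTop (𝓝 1) := by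
  obtain ⟨K, hK, hχ⟩ := exists_smooth_cutoff V
  choose χ h1 h2 h3 h4 h5 h6 _ using fun R : ℝ =>
    hχ (max R 1) (lt_max_of_lt_right one_pos)
  refine ⟨K, hK, χ, fun R => isCutoff_of_hasCompactSupport π (h1 R).continuous (h2 R) (h3 R), h1,
    h5, h6, fun x => tendsto_const_nhds.congr' ?_⟩
  filter_upwards [eventually_ge_atTop ‖x‖] with R hR
  exact (h4 R x (mem_closedBall_zero_iff.2 (hR.trans (le_max_left _ _)))).symm

theorem continuous_coefficient_testForm {a b : ℕ} (α : TestForm V a b)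
    (k : Fin (finrank ℝ (bidegree V a b))) : Continuous (coefficient α k) :=
  (LinearMap.continuous_of_finiteDimensional _).comp (TestFunction.contDiff α).continuous

theorem hasCompactSupport_coefficient_testForm {a b : ℕ} (α : TestForm V a b)
    (k : Fin (finrank ℝ (bidegree V a b))) : HasCompactSupport (coefficient α k) :=
  (TestFunction.hasCompactSupport α).comp_left (map_zero _)

/-- The compactly supported function `χ (c ∘ π)`, where `c` is a coefficient of a test form. -/
noncomputable def cutoffCoefficient {a b : ℕ} {π : V →L[ℝ] V'} {χ : V → ℝ} (hχ : IsCutoff π χ)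
    (α : TestForm V' a b) (k : Fin (finrank ℝ (bidegree V' a b))) : C_c(V, ℝ) where
  toFun x := χ x * coefficient α k (π x)
  continuous_toFun :=
    hχ.continuous.mul ((continuous_coefficient_testForm α k).comp π.continuous)
  hasCompactSupport' := by
    refine HasCompactSupport.intro (hχ.proper _ (hasCompactSupport_coefficient_testForm α k))
      fun x hx => ?_
    by_cases h : x ∈ tsupport χ
    · have h0 : coefficient α k (π x) = 0 :=
        image_eq_zero_of_notMem_tsupport fun h' => hx ⟨h, h'⟩
      rw [h0, mul_zero]
    · rw [image_eq_zero_of_notMem_tsupport h, zero_mul]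

omit [FiniteDimensional ℝ V] in
theorem cutoffCoefficient_apply {a b : ℕ} {π : V →L[ℝ] V'} {χ : V → ℝ} (hχ : IsCutoff π χ)
    (α : TestForm V' a b) (k : Fin (finrank ℝ (bidegree V' a b))) (x : V) :
    cutoffCoefficient hχ α k x = χ x * coefficient α k (π x) := rfl

theorem cutoffPullback_eq_sum {a b : ℕ} {π : V →L[ℝ] V'} {χ : V → ℝ} (hχ : IsCutoff π χ)
    (α : TestForm V' a b) : cutoffPullback π χ hχ α = ∑ k, scaledForm (cutoffCoefficient hχ α k)
      (pullbackHom π a b (finBasis ℝ (bidegree V' a b) k)) := by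
  ext1 x
  have h : α (π x) = ∑ k, coefficient α k (π x) • finBasis ℝ (bidegree V' a b) k :=
    ((finBasis ℝ (bidegree V' a b)).sum_repr (α (π x))).symm
  rw [CompactlySupportedContinuousMap.sum_apply]
  change χ x • pullbackHom π a b (α (π x)) = _
  rw [h, map_sum, Finset.smul_sum]
  refine Finset.sum_congr rfl fun k _ => ?_
  rw [map_smul, scaledForm_apply, cutoffCoefficient_apply, mul_smul]

variable [MeasurableSpace V] [BorelSpace V]

omit [FiniteDimensional ℝ V] in
theorem TubeFinite.integrable_coefficient {π : V →L[ℝ] V'} {ν : Measure V} (h : TubeFinite π ν)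
    {a b : ℕ} (α : TestForm V' a b) (k : Fin (finrank ℝ (bidegree V' a b))) :
    Integrable (fun x => coefficient α k (π x)) ν := by
  obtain ⟨M, hM⟩ := (hasCompactSupport_coefficient_testForm α k).exists_bound_of_continuous
    (continuous_coefficient_testForm α k)
  obtain ⟨R, -, hR⟩ := exists_pos_radius (hasCompactSupport_coefficient_testForm α k)
  exact h.integrable
    ((continuous_coefficient_testForm α k).comp π.continuous).aestronglyMeasurable
    (fun x => hM (π x)) fun x hx => mem_closedBall_zero_iff.1 (hR (subset_tsupport _ hx))

omit [FiniteDimensional ℝ V] in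
theorem TubeFinite.tendsto_integral {π : V →L[ℝ] V'} {ν : Measure V} (h : TubeFinite π ν)
    {a b : ℕ} (α : TestForm V' a b) (k : Fin (finrank ℝ (bidegree V' a b))) {χ : ℝ → V → ℝ}
    (hχ : ∀ R, IsCutoff π (χ R)) (hlim : ∀ x, Tendsto (fun R => χ R x) atTop (𝓝 1)) :
    Tendsto (fun R => ∫ x, cutoffCoefficient (hχ R) α k x ∂ν) atTop
      (𝓝 (∫ x, coefficient α k (π x) ∂ν)) := by
  refine tendsto_integral_filter_of_dominated_convergence (fun x => |coefficient α k (π x)|)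
    (Eventually.of_forall fun R =>
      (cutoffCoefficient (hχ R) α k).continuous.aestronglyMeasurable)
    (Eventually.of_forall fun R => ae_of_all _ fun x => ?_) (h.integrable_coefficient α k).abs
    (ae_of_all _ fun x => ?_)
  · rw [cutoffCoefficient_apply, norm_mul, Real.norm_eq_abs, Real.norm_eq_abs,
      abs_of_nonneg ((hχ R).mem_Icc x).1]
    exact mul_le_of_le_one_left (abs_nonneg _) ((hχ R).mem_Icc x).2
  · simp only [cutoffCoefficient_apply]
    simpa using (hlim x).mul_const (coefficient α k (π x))

/-- If the horizontal components of `S` are differences of measures with finite mass on tubes, the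
cutoff functions may be removed by dominated convergence, and `π_* S` has as coefficients the
differences of the image measures. -/
theorem existsUnique_pushforward {m : ℕ} {S : MeasureCurrent V m m} [MeasurableSpace V']
    [BorelSpace V'] (π : V →L[ℝ] V')
    (hS : ∀ w : bidegree V' m m, S.component (pullbackHom π m m w) ∈ tubeFunctionals π) :
    ∃! T : Current V' m m, HasPushforward π S T := by
  choose ν₁ ν₂ h₁ h₂ hν using fun k => hS (finBasis ℝ (bidegree V' m m) k)
  have hf₁ : ∀ k, IsLocallyFiniteMeasure ((ν₁ k).map π) := fun k =>
    (h₁ k).isLocallyFiniteMeasure_map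
  have hf₂ : ∀ k, IsLocallyFiniteMeasure ((ν₂ k).map π) := fun k =>
    (h₂ k).isLocallyFiniteMeasure_map
  choose T₁ hT₁ using fun k => exists_integral_functional (E := V') ((ν₁ k).map π)
    ((finBasis ℝ (bidegree V' m m)).coord k)
  choose T₂ hT₂ using fun k => exists_integral_functional (E := V') ((ν₂ k).map π)
    ((finBasis ℝ (bidegree V' m m)).coord k)
  have hmap : ∀ (ν : Measure V) (α : TestForm V' m m) (k),
      ∫ y, coefficient α k y ∂(ν.map π) = ∫ x, coefficient α k (π x) ∂ν := fun ν α k =>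
    integral_map π.continuous.measurable.aemeasurable
      (continuous_coefficient_testForm α k).aestronglyMeasurable
  refine existsUnique_of_exists_of_unique ⟨∑ k, (T₁ k - T₂ k), fun χ hχ hlim α => ?_⟩
    fun T T' hT hT' => ?_
  · have hval : (∑ k, (T₁ k - T₂ k)) α = ∑ k, (∫ x, coefficient α k (π x) ∂(ν₁ k) -
        ∫ x, coefficient α k (π x) ∂(ν₂ k)) := by
      rw [_root_.sum_apply]
      refine Finset.sum_congr rfl fun k _ => ?_
      rw [_root_.sub_apply, hT₁, hT₂, ← hmap, ← hmap]
      rfl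
    rw [hval]
    have hS' : ∀ R, S.toLinearMap (cutoffPullback π (χ R) (hχ R) α) =
        ∑ k, (∫ x, cutoffCoefficient (hχ R) α k x ∂(ν₁ k) -
          ∫ x, cutoffCoefficient (hχ R) α k x ∂(ν₂ k)) := by
      intro R
      rw [cutoffPullback_eq_sum, map_sum]
      exact Finset.sum_congr rfl fun k _ => hν k _
    simp only [hS']
    exact tendsto_finsetSum _ fun k _ => ((h₁ k).tendsto_integral α k hχ hlim).sub
      ((h₂ k).tendsto_integral α k hχ hlim)
  · obtain ⟨_, _, χ, hχ, -, -, -, hlim⟩ := exists_cutoff_family π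
    ext α
    exact tendsto_nhds_unique (hT χ hχ hlim α) (hT' χ hχ hlim α)

end Pushforward

/-! ### Positivity of the push-forward and vanishing for dimension reasons -/

section Positivity

variable {V V' : Type*} [NormedAddCommGroup V] [InnerProductSpace ℝ V] [FiniteDimensional ℝ V]
  [NormedAddCommGroup V'] [InnerProductSpace ℝ V'] [FiniteDimensional ℝ V']

theorem Current.eq_zero_of_finrank_lt {a b : ℕ} (h : finrank ℝ V < a) (T : Current V a b) :
    T = 0 := by
  refine ContinuousLinearMap.ext fun α => ?_
  have h0 : α = 0 := by
    ext1 x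
    exact Subtype.ext ((Submodule.mem_bot ℝ).1 ((bidegree_eq_bot h).le (α x).2))
  rw [h0, map_zero, map_zero]

variable [MeasurableSpace V] [BorelSpace V] {p m : ℕ} {f : Fin p → V → ℝ} {S : MeasureCurrent V m m}

theorem isPositive_pushforward (hS : HasIntersectionProduct f S)
    (hf : ∀ i, ConvexOn ℝ univ (f i)) (h : p + m = finrank ℝ V) {π : V →L[ℝ] V'}
    {T : Current V' m m} (hT : HasPushforward π S T) : T.IsPositive := by
  obtain ⟨_, _, χ, hχ, -, -, -, hlim⟩ := exists_cutoff_family π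
  constructor
  · intro α
    refine tendsto_nhds_unique (hT χ hχ hlim α.J)
      (((hT χ hχ hlim α).const_mul ((-1) ^ m)).congr fun R => ?_)
    rw [← smul_eq_mul, ← map_smul]
    refine (hS.congr hf fun x Θ hΘ => ?_).symm
    change topCoeff V (Θ * (χ R x • pullback V π.toLinearMap (J V' (α (π x))))) =
      topCoeff V (Θ * ((-1 : ℝ) ^ m • (χ R x • pullback V π.toLinearMap (α (π x)))))
    rw [← J_pullback, mul_smul_comm, map_smul,
      topCoeff_J h hΘ (pullback_mem_bidegree π.toLinearMap (α (π x)).2), mul_smul_comm, map_smul,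
      mul_smul_comm, map_smul, smul_eq_mul, smul_eq_mul, smul_eq_mul]
    ring
  · intro β
    refine ge_of_tendsto' (hT χ hχ hlim β.square) fun R => hS.nonneg hf fun x Θ hΘ => ?_
    change 0 ≤ topCoeff V (Θ * (χ R x • pullback V π.toLinearMap
      (sgn m • ((β (π x) : Covector V') * J V' (β (π x))))))
    rw [map_smul, map_mul (pullback V π.toLinearMap), ← J_pullback, mul_smul_comm, map_smul]
    exact smul_nonneg ((hχ R).mem_Icc x).1
      (topCoeff_nonneg h hΘ (pullback_mem_bidegree π.toLinearMap (β (π x)).2))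

end Positivity

/-! ### Closedness of the push-forward -/

section Closed

variable {V V' : Type*} [NormedAddCommGroup V] [InnerProductSpace ℝ V] [FiniteDimensional ℝ V]
  [NormedAddCommGroup V'] [InnerProductSpace ℝ V'] [FiniteDimensional ℝ V']

/-- The differential of a function at a point, as a functional. -/
noncomputable def gradForm (χ : V → ℝ) (x : V) : Dual ℝ V := (fderiv ℝ χ x).toLinearMap

theorem eq_sum_coordFn (a : Dual ℝ V) :
    a = ∑ i, a (stdOrthonormalBasis ℝ V i) • coordFn V i := by
  refine (stdOrthonormalBasis ℝ V).toBasis.ext fun j => ?_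
  simp [coordFn]

theorem dx_gradForm (χ : V → ℝ) (x : V) : dx V (gradForm χ x) =
    ∑ i, fderiv ℝ χ x (stdOrthonormalBasis ℝ V i) • dx V (coordFn V i) := by
  conv_lhs => rw [eq_sum_coordFn (gradForm χ x)]
  simp [gradForm]

theorem contDiff_dx_gradForm {χ : V → ℝ} (hχ : ContDiff ℝ ∞ χ) :
    ContDiff ℝ ∞ fun x => dx V (gradForm χ x) := by
  simp only [dx_gradForm]
  exact ContDiff.sum fun i _ => (contDiff_fderiv_apply hχ _).fun_smul contDiff_const

theorem d_smul {χ : V → ℝ} (hχ : ContDiff ℝ ∞ χ) {A : V → Covector V} (hA : ContDiff ℝ ∞ A)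
    (x : V) : d (fun y => χ y • A y) x = dx V (gradForm χ x) * A x + χ x • d A x := by
  have hfd : ∀ v, fderiv ℝ (fun y => χ y • A y) x v =
      fderiv ℝ χ x v • A x + χ x • fderiv ℝ A x v := by
    intro v
    have h : HasFDerivAt (fun y => χ y • A y) _ x :=
      (hasFDerivAt_of_smooth hχ x).smul (hasFDerivAt_of_smooth hA x)
    rw [h.fderiv]
    simp [add_comm]
  simp only [d, hfd, dx_gradForm, mul_add, Finset.sum_add_distrib, Finset.sum_mul, Finset.smul_sum,
    mul_smul_comm, smul_mul_assoc]

/-- The pull-back commutes with `d`. -/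
theorem d_pullback (π : V →L[ℝ] V') {α : V' → Covector V'} (hα : ContDiff ℝ ∞ α) (x : V) :
    d (fun y => pullback V π.toLinearMap (α (π y))) x = pullback V π.toLinearMap (d α (π x)) := by
  have hfd : ∀ v, fderiv ℝ (fun y => pullback V π.toLinearMap (α (π y))) x v =
      pullback V π.toLinearMap (fderiv ℝ α (π x) (π v)) := by
    intro v
    have h := fderiv_comp_linear (pullback V π.toLinearMap).toLinearMap
      (hα.comp π.contDiff) x v
    have h' : fderiv ℝ (α ∘ π) x v = fderiv ℝ α (π x) (π v) := by
      rw [((hasFDerivAt_of_smooth hα (π x)).comp x π.hasFDerivAt).fderiv]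
      rfl
    rw [h'] at h
    exact h
  have hπ : ∀ v, π v = ∑ j, coordFn V' j (π v) • stdOrthonormalBasis ℝ V' j := fun v => by
    have := (stdOrthonormalBasis ℝ V').toBasis.sum_repr (π v)
    simpa [coordFn] using this.symm
  have hcoord : ∀ j, dx V (coordFn V' j ∘ₗ π.toLinearMap) =
      ∑ i, coordFn V' j (π (stdOrthonormalBasis ℝ V i)) • dx V (coordFn V i) := fun j => by
    conv_lhs => rw [eq_sum_coordFn (coordFn V' j ∘ₗ π.toLinearMap)]
    simp
  calc d (fun y => pullback V π.toLinearMap (α (π y))) x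
      = ∑ i, ∑ j, coordFn V' j (π (stdOrthonormalBasis ℝ V i)) • (dx V (coordFn V i) *
          pullback V π.toLinearMap (fderiv ℝ α (π x) (stdOrthonormalBasis ℝ V' j))) := by
        refine Finset.sum_congr rfl fun i _ => ?_
        rw [hfd, hπ (stdOrthonormalBasis ℝ V i), map_sum, map_sum, Finset.mul_sum]
        simp only [← hπ, map_smul, mul_smul_comm]
    _ = pullback V π.toLinearMap (d α (π x)) := by
        rw [Finset.sum_comm, d, map_sum]
        refine Finset.sum_congr rfl fun j _ => ?_
        rw [map_mul, pullback_dx, hcoord, Finset.sum_mul]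
        simp only [smul_mul_assoc]

variable [MeasurableSpace V] [BorelSpace V] {p m : ℕ}

omit [MeasurableSpace V] [BorelSpace V] in
/-- The Cauchy–Schwarz inequality separates the gradient of a cutoff function from the rest. -/
theorem abs_topCoeff_gradForm_le (h : p + m = finrank ℝ V) {Θ : Covector V}
    (hΘ : Θ ∈ stronglyPositive V p) {e : Dual ℝ V} {κ t : ℝ} (ht : 0 < t)
    (he : ∀ i, |e (stdOrthonormalBasis ℝ V i)| ≤ κ) {a a' : List (Dual ℝ V)}
    (ha : a.length + 1 = m) (ha' : a'.length = m) :
    |topCoeff V (Θ * (dx V e * ((a.map (dx V)).prod * J V (a'.map (dx V)).prod)))| ≤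
      (t * (finrank ℝ V * κ ^ 2 * topCoeff V (Θ * ((a.map elemForm).prod * kahlerForm V ^ 1))) +
        t⁻¹ * topCoeff V (Θ * ((a'.map elemForm).prod * kahlerForm V ^ 0))) / 2 := by
  have hb : ((e :: a).map (dx V)).prod ∈ bidegree V m 0 := by
    have := list_dx_mem (e :: a)
    rwa [List.length_cons, ha] at this
  have hb' : (a'.map (dx V)).prod ∈ bidegree V m 0 := ha' ▸ list_dx_mem a'
  have h1 := abs_topCoeff_le h hΘ hb hb' ht
  have e1 := list_elemForm_eq (e :: a)
  have e2 := list_elemForm_eq a'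
  rw [List.length_cons, ha] at e1
  rw [ha'] at e2
  rw [← e1, ← e2, List.map_cons, List.map_cons, List.prod_cons, List.prod_cons] at h1
  have hP : Θ * (a.map elemForm).prod ∈ stronglyPositive V (p + a.length) :=
    mul_mem_stronglyPositive rfl hΘ (list_elemForm_mem a)
  have h2 := topCoeff_elemForm_le (by omega) hP he
  rw [(commute_elemForm e (a.map elemForm).prod).eq, ← mul_assoc Θ (a.map elemForm).prod] at h1
  rw [pow_one, pow_zero, mul_one, ← mul_assoc Θ _ (kahlerForm V), ← mul_assoc (dx V e)]
  refine h1.trans ?_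
  have := mul_le_mul_of_nonneg_left h2 ht.le
  linarith

theorem integral_cylinder_mono {l : List (V → ℝ)} (hl : ∀ g ∈ l, SmoothConvex g) {r : ℕ}
    {c : Covector V} (hc : c ∈ stronglyPositive V r) (h : l.length + r = finrank ℝ V)
    {a : List (Dual ℝ V)} {B R : ℝ} {Z : Set V} (hZ : Z ⊆ cylinder a B R) :
    ∫ x in Z, density l c x ≤ ∫ x in cylinder a B R, density l c x :=
  setIntegral_mono_set
    ((contDiff_density (fun g hg => (hl g hg).1) c).continuous.continuousOn.integrableOn_compact
      (isCompact_cylinder a B R)) (ae_of_all _ fun x => density_nonneg hl hc h x) hZ.eventuallyLE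

/-- The mass of the terms containing the gradient of the cutoff function tends to zero. -/
theorem exists_gradient_decay {c : ℕ} (h : p + m = finrank ℝ V) (hc : c + 1 = m) (π : V →L[ℝ] V')
    {K M : ℝ} (hM : 0 ≤ M) (ρ : ℝ) {w : Covector V'} (hw : w ∈ bidegree V' c m) :
    ∃ C : ℝ, 0 ≤ C ∧ ∀ (l : List (V → ℝ)) (R : ℝ) (χ : V → ℝ), l.length = p → 1 ≤ R →
      (∀ g ∈ l, BoundedConvex (2 ^ finrank ℝ V * (2 * R)) (M * (2 * R)) g) → ContDiff ℝ ∞ χ →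
      (∀ x i, |fderiv ℝ χ x (stdOrthonormalBasis ℝ V i)| ≤ K / R) →
      ∫ x in tube π ρ ∩ Metric.closedBall 0 (2 * R),
        |topCoeff V (listDD l x * (dx V (gradForm χ x) * pullback V π.toLinearMap w))| ≤ C / √R := by
  have hcompact : ∀ R : ℝ, IsCompact (tube π ρ ∩ Metric.closedBall (0 : V) (2 * R)) := fun R =>
    (isCompact_closedBall _ _).inter_left (isClosed_tube π ρ)
  have hcont : ∀ (l : List (V → ℝ)) (χ : V → ℝ) (u : Covector V) (N D : ℝ),
      (∀ g ∈ l, BoundedConvex N D g) → ContDiff ℝ ∞ χ →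
      Continuous fun x => |topCoeff V (listDD l x * (dx V (gradForm χ x) * u))| :=
    fun l χ u N D hg hχ => (contDiff_linear (topCoeff V) (contDiff_mul
      (isSmoothClosed_listDD fun g hgl => (hg g hgl).1.1).contDiff
      (contDiff_mul (contDiff_dx_gradForm hχ) contDiff_const))).continuous.abs
  -- the forms `w` with such a bound are a subspace, so it suffices to treat products of covectors
  let W : Submodule ℝ (Covector V') :=
    { carrier := {w | ∃ C : ℝ, 0 ≤ C ∧ ∀ (l : List (V → ℝ)) (R : ℝ) (χ : V → ℝ), l.length = p →
        1 ≤ R → (∀ g ∈ l, BoundedConvex (2 ^ finrank ℝ V * (2 * R)) (M * (2 * R)) g) →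
        ContDiff ℝ ∞ χ → (∀ x i, |fderiv ℝ χ x (stdOrthonormalBasis ℝ V i)| ≤ K / R) →
        ∫ x in tube π ρ ∩ Metric.closedBall 0 (2 * R),
          |topCoeff V (listDD l x * (dx V (gradForm χ x) * pullback V π.toLinearMap w))| ≤ C / √R}
      zero_mem' := ⟨0, le_rfl, fun l R χ _ _ _ _ _ => by simp⟩
      add_mem' := by
        rintro w w' ⟨C, hC, hw⟩ ⟨C', hC', hw'⟩
        refine ⟨C + C', add_nonneg hC hC', fun l R χ hl hR hg hχ hK => ?_⟩
        rw [add_div]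
        refine le_trans ?_ (add_le_add (hw l R χ hl hR hg hχ hK) (hw' l R χ hl hR hg hχ hK))
        have i1 := (hcont l χ (pullback V π.toLinearMap w) _ _ hg
          hχ).continuousOn.integrableOn_compact (hcompact R) (μ := volume)
        have i2 := (hcont l χ (pullback V π.toLinearMap w') _ _ hg
          hχ).continuousOn.integrableOn_compact (hcompact R) (μ := volume)
        rw [← integral_add i1 i2]
        refine setIntegral_mono_on ((hcont l χ _ _ _ hg hχ).continuousOn.integrableOn_compact
          (hcompact R)) (i1.add i2) (hcompact R).measurableSet fun x _ => ?_
        rw [map_add, mul_add, mul_add, map_add]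
        exact abs_add_le _ _
      smul_mem' := by
        rintro t w ⟨C, hC, hw⟩
        refine ⟨|t| * C, by positivity, fun l R χ hl hR hg hχ hK => ?_⟩
        simp only [map_smul, mul_smul_comm, smul_eq_mul, abs_mul]
        rw [integral_const_mul, mul_div_assoc]
        exact mul_le_mul_of_nonneg_left (hw l R χ hl hR hg hχ hK) (abs_nonneg _) }
  refine (show bidegree V' c m ≤ W from bidegree_le_span c m W fun b b' hb hb' => ?_) hw
  set a := b.map fun e => e ∘ₗ π.toLinearMap with ha
  set a' := b'.map fun e => e ∘ₗ π.toLinearMap with ha'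
  have hla : a.length = c := by rw [ha, List.length_map, hb]
  have hla' : a'.length = m := by rw [ha', List.length_map, hb']
  obtain ⟨B, hB⟩ := exists_bound_on_tube π b ρ
  obtain ⟨B', hB'⟩ := exists_bound_on_tube π b' ρ
  obtain ⟨C, hC, hcyl⟩ := exists_cylinder_bound p 1 a (by omega) B M hM
  obtain ⟨C', hC', hcyl'⟩ := exists_cylinder_bound p 0 a' (by omega) B' M hM
  refine ⟨finrank ℝ V * K ^ 2 * C + C' / 2, by positivity, fun l R χ hl hR hg hχ hK => ?_⟩
  have hR0 : 0 < R := by linarith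
  have hs : 0 < √R := Real.sqrt_pos.2 hR0
  have sg : ∀ g ∈ l, SmoothConvex g := fun g hgl => (hg g hgl).1
  set P := (a.map elemForm).prod * kahlerForm V ^ 1 with hP
  set P' := (a'.map elemForm).prod * kahlerForm V ^ 0 with hP'
  set Z := tube π ρ ∩ Metric.closedBall (0 : V) (2 * R)
  have mP : P ∈ stronglyPositive V (c + 1) :=
    mul_mem_stronglyPositive rfl (hla ▸ list_elemForm_mem a) (kahlerForm_pow_mem 1)
  have mP' : P' ∈ stronglyPositive V (m + 0) :=
    mul_mem_stronglyPositive rfl (hla' ▸ list_elemForm_mem a') (kahlerForm_pow_mem 0)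
  have b1 : ∫ x in Z, density l P x ≤ C * (2 * R) ^ 1 :=
    (integral_cylinder_mono sg mP (by omega) fun x hx => ⟨hx.2, hB x hx.1⟩).trans
      (hcyl l (2 * R) hl (by linarith) hg)
  have b2 : ∫ x in Z, density l P' x ≤ C' * (2 * R) ^ 0 :=
    (integral_cylinder_mono sg mP' (by omega) fun x hx => ⟨hx.2, hB' x hx.1⟩).trans
      (hcyl' l (2 * R) hl (by linarith) hg)
  have cont : ∀ u, Continuous (density l u) := fun u =>
    (contDiff_density (fun g hgl => (sg g hgl).1) u).continuous
  have i1 : IntegrableOn (density l P) Z := (cont P).continuousOn.integrableOn_compact (hcompact R)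
  have i2 : IntegrableOn (density l P') Z :=
    (cont P').continuousOn.integrableOn_compact (hcompact R)
  -- the weight `√R` balances the gain `R⁻²` from the gradient against the growth `R` of the mass
  calc _ ≤ ∫ x in Z, (√R * (finrank ℝ V * (K / R) ^ 2) / 2 * density l P x +
        (√R)⁻¹ / 2 * density l P' x) := by
        refine setIntegral_mono_on ((hcont l χ _ _ _ hg hχ).continuousOn.integrableOn_compact
          (hcompact R)) ((i1.const_mul _).add (i2.const_mul _)) (hcompact R).measurableSet
          fun x _ => ?_
        have mem := listDD_mem sg x
        rw [hl] at mem
        rw [map_mul (pullback V π.toLinearMap), ← J_pullback, pullback_list_dx, pullback_list_dx]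
        refine (abs_topCoeff_gradForm_le h mem hs (κ := K / R) (hK x) (a := a)
          (by rw [hla, hc]) hla').trans_eq ?_
        rw [density, density]
        ring
    _ = √R * (finrank ℝ V * (K / R) ^ 2) / 2 * (∫ x in Z, density l P x) +
        (√R)⁻¹ / 2 * ∫ x in Z, density l P' x := by
        rw [integral_add (i1.const_mul _) (i2.const_mul _), integral_const_mul, integral_const_mul]
    _ ≤ √R * (finrank ℝ V * (K / R) ^ 2) / 2 * (C * (2 * R) ^ 1) +
        (√R)⁻¹ / 2 * (C' * (2 * R) ^ 0) := by gcongr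
    _ = _ := by
        have hsq : R = √R ^ 2 := (Real.sq_sqrt hR0.le).symm
        generalize √R = s at hs hsq
        subst hsq
        field_simp

variable {f : Fin p → V → ℝ} {S : MeasureCurrent V m m}

/-- For a cutoff function `χ`, integration by parts leaves `d χ ∧ π^* α` as the only term, and its mass
tends to zero as the cutoff functions exhaust the space. -/
theorem isClosed_pushforward (hS : HasIntersectionProduct f S) (hf : ∀ i, f i ∈ LelongClass V)
    (h : p + m = finrank ℝ V) {π : V →L[ℝ] V'} {T : Current V' m m} (hT : HasPushforward π S T) :
    T.IsClosed := by
  intro c hc α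
  obtain ⟨K, -, χ, hχ, sχ, suppχ, dχ, hlim⟩ := exists_cutoff_family π
  obtain ⟨M, hM, hgrow⟩ := hS.exists_growth_bound hf
  obtain ⟨ρ, -, hρ⟩ := exists_pos_radius α.hasCompactSupport_coe
  choose C hC hdecay using fun k => exists_gradient_decay h hc π (K := K) hM ρ
    (finBasis ℝ (bidegree V' c m) k).2
  choose N hN using fun k => (hasCompactSupport_coefficient_testForm α
    k).exists_bound_of_continuous (continuous_coefficient_testForm α k)
  have hN0 : ∀ k, 0 ≤ N k := fun k => (norm_nonneg _).trans (hN k 0)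
  let A : V → Covector V := fun x => pullback V π.toLinearMap (α (π x))
  have sA : ContDiff ℝ ∞ A :=
    contDiff_linear (pullback V π.toLinearMap).toLinearMap (α.contDiff_coe.comp π.contDiff)
  have hA : ∀ x, A x = ∑ k, coefficient α k (π x) •
      pullback V π.toLinearMap (finBasis ℝ (bidegree V' c m) k : Covector V') := by
    intro x
    change pullback V π.toLinearMap _ = _
    rw [sum_coefficient α (π x), map_sum]
    simp only [map_smul]
  have key : ∀ R, 1 ≤ R → |S.toLinearMap (cutoffPullback π (χ R) (hχ R) (α.d hc))| ≤
      (∑ k, N k * C k) / √R := by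
    intro R hR
    have hRm : max R 1 = R := max_eq_left hR
    refine hgrow (2 * R) (by linarith) _ {t | |t| ≤ (∑ k, N k * C k) / √R}
      (isClosed_le continuous_abs continuous_const) fun l hl hg => ?_
    have sl : ∀ g ∈ l, ContDiff ℝ ∞ g := fun g hgl => (hg g hgl).1.1
    have sχR := suppχ R
    have dχR := dχ R
    rw [hRm] at sχR
    simp only [hRm] at dχR
    set Z := tube π ρ ∩ Metric.closedBall (0 : V) (2 * R) with hZ
    have hZc : IsCompact Z := (isCompact_closedBall _ _).inter_left (isClosed_tube π ρ)
    have hgrad : ∀ x ∉ Metric.closedBall (0 : V) (2 * R), gradForm (χ R) x = 0 := by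
      intro x hx
      have : fderiv ℝ (χ R) x = 0 := by
        by_contra hne
        exact hx (sχR (support_fderiv_subset ℝ hne))
      rw [gradForm, this]
      rfl
    let F : V → ℝ := fun x => topCoeff V (listDD l x * (dx V (gradForm (χ R) x) * A x))
    have cF : Continuous F := (contDiff_linear (topCoeff V) (contDiff_mul
      (isSmoothClosed_listDD sl).contDiff (contDiff_mul (contDiff_dx_gradForm (sχ R))
      sA))).continuous
    have hF : ∀ x ∉ Z, F x = 0 := by
      intro x hx
      by_cases hxt : x ∈ tube π ρ
      · have : gradForm (χ R) x = 0 := hgrad x fun hx' => hx ⟨hxt, hx'⟩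
        change topCoeff V (listDD l x * (dx V (gradForm (χ R) x) * A x)) = 0
        rw [this, map_zero, zero_mul, mul_zero, map_zero]
      · have h0 : (α (π x) : Covector V') = 0 := image_eq_zero_of_notMem_tsupport
          (f := fun y => (α y : Covector V'))
          fun hx' => hxt (mem_closedBall_zero_iff.1 (hρ hx'))
        change topCoeff V (listDD l x * (dx V (gradForm (χ R) x) *
          pullback V π.toLinearMap (α (π x)))) = 0
        rw [h0, map_zero, mul_zero, mul_zero, map_zero]
    have iF : Integrable F := cF.integrable_of_hasCompactSupport (HasCompactSupport.intro hZc hF)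
    have iG := integrable_formPairing sl
      (continuous_coe_contForm (cutoffPullback π (χ R) (hχ R) (α.d hc)))
      (hasCompactSupport_coe_contForm (cutoffPullback π (χ R) (hχ R) (α.d hc)))
    -- integration by parts leaves only the term with the gradient of the cutoff function
    have hsum : (∫ x, F x) + formPairing l
        (fun x => (cutoffPullback π (χ R) (hχ R) (α.d hc) x : Covector V)) = 0 := by
      rw [formPairing, ← integral_add iF iG,
        ← (isSmoothClosed_listDD sl).integral_mul_d (fun x u => commute_listDD sl x u)
          ((sχ R).fun_smul sA) (hasCompactSupport_of_tsupport sχR).smul_right]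
      refine integral_congr_ae (ae_of_all _ fun x => ?_)
      change F x + topCoeff V (listDD l x * (χ R x • pullback V π.toLinearMap
        (d (fun y => (α y : Covector V')) (π x)))) = topCoeff V (listDD l x *
          d (fun y => χ R y • A y) x)
      rw [d_smul (sχ R) sA, ← d_pullback π α.contDiff_coe, ← map_add, ← mul_add]
    rw [mem_ofPred_eq, eq_neg_of_add_eq_zero_right hsum, abs_neg,
      ← setIntegral_eq_integral_of_forall_compl_eq_zero hF]
    let G := fun k x => |topCoeff V (listDD l x * (dx V (gradForm (χ R) x) *
      pullback V π.toLinearMap (finBasis ℝ (bidegree V' c m) k : Covector V')))|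
    have iGk : ∀ k, IntegrableOn (fun x => N k * G k x) Z := fun k =>
      (continuous_const.mul (contDiff_linear (topCoeff V) (contDiff_mul
        (isSmoothClosed_listDD sl).contDiff (contDiff_mul (contDiff_dx_gradForm (sχ R))
        contDiff_const))).continuous.abs).continuousOn.integrableOn_compact hZc
    calc |∫ x in Z, F x| ≤ ∫ x in Z, |F x| := abs_integral_le_integral_abs
      _ ≤ ∫ x in Z, ∑ k, N k * G k x := by
          refine setIntegral_mono_on (cF.abs.continuousOn.integrableOn_compact hZc)
            (integrable_finsetSum _ fun k _ => iGk k) hZc.measurableSet fun x _ => ?_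
          change |topCoeff V (listDD l x * (dx V (gradForm (χ R) x) * A x))| ≤ _
          rw [hA, Finset.mul_sum, Finset.mul_sum, map_sum]
          refine (Finset.abs_sum_le_sum_abs _ _).trans (Finset.sum_le_sum fun k _ => ?_)
          rw [mul_smul_comm, mul_smul_comm, map_smul, smul_eq_mul, abs_mul]
          exact mul_le_mul_of_nonneg_right (hN k (π x)) (abs_nonneg _)
      _ = ∑ k, N k * ∫ x in Z, G k x := by
          rw [integral_finsetSum _ fun k _ => iGk k]
          exact Finset.sum_congr rfl fun k _ => integral_const_mul _ _
      _ ≤ ∑ k, N k * (C k / √R) := Finset.sum_le_sum fun k _ =>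
          mul_le_mul_of_nonneg_left (hdecay k l R (χ R) hl hR hg (sχ R) dχR) (hN0 k)
      _ = _ := by simp only [Finset.sum_div, mul_div_assoc]
  have hzero : Tendsto (fun R : ℝ => (∑ k, N k * C k) / √R) atTop (𝓝 0) :=
    tendsto_const_nhds.div_atTop Real.tendsto_sqrt_atTop
  refine tendsto_nhds_unique (hT χ hχ hlim (α.d hc)) (squeeze_zero_norm' ?_ hzero)
  filter_upwards [eventually_ge_atTop 1] with R hR
  exact key R hR

end Closed

end Super

theorem mainTheorem10 (n k p m : ℕ) (hpm : p + m = n)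
    (L : Submodule ℝ (EuclideanSpace ℝ (Fin n))) (hL : Module.finrank ℝ L + k = n)
    (π : EuclideanSpace ℝ (Fin n) →L[ℝ] L) (hπ : ∀ x : L, π x = x)
    (f : Fin p → EuclideanSpace ℝ (Fin n) → ℝ)
    (hf : ∀ i, f i ∈ Super.LelongClass (EuclideanSpace ℝ (Fin n))) :
    (∃! S : Super.MeasureCurrent (EuclideanSpace ℝ (Fin n)) m m,
      Super.HasIntersectionProduct f S) ∧
    ∀ S : Super.MeasureCurrent (EuclideanSpace ℝ (Fin n)) m m,
      Super.HasIntersectionProduct f S →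
        (∃! T : Super.Current L m m, Super.HasPushforward π S T) ∧
        ∀ T : Super.Current L m m, Super.HasPushforward π S T →
          T.IsPositive ∧ T.IsClosed ∧ (p < k → T = 0) := by
  have h : p + m = finrank ℝ (EuclideanSpace ℝ (Fin n)) := by
    rw [finrank_euclideanSpace_fin, hpm]
  have hc : ∀ i, ConvexOn ℝ univ (f i) := fun i => (hf i).1
  refine ⟨Super.existsUnique_intersectionProduct h hc, fun S hS => ⟨?_, fun T hT => ⟨?_, ?_, ?_⟩⟩⟩
  · exact Super.existsUnique_pushforward π fun w => Super.component_pullback_mem hS hf π h w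
  · exact Super.isPositive_pushforward hS hc h hT
  · exact Super.isClosed_pushforward hS hf h hT
  · intro hpk
    exact Super.Current.eq_zero_of_finrank_lt (by omega) T
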